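/- **Setting.** Let $\mathbb R^4_2$ be $\mathbb R^4$ with the product $a\cdot b=-a_1b_1+a_2b_2-a_3b_3+a_4b_4$, let $\mathbb D=\{t=u+\mathrm jv:\ u,v\in\mathbb R,\ \mathrm j^2=1\}$ be the algebra of double numbers, with $\overline{u+\mathrm jv}=u-\mathrm jv$, $|t|^2=t\bar t=u^2-v^2$, $e^{\mathrm j\theta}=\cosh\theta+\mathrm j\sinh\theta$, and extend the product bilinearly to $\mathbb D^4$. Put $\Delta^h=\partial_u^2-\partial_v^2$ and $\frac{\partial}{\partial t}=\frac12(\partial_u+\mathrm j\,\partial_v)$. All functions are $C^\infty$. A regular time-like surface $(\mathcal D_0,\mathrm x)$ is an immersion $\mathrm x:\mathcal D_0\to\mathbb R^4_2$ of an open set $\mathcal D_0\subset\mathbb R^2$ whose induced scalar product is indefinite; it is minimal if its mean curvature vector vanishes. The coordinates $(u,v)$ are isothermal with $E<0$ if $E:=\mathrm x_u^2=-\mathrm x_v^2<0$ and $\mathrm x_u\cdot \mathrm x_v=0$. In such coordinates let $\Phi=\mathrm x_u+\mathrm j\,\mathrm x_v$, $\Phi'=\partial\Phi/\partial t$, and let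 $\Phi'^\bot$ be the projection of $\Phi'$ to the ($\mathbb D$-linear span of the) normal space. A minimal time-like surface is of general type if $|(\Phi'^\bot)^2|^2\ne0$ everywhere. It is of the first, second or third type if, respectively, $(\Phi'^\bot)^2\in\mathbb D_+$, $-(\Phi'^\bot)^2\in\mathbb D_+$, or $\mathrm j(\Phi'^\bot)^2\in\mathbb D_+\cup(-\mathbb D_+)$ everywhere, where $\mathbb D_+=\{t:\ |t|^2>0,\ \operatorname{Re}t>0\}$. Isothermal coordinates with $E<0$ are canonical if $(\Phi'^\bot)^2$ is identically $1$, $-1$, $\mathrm j$ for a surface of the first, second, third type respectively. **Theorem.** Let $E<0$ and $\varphi$ be real functions in a domain $\mathcal D\subset\mathbb R^2$, and let $\varepsilon\in\{1,-1,\mathrm j\}$, $\delta\in\{1,\mathrm j\}$ be constants such that in $\mathcal D$ $$\Delta^h\ln|E|=\frac{2\operatorname{Re}\big(\bar\varepsilon|\delta|^2e^{\mathrm j\varphi}\big)}{E},\qquad \Delta^h\varphi=-\frac{2\operatorname{Im}\big(\bar\varepsilon|\delta|^2e^{\mathrm j\varphi}\big)}{E}.$$ Then for every $p_0\in\mathcal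 D$ there exist a neighbourhood $\mathcal D_0\subset\mathcal D$ of $p_0$ and a map $\mathrm x:\mathcal D_0\to\mathbb R^4_2$ such that: 1. $(\mathcal D_0,\mathrm x)$ is a minimal time-like surface of general type, parametrized by canonical coordinates; 2. $\mathrm x_u^2=E$ on $\mathcal D_0$; 3. there are normal vector fields $\mathrm m_1,\mathrm m_2$ on $\mathcal D_0$ with $\mathrm m_1^2=\mathrm m_2^2=0$, $\mathrm m_1\cdot\mathrm m_2=\frac12$, such that $\big(\mathrm x_u/\sqrt{-E},\ \mathrm x_v/\sqrt{-E},\ \mathrm m_1,\ \mathrm m_2\big)$ is right oriented and $$\Phi'^\bot=\delta e^{\mathrm j\varphi/2}\,\mathrm m_1+\varepsilon\delta e^{-\mathrm j\varphi/2}\,\mathrm m_2 .$$ If $(\mathcal D_0,\mathrm x)$ and $(\hat{\mathcal D}_0,\hat{\mathrm x})$ are two surfaces with these properties (for the same $p_0$), then there are a domain $\tilde{\mathcal D}_0\subset\mathcal D_0\cap\hat{\mathcal D}_0$ containing $p_0$, a matrix $A\in\mathbf{SO}(2,2,\mathbb R)$ (preserving the product, with $\det A=1$) and a vector $b\in\mathbb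 R^4_2$ such that $\hat{\mathrm x}=A\mathrm x+b$ on $\tilde{\mathcal D}_0$. -/

import Mathlib

open scoped ContDiff

noncomputable section

namespace TimelikeR42

/-! ### Double numbers -/

/-- The algebra `𝔻` of double numbers `t = u + j v`, `j² = 1`, with `u = t.re`, `v = t.im`;
conjugation is `star`, and `t.norm` is the real number `|t|² = t * star t = u² - v²`. -/
abbrev DNum : Type := QuadraticAlgebra ℝ 1 0

/-- The unit `j`. -/
def jj : DNum := ⟨0, 1⟩

theorem jj_mul_jj : jj * jj = 1 := by
  ext <;> simp [jj, QuadraticAlgebra.re_one, QuadraticAlgebra.im_one]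

theorem norm_eq (t : DNum) : t.norm = t.re ^ 2 - t.im ^ 2 := by
  simp [QuadraticAlgebra.norm_def]; ring

theorem star_eq (t : DNum) : star t = ⟨t.re, -t.im⟩ := by
  ext <;> simp

/-- `e^{jθ} = cosh θ + j sinh θ`. -/
def expj (θ : ℝ) : DNum := ⟨Real.cosh θ, Real.sinh θ⟩

/-- The set `𝔻₀` of non-invertible double numbers. -/
def nonInvertible : Set DNum := {t | t.norm = 0}

/-- The set `𝔻₊` of "positive" double numbers. -/
def positive : Set DNum := {t | 0 < t.norm ∧ 0 < t.re}

/-! ### The spaces `ℝ⁴₂` and `𝔻⁴₂` -/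

/-- The product `a · b = -a₁b₁ + a₂b₂ - a₃b₃ + a₄b₄`; it is used on `ℝ⁴` (`R = ℝ`) and on `𝔻⁴`
(`R = DNum`). -/
def ip {R : Type} [CommRing R] (a b : Fin 4 → R) : R :=
  -(a 0 * b 0) + a 1 * b 1 - a 2 * b 2 + a 3 * b 3

/-- The inclusion `ℝ⁴₂ ⊂ 𝔻⁴₂`. -/
def toD (a : Fin 4 → ℝ) : Fin 4 → DNum := fun i => ⟨a i, 0⟩

/-- The quadruple `(a, b, c, d)` of vectors of `ℝ⁴` is a right oriented basis. -/
def RightOriented (a b c d : Fin 4 → ℝ) : Prop :=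
  0 < (Matrix.of ![a, b, c, d]).det

/-- A proper linear motion: an element of `SO(2,2,ℝ)`. -/
def IsProperMotion (A : Matrix (Fin 4) (Fin 4) ℝ) : Prop :=
  (∀ a b : Fin 4 → ℝ, ip (A.mulVec a) (A.mulVec b) = ip a b) ∧ A.det = 1

/-! ### Partial derivatives on the `(u, v)`-plane, `t = u + j v` -/

section Derivatives

variable {V : Type} [NormedAddCommGroup V] [NormedSpace ℝ V]

/-- `∂f/∂u`. -/
def du (f : ℝ × ℝ → V) (p : ℝ × ℝ) : V := fderiv ℝ f p (1, 0)

/-- `∂f/∂v`. -/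
def dv (f : ℝ × ℝ → V) (p : ℝ × ℝ) : V := fderiv ℝ f p (0, 1)

/-- The hyperbolic Laplacian `Δʰ f = f_uu - f_vv`. -/
def hypLaplacian (f : ℝ × ℝ → V) (p : ℝ × ℝ) : V := du (du f) p - dv (dv f) p

end Derivatives

/-- `∂f/∂t = (f_u + j f_v) / 2` for a function `f = g + j h` with values in `𝔻`. -/
def dt (f : ℝ × ℝ → DNum) (p : ℝ × ℝ) : DNum :=
  (1 / 2 : ℝ) •
    ((⟨du (fun q => (f q).re) p, du (fun q => (f q).im) p⟩ : DNum) +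
      jj * (⟨dv (fun q => (f q).re) p, dv (fun q => (f q).im) p⟩ : DNum))

/-! ### Time-like surfaces in `ℝ⁴₂` -/

/-- Coefficients of the first fundamental form. -/
def coeffE (x : ℝ × ℝ → Fin 4 → ℝ) (p : ℝ × ℝ) : ℝ := ip (du x p) (du x p)

/-- Coefficients of the first fundamental form. -/
def coeffF (x : ℝ × ℝ → Fin 4 → ℝ) (p : ℝ × ℝ) : ℝ := ip (du x p) (dv x p)

/-- Coefficients of the first fundamental form. -/
def coeffG (x : ℝ × ℝ → Fin 4 → ℝ) (p : ℝ × ℝ) : ℝ := ip (dv x p) (dv x p)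

/-- `(U, x)` is a regular time-like surface: `x` is a smooth immersion of the open set `U`, and the
scalar product induced on each tangent space is indefinite. -/
structure IsTimelikeSurface (U : Set (ℝ × ℝ)) (x : ℝ × ℝ → Fin 4 → ℝ) : Prop where
  isOpen : IsOpen U
  smooth : ContDiffOn ℝ ∞ x U
  immersion : ∀ p ∈ U, Function.Injective (fderiv ℝ x p)
  indefinite : ∀ p ∈ U, ∃ ξ η : ℝ × ℝ,
    ip (fderiv ℝ x p ξ) (fderiv ℝ x p ξ) < 0 ∧ 0 < ip (fderiv ℝ x p η) (fderiv ℝ x p η)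

/-- The orthogonal projection `a^⊥` of `a ∈ ℝ⁴₂` into the normal space of `x` at `p`, that is, `a`
minus its tangential projection (computed in the basis `x_u, x_v`). -/
def normalPart (x : ℝ × ℝ → Fin 4 → ℝ) (p : ℝ × ℝ) (a : Fin 4 → ℝ) : Fin 4 → ℝ :=
  a - (((ip a (du x p) * coeffG x p - ip a (dv x p) * coeffF x p) /
          (coeffE x p * coeffG x p - coeffF x p ^ 2)) • du x p +
       ((ip a (dv x p) * coeffE x p - ip a (du x p) * coeffF x p) /
          (coeffE x p * coeffG x p - coeffF x p ^ 2)) • dv x p)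

/-- The orthogonal projection `a^⊥` of `a ∈ 𝔻⁴₂` into the complexified normal space, which is the
`𝔻`-linear span of the real normal space. -/
def normalPartD (x : ℝ × ℝ → Fin 4 → ℝ) (p : ℝ × ℝ) (a : Fin 4 → DNum) : Fin 4 → DNum :=
  fun i => ⟨normalPart x p (fun k => (a k).re) i, normalPart x p (fun k => (a k).im) i⟩

/-- The second fundamental form `σ(X, Y) = (∇_X Y)^⊥`, for tangent vectors given by their coordinate
vectors `X = x_* ξ`, `Y = x_* η`. -/
def sff (x : ℝ × ℝ → Fin 4 → ℝ) (p : ℝ × ℝ) (ξ η : ℝ × ℝ) : Fin 4 → ℝ :=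
  normalPart x p (fderiv ℝ (fderiv ℝ x) p ξ η)

/-- The mean curvature vector `H = (1/2) trace σ`, the trace being taken with respect to the first
fundamental form. -/
def meanCurvature (x : ℝ × ℝ → Fin 4 → ℝ) (p : ℝ × ℝ) : Fin 4 → ℝ :=
  (1 / (2 * (coeffE x p * coeffG x p - coeffF x p ^ 2))) •
    (coeffG x p • sff x p (1, 0) (1, 0)
      - coeffF x p • (sff x p (1, 0) (0, 1) + sff x p (0, 1) (1, 0))
      + coeffE x p • sff x p (0, 1) (0, 1))

/-- A minimal time-like surface: `H = 0`. -/
structure IsMinimalSurface (U : Set (ℝ × ℝ)) (x : ℝ × ℝ → Fin 4 → ℝ) : Prop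
    extends IsTimelikeSurface U x where
  minimal : ∀ p ∈ U, meanCurvature x p = 0

/-- The coordinates `(u, v)` are isothermal with `E < 0`. -/
def IsIsothermal (U : Set (ℝ × ℝ)) (x : ℝ × ℝ → Fin 4 → ℝ) : Prop :=
  ∀ p ∈ U, coeffE x p = -coeffG x p ∧ coeffF x p = 0 ∧ coeffE x p < 0

/-! ### The function `Φ`, the type of a surface, canonical coordinates -/

/-- `Φ = 2 ∂x/∂t = x_u + j x_v`. -/
def Phi (x : ℝ × ℝ → Fin 4 → ℝ) (p : ℝ × ℝ) : Fin 4 → DNum := fun i => ⟨du x p i, dv x p i⟩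

/-- `Φ' = ∂Φ/∂t`. -/
def PhiPrime (x : ℝ × ℝ → Fin 4 → ℝ) (p : ℝ × ℝ) : Fin 4 → DNum := fun i => dt (fun q => Phi x q i) p

/-- `Φ'^⊥`, the normal projection of `Φ'`. -/
def PhiPrimePerp (x : ℝ × ℝ → Fin 4 → ℝ) (p : ℝ × ℝ) : Fin 4 → DNum := normalPartD x p (PhiPrime x p)

/-- The scalar square `(Φ'^⊥)²`. -/
def PhiPerpSq (x : ℝ × ℝ → Fin 4 → ℝ) (p : ℝ × ℝ) : DNum := ip (PhiPrimePerp x p) (PhiPrimePerp x p)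

/-- A minimal time-like surface in isothermal coordinates with `E < 0` is of general type if it has
no degenerate points, i.e. no points with `(Φ'^⊥)² ∈ 𝔻₀`. -/
structure IsGeneralType (U : Set (ℝ × ℝ)) (x : ℝ × ℝ → Fin 4 → ℝ) : Prop
    extends IsMinimalSurface U x where
  isothermal : IsIsothermal U x
  nondegenerate : ∀ p ∈ U, PhiPerpSq x p ∉ nonInvertible

/-- First type: `(Φ'^⊥)² ∈ 𝔻₊`. -/
def IsFirstType (U : Set (ℝ × ℝ)) (x : ℝ × ℝ → Fin 4 → ℝ) : Prop :=
  ∀ p ∈ U, PhiPerpSq x p ∈ positive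

/-- Second type: `-(Φ'^⊥)² ∈ 𝔻₊`. -/
def IsSecondType (U : Set (ℝ × ℝ)) (x : ℝ × ℝ → Fin 4 → ℝ) : Prop :=
  ∀ p ∈ U, -PhiPerpSq x p ∈ positive

/-- Third type: `± j (Φ'^⊥)² ∈ 𝔻₊`. -/
def IsThirdType (U : Set (ℝ × ℝ)) (x : ℝ × ℝ → Fin 4 → ℝ) : Prop :=
  ∀ p ∈ U, jj * PhiPerpSq x p ∈ positive ∨ -(jj * PhiPerpSq x p) ∈ positive

/-- `(U, x)` is a minimal time-like surface of general type parametrized by canonical coordinates: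
`(Φ'^⊥)²` is `1`, `-1` or `j` according to the type of the surface. -/
structure IsCanonical (U : Set (ℝ × ℝ)) (x : ℝ × ℝ → Fin 4 → ℝ) : Prop
    extends IsGeneralType U x where
  canonical :
    (IsFirstType U x ∧ ∀ p ∈ U, PhiPerpSq x p = 1) ∨
    (IsSecondType U x ∧ ∀ p ∈ U, PhiPerpSq x p = -1) ∨
    (IsThirdType U x ∧ ∀ p ∈ U, PhiPerpSq x p = jj)

/-- The unit tangent field `X₁ = x_u / √(-E)`. -/
def frameX1 (x : ℝ × ℝ → Fin 4 → ℝ) (p : ℝ × ℝ) : Fin 4 → ℝ := (√(-coeffE x p))⁻¹ • du x p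

/-- The unit tangent field `X₂ = x_v / √G`. -/
def frameX2 (x : ℝ × ℝ → Fin 4 → ℝ) (p : ℝ × ℝ) : Fin 4 → ℝ := (√(coeffG x p))⁻¹ • dv x p

/-- `(m₁, m₂)` is a pair of smooth isotropic normal vector fields along `(U, x)` such that
`m₁ · m₂ = 1/2` and `(X₁, X₂, m₁, m₂)` is right oriented. -/
structure IsIsotropicNormalFrame (U : Set (ℝ × ℝ)) (x m₁ m₂ : ℝ × ℝ → Fin 4 → ℝ) : Prop where
  smooth₁ : ContDiffOn ℝ ∞ m₁ U
  smooth₂ : ContDiffOn ℝ ∞ m₂ U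
  normal₁ : ∀ p ∈ U, ip (m₁ p) (du x p) = 0 ∧ ip (m₁ p) (dv x p) = 0
  normal₂ : ∀ p ∈ U, ip (m₂ p) (du x p) = 0 ∧ ip (m₂ p) (dv x p) = 0
  isotropic : ∀ p ∈ U, ip (m₁ p) (m₁ p) = 0 ∧ ip (m₂ p) (m₂ p) = 0
  product : ∀ p ∈ U, ip (m₁ p) (m₂ p) = 1 / 2
  oriented : ∀ p ∈ U, RightOriented (frameX1 x p) (frameX2 x p) (m₁ p) (m₂ p)

/-- `Φ'^⊥ = δ e^{jφ/2} m₁ + ε δ e^{-jφ/2} m₂` on `U` for some isotropic normal frame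
`(m₁, m₂)`. -/
def HasRepresentation (U : Set (ℝ × ℝ)) (x : ℝ × ℝ → Fin 4 → ℝ) (φ : ℝ × ℝ → ℝ) (ε δ : DNum) :
    Prop :=
  ∃ m₁ m₂ : ℝ × ℝ → Fin 4 → ℝ, IsIsotropicNormalFrame U x m₁ m₂ ∧
    ∀ p ∈ U, PhiPrimePerp x p =
      (δ * expj (φ p / 2)) • toD (m₁ p) + (ε * δ * expj (-(φ p / 2))) • toD (m₂ p)

/-- `(U, x)` is a minimal time-like surface of general type in canonical coordinates, with first
coefficient `E` and with `Φ'^⊥` represented through `φ`, `ε`, `δ`. -/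
structure IsSurfaceWithData (U : Set (ℝ × ℝ)) (x : ℝ × ℝ → Fin 4 → ℝ) (E φ : ℝ × ℝ → ℝ)
    (ε δ : DNum) : Prop extends IsCanonical U x where
  coeffE_eq : ∀ p ∈ U, coeffE x p = E p
  representation : HasRepresentation U x φ ε δ

/-- The system of natural equations for `E < 0`, `φ`, `ε`, `δ` on `D`. -/
structure SolvesNaturalSystem (D : Set (ℝ × ℝ)) (E φ : ℝ × ℝ → ℝ) (ε δ : DNum) : Prop where
  E_neg : ∀ p ∈ D, E p < 0
  eps : ε = 1 ∨ ε = -1 ∨ ε = jj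
  del : δ = 1 ∨ δ = jj
  eq_E : ∀ p ∈ D, hypLaplacian (fun q => Real.log |E q|) p =
    2 * (δ.norm • (star ε * expj (φ p))).re / E p
  eq_phi : ∀ p ∈ D, hypLaplacian φ p =
    -(2 * (δ.norm • (star ε * expj (φ p))).im / E p)

/-! ### Checks of the definitions -/

theorem ip_normalPart (x : ℝ × ℝ → Fin 4 → ℝ) (p : ℝ × ℝ) (a : Fin 4 → ℝ)
    (h : coeffE x p * coeffG x p - coeffF x p ^ 2 ≠ 0) :
    ip (normalPart x p a) (du x p) = 0 ∧ ip (normalPart x p a) (dv x p) = 0 := by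
  set W := coeffE x p * coeffG x p - coeffF x p ^ 2 with hW
  have key : ∀ (r s : ℝ) (b c d y : Fin 4 → ℝ),
      ip (b - (r • c + s • d)) y = ip b y - (r * ip c y + s * ip d y) := by
    intro r s b c d y
    simp only [ip, Pi.sub_apply, Pi.add_apply, Pi.smul_apply, smul_eq_mul]
    ring
  have hs : ip (dv x p) (du x p) = coeffF x p := by
    simp only [coeffF, ip]; ring
  have hE : ip (du x p) (du x p) = coeffE x p := rfl
  have hF : ip (du x p) (dv x p) = coeffF x p := rfl
  have hG : ip (dv x p) (dv x p) = coeffG x p := rfl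
  constructor
  · rw [normalPart, key, hs, hE, ← hW]
    field_simp
    rw [hW]; ring
  · rw [normalPart, key, hF, hG, ← hW]
    field_simp
    rw [hW]; ring

/-- In an orthonormal tangent frame `X₁² = -1`, `X₂² = 1`, the inverse of the first fundamental form
is `-X₁ ⊗ X₁ + X₂ ⊗ X₂`. Hence `meanCurvature` is `(-σ(X₁, X₁) + σ(X₂, X₂)) / 2`. -/
theorem inverse_metric (E F G a b c d : ℝ)
    (h1 : a ^ 2 * E + 2 * a * b * F + b ^ 2 * G = -1)
    (h2 : c ^ 2 * E + 2 * c * d * F + d ^ 2 * G = 1)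
    (h3 : a * c * E + (a * d + b * c) * F + b * d * G = 0) :
    G = (E * G - F ^ 2) * (-a ^ 2 + c ^ 2) ∧
    -F = (E * G - F ^ 2) * (-(a * b) + c * d) ∧
    E = (E * G - F ^ 2) * (-b ^ 2 + d ^ 2) := by
  have e1 : (a * d - b * c) * (a * F + b * G) = c := by linear_combination a * h3 - c * h1
  have e2 : (a * d - b * c) * (a * E + b * F) = -d := by linear_combination d * h1 - b * h3
  have e3 : (a * d - b * c) * (c * F + d * G) = a := by linear_combination a * h2 - c * h3
  have e4 : (a * d - b * c) * (c * E + d * F) = -b := by linear_combination d * h3 - b * h2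
  have w : (E * G - F ^ 2) * (a * d - b * c) ^ 2 = -1 := by
    linear_combination (c ^ 2 * E + 2 * c * d * F + d ^ 2 * G) * h1 - h2
      - (a * c * E + (a * d + b * c) * F + b * d * G) * h3
  refine ⟨?_, ?_, ?_⟩
  · linear_combination G * w - (E * G - F ^ 2) * (a * e3 - c * e1)
  · linear_combination -F * w - (E * G - F ^ 2) * (-(a * e4) + c * e2) 
  · linear_combination E * w - (E * G - F ^ 2) * (-b * e4 + d * e2)

end TimelikeR42

end

noncomputable section

namespace TimelikeR42

/-! ### Linear total differential equations in two variables -/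

section Frobenius

open Set Metric MeasureTheory Filter Topology

variable {V : Type*} [NormedAddCommGroup V] [NormedSpace ℝ V]

/-! The argument is the fundamental theorem of surface theory, carried out in null directions. The
algebra of double numbers splits as `ℝ × ℝ` by sending `t` to `t.re + t.im` and `t.re - t.im`.
Accordingly the moving frame is `(x_u + x_v)/2, (x_u - x_v)/2, m₁, m₂`, whose only nonzero products
are `E/2` and `1/2`. Minimality in isothermal coordinates is the wave equation `x_uu = x_vv`, so the
first frame vector is constant along `∂_u - ∂_v` and the second along `∂_u + ∂_v`. The Gauss and
Weingarten formulas become a linear system `M_u = (P + Q) M`, `M_v = (P - Q) M`, where `P` and `Q`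
depend only on `E`, `φ`, `ε`, `δ`.

Existence. The zero-curvature condition for this system consists of identities and the two natural
equations (`coef_compat`, `natural_system_null`, `coefUV_compat`). A Frobenius theorem for linear
systems in two variables (`LocalSystem.exists_solution`, `exists_solvesFrame`) then gives a frame
with any initial value. The prescribed Gram matrix satisfies the same linear equation as the Gram
matrix of the solution, so it persists from the centre (`SolvesFrame.frameGram_eq`). The one-form
with coefficients `M 0 + M 1`, `M 0 - M 1` is closed, and a primitive is the surface
(`exists_primitive`, `isSurfaceWithData_of_frame`).

Uniqueness. The null frame of any surface with the given data solves the same system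
(`IsSurfaceWithData.solvesFrame`). The representation of `Φ'^⊥` gives the Gauss formulas; the
remaining rotation coefficient of `m₁, m₂` is forced because the second derivatives are again
constant in a null direction (`solvesFrame_of_gauss`). Two frames at `p₀` with equal Gram matrices
and orientation differ by a proper motion (`exists_motion`). A constant motion carries solutions to
solutions, so uniqueness for the linear system makes the frames, and hence the differentials, agree
after the motion. -/

/-- The retraction of `ℝ` onto `[a - r, a + r]`. -/
def clamp (a r s : ℝ) : ℝ := max (a - r) (min s (a + r))

theorem continuous_clamp (a r : ℝ) : Continuous (clamp a r) := by
  unfold clamp; fun_prop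

theorem abs_clamp_sub_le {a r : ℝ} (hr : 0 ≤ r) (s : ℝ) : |clamp a r s - a| ≤ r := by
  unfold clamp
  rw [abs_le]
  constructor
  · linarith [le_max_left (a - r) (min s (a + r))]
  · have : max (a - r) (min s (a + r)) ≤ a + r :=
      max_le (by linarith) (min_le_right _ _)
    linarith

theorem clamp_eq {a r s : ℝ} (hs : |s - a| ≤ r) : clamp a r s = s := by
  rw [abs_le] at hs
  unfold clamp
  rw [min_eq_left (by linarith), max_eq_right (by linarith)]

theorem norm_integral_clamp_le {f : ℝ → V} {a r K : ℝ} (hr : 0 ≤ r) (hK : 0 ≤ K)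
    (hf : ∀ s, ‖f s‖ ≤ K) (x : ℝ) : ‖∫ s in a..clamp a r x, f s‖ ≤ K * r :=
  (intervalIntegral.norm_integral_le_of_norm_le_const fun s _ => hf s).trans
    (mul_le_mul_of_nonneg_left (abs_clamp_sub_le hr x) hK)

/-- The integral operator whose fixed points solve the axis equation in the first variable and then
the equation in the second variable. -/
def axisOperator (A B : ℝ × ℝ → V →L[ℝ] V) (p₀ : ℝ × ℝ) (r : ℝ) (y₀ : V) (y : ℝ × ℝ → V)
    (p : ℝ × ℝ) : V :=
  y₀ + (∫ s in p₀.1..clamp p₀.1 r p.1, A (s, p₀.2) (y (s, p₀.2))) +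
    ∫ t in p₀.2..clamp p₀.2 r p.2, B (p.1, t) (y (p.1, t))

theorem continuous_axisOperator {A B : ℝ × ℝ → V →L[ℝ] V} (hA : Continuous A) (hB : Continuous B)
    (p₀ : ℝ × ℝ) (r : ℝ) (y₀ : V) {y : ℝ × ℝ → V} (hy : Continuous y) :
    Continuous (axisOperator A B p₀ r y₀ y) := by
  unfold axisOperator
  refine (continuous_const.add ?_).add ?_
  · refine intervalIntegral.continuous_parametric_intervalIntegral_of_continuous
      (f := fun (_ : ℝ × ℝ) s => A (s, p₀.2) (y (s, p₀.2))) ?_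
      ((continuous_clamp _ _).comp continuous_fst)
    simp only [Function.uncurry_def]
    fun_prop
  · refine intervalIntegral.continuous_parametric_intervalIntegral_of_continuous
      (f := fun (p : ℝ × ℝ) t => B (p.1, t) (y (p.1, t))) ?_
      ((continuous_clamp _ _).comp continuous_snd)
    simp only [Function.uncurry_def]
    fun_prop

theorem axisOperator_sub {A B : ℝ × ℝ → V →L[ℝ] V} (hA : Continuous A) (hB : Continuous B)
    (p₀ : ℝ × ℝ) (r : ℝ) (y₀ : V) {y z : ℝ × ℝ → V} (hy : Continuous y) (hz : Continuous z)
    (p : ℝ × ℝ) :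
    axisOperator A B p₀ r y₀ y p - axisOperator A B p₀ r y₀ z p =
      (∫ s in p₀.1..clamp p₀.1 r p.1, A (s, p₀.2) (y (s, p₀.2) - z (s, p₀.2))) +
        ∫ t in p₀.2..clamp p₀.2 r p.2, B (p.1, t) (y (p.1, t) - z (p.1, t)) := by
  simp only [axisOperator, map_sub]
  rw [intervalIntegral.integral_sub, intervalIntegral.integral_sub]
  · abel
  all_goals exact Continuous.intervalIntegrable (by fun_prop) _ _

theorem norm_axis_integrals_le {A B : ℝ × ℝ → V →L[ℝ] V} {C r K : ℝ} (hC : 0 ≤ C) (hr : 0 ≤ r)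
    (hK : 0 ≤ K) (hAC : ∀ p, ‖A p‖ ≤ C) (hBC : ∀ p, ‖B p‖ ≤ C) (p₀ : ℝ × ℝ) {y : ℝ × ℝ → V}
    (hy : ∀ p, ‖y p‖ ≤ K) (p : ℝ × ℝ) :
    ‖(∫ s in p₀.1..clamp p₀.1 r p.1, A (s, p₀.2) (y (s, p₀.2))) +
        ∫ t in p₀.2..clamp p₀.2 r p.2, B (p.1, t) (y (p.1, t))‖ ≤ 2 * (C * r) * K := by
  have hCK : 0 ≤ C * K := mul_nonneg hC hK
  have h1 := norm_integral_clamp_le (a := p₀.1) hr hCK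
    (fun s => ((A (s, p₀.2)).le_opNorm (y (s, p₀.2))).trans
      (mul_le_mul (hAC _) (hy _) (norm_nonneg _) hC)) p.1
  have h2 := norm_integral_clamp_le (a := p₀.2) hr hCK
    (fun t => ((B (p.1, t)).le_opNorm (y (p.1, t))).trans
      (mul_le_mul (hBC _) (hy _) (norm_nonneg _) hC)) p.2
  refine (norm_add_le _ _).trans ((add_le_add h1 h2).trans (le_of_eq ?_))
  ring

/-- Banach's fixed point theorem on bounded continuous functions on the whole plane. Each integral
contributes a factor `C * r`, so `C * r ≤ 1/4` gives contraction constant `1/2`; the clamped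
endpoints keep the integration length at most `r` everywhere. -/
theorem exists_axisOperator_fixed [CompleteSpace V] {A B : ℝ × ℝ → V →L[ℝ] V} (hA : Continuous A)
    (hB : Continuous B) {C r : ℝ} (hC : 0 ≤ C) (hr : 0 ≤ r) (hAC : ∀ p, ‖A p‖ ≤ C)
    (hBC : ∀ p, ‖B p‖ ≤ C) (hCr : C * r ≤ 1 / 4) (p₀ : ℝ × ℝ) (y₀ : V) :
    ∃ y : ℝ × ℝ → V, Continuous y ∧ (∃ K, ∀ p, ‖y p‖ ≤ K) ∧
      ∀ p, y p = axisOperator A B p₀ r y₀ y p := by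
  let T : BoundedContinuousFunction (ℝ × ℝ) V → BoundedContinuousFunction (ℝ × ℝ) V := fun y =>
    BoundedContinuousFunction.ofNormedAddCommGroup (axisOperator A B p₀ r y₀ y)
      (continuous_axisOperator hA hB p₀ r y₀ y.continuous) (‖y₀‖ + 2 * (C * r) * ‖y‖) fun p => by
        unfold axisOperator
        rw [add_assoc]
        exact (norm_add_le _ _).trans (add_le_add le_rfl
          (norm_axis_integrals_le hC hr (norm_nonneg _) hAC hBC p₀ y.norm_coe_le_norm p))
  have hT : ContractingWith (1 / 2) T := by
    refine ⟨by rw [← NNReal.coe_lt_coe]; norm_num, LipschitzWith.of_dist_le_mul fun y z => ?_⟩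
    refine (BoundedContinuousFunction.dist_le (by positivity)).2 fun p => ?_
    have h := norm_axis_integrals_le hC hr (norm_nonneg (y - z)) hAC hBC p₀
      (y - z).norm_coe_le_norm p
    rw [dist_eq_norm, dist_eq_norm]
    change ‖axisOperator A B p₀ r y₀ y p - axisOperator A B p₀ r y₀ z p‖ ≤ _
    rw [axisOperator_sub hA hB p₀ r y₀ y.continuous z.continuous]
    refine h.trans (mul_le_mul_of_nonneg_right ?_ (norm_nonneg _))
    push_cast
    linarith
  have hfix := hT.fixedPoint_isFixedPt
  set y := hT.fixedPoint
  refine ⟨y, y.continuous, ⟨‖y‖, y.norm_coe_le_norm⟩, fun p => ?_⟩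
  exact congrArg (fun f : BoundedContinuousFunction (ℝ × ℝ) V => f p) hfix.symm

end Frobenius

/-! ### Frobenius theorem: compatible linear systems on a small square -/

section Frobenius

open Set Metric MeasureTheory Filter Topology

variable {V : Type} [NormedAddCommGroup V] [NormedSpace ℝ V]

theorem hasDerivAt_fst {f : ℝ × ℝ → V} {p : ℝ × ℝ} (hf : DifferentiableAt ℝ f p) :
    HasDerivAt (fun s => f (s, p.2)) (du f p) p.1 :=
  hf.hasFDerivAt.comp_hasDerivAt (f := fun s : ℝ => (s, p.2)) p.1
    ((hasDerivAt_id p.1).prodMk (hasDerivAt_const p.1 p.2))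

theorem hasDerivAt_snd {f : ℝ × ℝ → V} {p : ℝ × ℝ} (hf : DifferentiableAt ℝ f p) :
    HasDerivAt (fun t => f (p.1, t)) (dv f p) p.2 :=
  hf.hasFDerivAt.comp_hasDerivAt (f := fun t : ℝ => (p.1, t)) p.2
    ((hasDerivAt_const p.2 p.1).prodMk (hasDerivAt_id p.2))

theorem mem_ball_prod_iff {p₀ p : ℝ × ℝ} {r : ℝ} :
    p ∈ ball p₀ r ↔ |p.1 - p₀.1| < r ∧ |p.2 - p₀.2| < r := by
  rw [mem_ball, Prod.dist_eq, max_lt_iff, Real.dist_eq, Real.dist_eq]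

theorem mem_closedBall_prod_iff {p₀ p : ℝ × ℝ} {r : ℝ} :
    p ∈ closedBall p₀ r ↔ |p.1 - p₀.1| ≤ r ∧ |p.2 - p₀.2| ≤ r := by
  rw [mem_closedBall, Prod.dist_eq, max_le_iff, Real.dist_eq, Real.dist_eq]

theorem abs_sub_le_of_mem_uIcc {a b s : ℝ} (hs : s ∈ uIcc a b) : |s - a| ≤ |b - a| := by
  rw [abs_sub_comm, abs_sub_comm b a]
  rcases le_total a b with h | h
  · rw [uIcc_of_le h] at hs
    rw [abs_of_nonpos, abs_of_nonpos] <;> linarith [hs.1, hs.2]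
  · rw [uIcc_of_ge h] at hs
    rw [abs_of_nonneg, abs_of_nonneg] <;> linarith [hs.1, hs.2]

theorem mem_ball_of_mem_uIcc_fst {p₀ p : ℝ × ℝ} {r s : ℝ} (hp : p ∈ ball p₀ r)
    (hs : s ∈ uIcc p₀.1 p.1) : (s, p.2) ∈ ball p₀ r := by
  rw [mem_ball_prod_iff] at hp ⊢
  exact ⟨(abs_sub_le_of_mem_uIcc hs).trans_lt hp.1, hp.2⟩

/-- The defect `h` of a candidate solution, controlled by its own supremum through its derivative
in the second variable, vanishes. -/
theorem eq_zero_of_hasDerivAt_snd_bound {h : ℝ × ℝ → V} {p₀ : ℝ × ℝ} {r M K : ℝ} (hK : 0 ≤ K)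
    (hKr : K * r ≤ 1 / 2) (hM : ∀ p ∈ ball p₀ r, ‖h p‖ ≤ M)
    (h0 : ∀ p ∈ ball p₀ r, h (p.1, p₀.2) = 0)
    (hd : ∀ N, (∀ p ∈ ball p₀ r, ‖h p‖ ≤ N) → ∀ p ∈ ball p₀ r,
      ∃ w, HasDerivAt (fun t => h (p.1, t)) w p.2 ∧ ‖w‖ ≤ K * N)
    {p : ℝ × ℝ} (hp : p ∈ ball p₀ r) : h p = 0 := by
  have key : ∀ n : ℕ, ∀ p ∈ ball p₀ r, ‖h p‖ ≤ M * (1 / 2) ^ n := by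
    intro n
    induction n with
    | zero => simpa using hM
    | succ n ih =>
      intro p hp
      have hN : 0 ≤ M * (1 / 2) ^ n := (norm_nonneg _).trans (ih p hp)
      have hp' := mem_ball_prod_iff.1 hp
      have hr : 0 < r := (abs_nonneg _).trans_lt hp'.1
      have hmem : ∀ t ∈ Ioo (p₀.2 - r) (p₀.2 + r), (p.1, t) ∈ ball p₀ r := fun t ht =>
        mem_ball_prod_iff.2 ⟨hp'.1, abs_lt.2 ⟨by linarith [ht.1], by linarith [ht.2]⟩⟩
      have hbound := (convex_Ioo (p₀.2 - r) (p₀.2 + r)).norm_image_sub_le_of_norm_deriv_le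
        (f := fun t => h (p.1, t)) (C := K * (M * (1 / 2) ^ n)) (x := p₀.2) (y := p.2)
        (fun t ht => by
          obtain ⟨w, hw, -⟩ := hd _ ih _ (hmem t ht)
          exact hw.differentiableAt)
        (fun t ht => by
          obtain ⟨w, hw, hwK⟩ := hd _ ih _ (hmem t ht)
          rw [hw.deriv]
          exact hwK)
        ⟨by linarith, by linarith⟩
        ⟨by linarith [(abs_lt.1 hp'.2).1], by linarith [(abs_lt.1 hp'.2).2]⟩
      rw [h0 p hp, sub_zero] at hbound
      refine hbound.trans ?_
      calc K * (M * (1 / 2) ^ n) * ‖p.2 - p₀.2‖ ≤ K * (M * (1 / 2) ^ n) * r :=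
            mul_le_mul_of_nonneg_left hp'.2.le (mul_nonneg hK hN)
        _ = K * r * (M * (1 / 2) ^ n) := by ring
        _ ≤ 1 / 2 * (M * (1 / 2) ^ n) := mul_le_mul_of_nonneg_right hKr hN
        _ = M * (1 / 2) ^ (n + 1) := by ring
  have hlim : Tendsto (fun n : ℕ => M * (1 / 2 : ℝ) ^ n) atTop (𝓝 0) := by
    simpa using (tendsto_pow_atTop_nhds_zero_of_lt_one (r := (1 / 2 : ℝ))
      (by norm_num) (by norm_num)).const_mul M
  exact norm_le_zero_iff.1 (ge_of_tendsto' hlim fun n => key n p hp)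

/-- The frame equations `Y_u = A Y`, `Y_v = B Y` as a total derivative. -/
def totalForm (a b : V) : ℝ × ℝ →L[ℝ] V :=
  (ContinuousLinearMap.toSpanSingleton ℝ a).coprod (ContinuousLinearMap.toSpanSingleton ℝ b)

@[simp]
theorem totalForm_apply (a b : V) (w : ℝ × ℝ) : totalForm a b w = w.1 • a + w.2 • b := by
  simp [totalForm]

theorem fderiv_eq_totalForm (f : ℝ × ℝ → V) (p : ℝ × ℝ) :
    fderiv ℝ f p = totalForm (du f p) (dv f p) := by
  ext <;> simp [totalForm, du, dv]

/-- Data for the local existence of solutions of a compatible linear system. -/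
structure LocalSystem (A B : ℝ × ℝ → V →L[ℝ] V) (p₀ : ℝ × ℝ) (r C : ℝ) : Prop where
  r_pos : 0 < r
  r_le : r ≤ 1
  C_nonneg : 0 ≤ C
  C_mul_r : C * r ≤ 1 / 4
  diffA : ∀ p ∈ closedBall p₀ r, DifferentiableAt ℝ A p
  diffB : ∀ p ∈ closedBall p₀ r, DifferentiableAt ℝ B p
  norm_A : ∀ p ∈ closedBall p₀ r, ‖A p‖ ≤ C
  norm_B : ∀ p ∈ closedBall p₀ r, ‖B p‖ ≤ C
  norm_dA : ∀ p ∈ closedBall p₀ r, ‖dv A p‖ ≤ C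
  norm_dB : ∀ p ∈ closedBall p₀ r, ‖du B p‖ ≤ C
  cont_dA : ContinuousOn (dv A) (closedBall p₀ r)
  cont_dB : ContinuousOn (du B) (closedBall p₀ r)
  compat : ∀ p ∈ closedBall p₀ r, dv A p + A p * B p = du B p + B p * A p

theorem exists_localSystem {U : Set (ℝ × ℝ)} (hU : IsOpen U) {A B : ℝ × ℝ → V →L[ℝ] V}
    (hA : ContDiffOn ℝ 1 A U) (hB : ContDiffOn ℝ 1 B U)
    (hAB : ∀ p ∈ U, dv A p + A p * B p = du B p + B p * A p) {p₀ : ℝ × ℝ} (hp₀ : p₀ ∈ U) :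
    ∃ r C, LocalSystem A B p₀ r C ∧ closedBall p₀ r ⊆ U := by
  obtain ⟨R, hR, hRU⟩ := nhds_basis_closedBall.mem_iff.1 (hU.mem_nhds hp₀)
  have hcomp : IsCompact (closedBall p₀ R) := isCompact_closedBall p₀ R
  have hdA : ContinuousOn (dv A) U :=
    (hA.continuousOn_fderiv_of_isOpen hU le_rfl).clm_apply continuousOn_const
  have hdB : ContinuousOn (du B) U :=
    (hB.continuousOn_fderiv_of_isOpen hU le_rfl).clm_apply continuousOn_const
  obtain ⟨C₁, h₁⟩ := hcomp.exists_bound_of_continuousOn (hA.continuousOn.mono hRU)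
  obtain ⟨C₂, h₂⟩ := hcomp.exists_bound_of_continuousOn (hB.continuousOn.mono hRU)
  obtain ⟨C₃, h₃⟩ := hcomp.exists_bound_of_continuousOn (hdA.mono hRU)
  obtain ⟨C₄, h₄⟩ := hcomp.exists_bound_of_continuousOn (hdB.mono hRU)
  set C := max (max C₁ C₂) (max C₃ C₄) with hC
  have hC0 : 0 ≤ C := (norm_nonneg _).trans
    ((h₁ p₀ (mem_closedBall_self hR.le)).trans ((le_max_left _ _).trans (le_max_left _ _)))
  -- The `+ 1` keeps the denominator positive when `C = 0`. The bound `r ≤ 1` is used later to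
  -- absorb a term of size `C * r * r` into `C * r`.
  set r := min R (min 1 (1 / (4 * (C + 1)))) with hr
  have hrR : closedBall p₀ r ⊆ closedBall p₀ R := closedBall_subset_closedBall (min_le_left _ _)
  refine ⟨r, C, ⟨?_, ?_, hC0, ?_, ?_, ?_, ?_, ?_, ?_, ?_, ?_, ?_, ?_⟩, hrR.trans hRU⟩
  · exact lt_min hR (lt_min one_pos (by positivity))
  · exact (min_le_right _ _).trans (min_le_left _ _)
  · have : r ≤ 1 / (4 * (C + 1)) := (min_le_right _ _).trans (min_le_right _ _)
    calc C * r ≤ C * (1 / (4 * (C + 1))) := mul_le_mul_of_nonneg_left this hC0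
      _ ≤ 1 / 4 := by
        rw [mul_one_div, div_le_div_iff₀ (by positivity) (by norm_num)]
        linarith
  · exact fun p hp => (hA.differentiableOn one_ne_zero).differentiableAt
      (hU.mem_nhds (hRU (hrR hp)))
  · exact fun p hp => (hB.differentiableOn one_ne_zero).differentiableAt
      (hU.mem_nhds (hRU (hrR hp)))
  · exact fun p hp => (h₁ p (hrR hp)).trans ((le_max_left _ _).trans (le_max_left _ _))
  · exact fun p hp => (h₂ p (hrR hp)).trans ((le_max_right _ _).trans (le_max_left _ _))
  · exact fun p hp => (h₃ p (hrR hp)).trans ((le_max_left _ _).trans (le_max_right _ _))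
  · exact fun p hp => (h₄ p (hrR hp)).trans ((le_max_right _ _).trans (le_max_right _ _))
  · exact hdA.mono (hrR.trans hRU)
  · exact hdB.mono (hrR.trans hRU)
  · exact fun p hp => hAB p (hRU (hrR hp))

variable {A B : ℝ × ℝ → V →L[ℝ] V} {p₀ : ℝ × ℝ} {r C : ℝ}

/-- The candidate obtained by integrating the first equation away from the line `u = u₀`. -/
def candidate (A : ℝ × ℝ → V →L[ℝ] V) (p₀ : ℝ × ℝ) (y : ℝ × ℝ → V) (p : ℝ × ℝ) : V :=
  y (p₀.1, p.2) + ∫ s in p₀.1..p.1, A (s, p.2) (y (s, p.2))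

theorem continuousOn_clm_apply_line {L : ℝ × ℝ → V →L[ℝ] V}
    (hL : ContinuousOn L (closedBall p₀ r)) {y : ℝ × ℝ → V} (hy : ContinuousOn y (ball p₀ r))
    {p : ℝ × ℝ} (hp : p ∈ ball p₀ r) :
    ContinuousOn (fun s => L (s, p.2) (y (s, p.2))) (uIcc p₀.1 p.1) := by
  have hm : MapsTo (fun s : ℝ => (s, p.2)) (uIcc p₀.1 p.1) (ball p₀ r) :=
    fun s hs' => mem_ball_of_mem_uIcc_fst hp hs'
  have hc : ContinuousOn (fun s : ℝ => (s, p.2)) (uIcc p₀.1 p.1) := by fun_prop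
  exact (hL.comp hc fun s hs' => ball_subset_closedBall (hm hs')).clm_apply (hy.comp hc hm)

theorem norm_integral_line_le {f : ℝ → V} {K : ℝ}
    {p : ℝ × ℝ} (hp : p ∈ ball p₀ r) (hf : ∀ s, (s, p.2) ∈ ball p₀ r → ‖f s‖ ≤ K) :
    ‖∫ s in p₀.1..p.1, f s‖ ≤ K * r := by
  have hp' := mem_ball_prod_iff.1 hp
  have hK : 0 ≤ K := (norm_nonneg _).trans (hf p.1 hp)
  exact (intervalIntegral.norm_integral_le_of_norm_le_const fun s hs' =>
    hf s (mem_ball_of_mem_uIcc_fst hp (uIoc_subset_uIcc hs'))).trans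
    (mul_le_mul_of_nonneg_left hp'.1.le hK)

end Frobenius

/-! ### Frobenius theorem: integration along the axis and proof of the second equation -/

section Frobenius

open Set Metric MeasureTheory Filter Topology

variable {V : Type} [NormedAddCommGroup V] [NormedSpace ℝ V]
variable {A B : ℝ × ℝ → V →L[ℝ] V} {p₀ : ℝ × ℝ} {r C : ℝ}

theorem hasDerivAt_integral_of_continuousOn_Ioo [CompleteSpace V] {f : ℝ → V} {a b c x : ℝ}
    (hf : ContinuousOn f (Ioo b c)) (ha : a ∈ Ioo b c) (hx : x ∈ Ioo b c) :
    HasDerivAt (fun z => ∫ s in a..z, f s) (f x) x :=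
  intervalIntegral.integral_hasDerivAt_right
    ((hf.mono (ordConnected_Ioo.uIcc_subset ha hx)).intervalIntegrable)
    (hf.stronglyMeasurableAtFilter isOpen_Ioo x hx)
    (hf.continuousAt (isOpen_Ioo.mem_nhds hx))

/-- Precomposing the coefficients with the retraction `ρ` onto the closed square makes them
continuous and bounded on the plane without changing them on the square. The fixed point then solves
the `v`-equation on the whole ball, but the `u`-equation only on the axis `v = v₀`. -/
theorem LocalSystem.exists_axis_solution [CompleteSpace V] (hs : LocalSystem A B p₀ r C) (y₀ : V) :
    ∃ y : ℝ × ℝ → V, Continuous y ∧ (∃ K, ∀ p, ‖y p‖ ≤ K) ∧ y p₀ = y₀ ∧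
      (∀ p ∈ ball p₀ r,
        HasDerivAt (fun s => y (s, p₀.2)) (A (p.1, p₀.2) (y (p.1, p₀.2))) p.1) ∧
      ∀ p ∈ ball p₀ r, HasDerivAt (fun t => y (p.1, t)) (B p (y p)) p.2 := by
  have hr := hs.r_pos
  set ρ : ℝ × ℝ → ℝ × ℝ := fun p => (clamp p₀.1 r p.1, clamp p₀.2 r p.2) with hρ
  have hρc : Continuous ρ :=
    ((continuous_clamp _ _).comp continuous_fst).prodMk ((continuous_clamp _ _).comp continuous_snd)
  have hρm : ∀ p, ρ p ∈ closedBall p₀ r := fun p =>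
    mem_closedBall_prod_iff.2 ⟨abs_clamp_sub_le hr.le _, abs_clamp_sub_le hr.le _⟩
  have hρe : ∀ p ∈ closedBall p₀ r, ρ p = p := fun p hp => by
    rw [mem_closedBall_prod_iff] at hp
    simp only [hρ, clamp_eq hp.1, clamp_eq hp.2]
  have hAc : Continuous (A ∘ ρ) := continuous_iff_continuousAt.2 fun p =>
    (hs.diffA _ (hρm p)).continuousAt.comp hρc.continuousAt
  have hBc : Continuous (B ∘ ρ) := continuous_iff_continuousAt.2 fun p =>
    (hs.diffB _ (hρm p)).continuousAt.comp hρc.continuousAt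
  obtain ⟨y, hy, hK, hfix⟩ := exists_axisOperator_fixed hAc hBc hs.C_nonneg hr.le
    (fun p => hs.norm_A _ (hρm p)) (fun p => hs.norm_B _ (hρm p)) hs.C_mul_r p₀ y₀
  have hform : ∀ p ∈ closedBall p₀ r, y p = y₀ +
      (∫ s in p₀.1..p.1, (A ∘ ρ) (s, p₀.2) (y (s, p₀.2))) +
        ∫ t in p₀.2..p.2, (B ∘ ρ) (p.1, t) (y (p.1, t)) := fun p hp => by
    have hp' := mem_closedBall_prod_iff.1 hp
    rw [hfix p]
    simp only [axisOperator, clamp_eq hp'.1, clamp_eq hp'.2]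
  have haxis : ∀ s, |s - p₀.1| < r → (s, p₀.2) ∈ closedBall p₀ r := fun s hs' =>
    mem_closedBall_prod_iff.2 ⟨hs'.le, by simpa using hr.le⟩
  have hnear : ∀ {a b : ℝ}, |a - b| < r → ∀ᶠ s in 𝓝 a, |s - b| < r := fun {a b} hab =>
    (isOpen_lt (by fun_prop) continuous_const).mem_nhds hab
  refine ⟨y, hy, hK, ?_, fun p hp => ?_, fun p hp => ?_⟩
  · rw [hform p₀ (mem_closedBall_self hr.le)]
    simp
  · have hp' := mem_ball_prod_iff.1 hp
    have h1 : HasDerivAt (fun s => y₀ + ∫ z in p₀.1..s, (A ∘ ρ) (z, p₀.2) (y (z, p₀.2)))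
        ((A ∘ ρ) (p.1, p₀.2) (y (p.1, p₀.2))) p.1 :=
      (Continuous.integral_hasStrictDerivAt
        ((hAc.comp (by fun_prop : Continuous fun z : ℝ => (z, p₀.2))).clm_apply (by fun_prop)) _ _).hasDerivAt.const_add _
    have h2 := h1.congr_of_eventuallyEq (f₁ := fun s => y (s, p₀.2)) (by
      filter_upwards [hnear hp'.1] with s hs'
      rw [hform _ (haxis s hs')]
      simp)
    rwa [Function.comp_apply, hρe _ (haxis _ hp'.1)] at h2
  · have hp' := mem_ball_prod_iff.1 hp
    have h1 : HasDerivAt (fun t => y₀ + (∫ s in p₀.1..p.1, (A ∘ ρ) (s, p₀.2) (y (s, p₀.2))) +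
        ∫ z in p₀.2..t, (B ∘ ρ) (p.1, z) (y (p.1, z)))
        ((B ∘ ρ) (p.1, p.2) (y (p.1, p.2))) p.2 :=
      (Continuous.integral_hasStrictDerivAt
        ((hBc.comp (by fun_prop : Continuous fun z : ℝ => (p.1, z))).clm_apply (by fun_prop)) _ _).hasDerivAt.const_add _
    have h2 := h1.congr_of_eventuallyEq (f₁ := fun t => y (p.1, t)) (by
      filter_upwards [hnear hp'.2] with t ht
      exact hform (p.1, t) (mem_closedBall_prod_iff.2 ⟨hp'.1.le, ht.le⟩))
    rwa [Function.comp_apply, hρe _ (ball_subset_closedBall hp)] at h2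

theorem LocalSystem.continuousOn_A (hs : LocalSystem A B p₀ r C) :
    ContinuousOn A (closedBall p₀ r) := fun p hp =>
  (hs.diffA p hp).continuousAt.continuousWithinAt

theorem LocalSystem.continuousOn_B (hs : LocalSystem A B p₀ r C) :
    ContinuousOn B (closedBall p₀ r) := fun p hp =>
  (hs.diffB p hp).continuousAt.continuousWithinAt

theorem mem_ball_line {p : ℝ × ℝ} (hp : p ∈ ball p₀ r) {s : ℝ} :
    s ∈ Ioo (p₀.1 - r) (p₀.1 + r) ↔ (s, p.2) ∈ ball p₀ r := by
  have h2 := (mem_ball_prod_iff.1 hp).2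
  rw [mem_ball_prod_iff, abs_lt, mem_Ioo]
  constructor
  · exact fun h => ⟨⟨by linarith [h.1], by linarith [h.2]⟩, h2⟩
  · exact fun h => ⟨by linarith [h.1.1], by linarith [h.1.2]⟩

theorem center_mem_ball_line {p : ℝ × ℝ} (hp : p ∈ ball p₀ r) : (p₀.1, p.2) ∈ ball p₀ r :=
  mem_ball_of_mem_uIcc_fst hp left_mem_uIcc

/-- The derivative involves `y`, not the candidate itself: the candidate is an integral of `A y`.
This is why its equality with `y` yields the `u`-equation for `y` off the axis. -/
theorem LocalSystem.hasDerivAt_candidate_fst [CompleteSpace V] (hs : LocalSystem A B p₀ r C)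
    {y : ℝ × ℝ → V} (hy : Continuous y) {p : ℝ × ℝ} (hp : p ∈ ball p₀ r) :
    HasDerivAt (fun s => candidate A p₀ y (s, p.2)) (A p (y p)) p.1 := by
  refine HasDerivAt.const_add (y (p₀.1, p.2)) (hasDerivAt_integral_of_continuousOn_Ioo
    (f := fun s => A (s, p.2) (y (s, p.2))) (b := p₀.1 - r) (c := p₀.1 + r) ?_
    ((mem_ball_line hp).2 (center_mem_ball_line hp)) ((mem_ball_line hp).2 hp))
  refine (hs.continuousOn_A.comp (by fun_prop) fun s hs' =>
    ball_subset_closedBall ((mem_ball_line hp).1 hs')).clm_apply (by fun_prop)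

theorem LocalSystem.hasDerivAt_candidate_snd [CompleteSpace V] (hs : LocalSystem A B p₀ r C)
    {y : ℝ × ℝ → V} (hy : Continuous y) {K : ℝ} (hK : ∀ p, ‖y p‖ ≤ K)
    (hyB : ∀ p ∈ ball p₀ r, HasDerivAt (fun t => y (p.1, t)) (B p (y p)) p.2)
    {p : ℝ × ℝ} (hp : p ∈ ball p₀ r) :
    HasDerivAt (fun t => candidate A p₀ y (p.1, t))
      (B (p₀.1, p.2) (y (p₀.1, p.2)) +
        ∫ s in p₀.1..p.1, (dv A (s, p.2) + A (s, p.2) * B (s, p.2)) (y (s, p.2))) p.2 := by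
  have hp' := mem_ball_prod_iff.1 hp
  have hcont : ∀ {L : ℝ × ℝ → V →L[ℝ] V}, ContinuousOn L (closedBall p₀ r) →
      ∀ t, (p.1, t) ∈ ball p₀ r → 
      ContinuousOn (fun s => L (s, t) (y (s, t))) (uIcc p₀.1 p.1) := fun hL t ht =>
    continuousOn_clm_apply_line (p := (p.1, t)) hL hy.continuousOn ht
  have hnear : {t : ℝ | (p.1, t) ∈ ball p₀ r} ∈ 𝓝 p.2 :=
    (isOpen_ball.preimage (by fun_prop : Continuous fun t : ℝ => (p.1, t))).mem_nhds hp
  have hsub : ∀ {t s : ℝ}, (p.1, t) ∈ ball p₀ r → s ∈ uIoc p₀.1 p.1 → (s, t) ∈ ball p₀ r :=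
    fun ht hs' => mem_ball_of_mem_uIcc_fst ht (uIoc_subset_uIcc hs')
  have hABc : ContinuousOn (fun p => dv A p + A p * B p) (closedBall p₀ r) :=
    hs.cont_dA.add (hs.continuousOn_A.mul hs.continuousOn_B)
  unfold candidate
  refine (hyB _ (center_mem_ball_line hp)).add ?_
  refine (intervalIntegral.hasDerivAt_integral_of_dominated_loc_of_deriv_le
    (F := fun t s => A (s, t) (y (s, t)))
    (F' := fun t s => (dv A (s, t) + A (s, t) * B (s, t)) (y (s, t)))
    (bound := fun _ => (C + C * C) * K) hnear ?_ ?_ ?_ ?_ ?_ ?_).2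
  · filter_upwards [hnear] with t ht
    exact ((hcont hs.continuousOn_A t ht).mono uIoc_subset_uIcc).aestronglyMeasurable
      measurableSet_uIoc
  · exact (hcont hs.continuousOn_A p.2 hp).intervalIntegrable
  · exact ((hcont hABc p.2 hp).mono uIoc_subset_uIcc).aestronglyMeasurable measurableSet_uIoc
  · refine Eventually.of_forall fun s hs' t ht => ?_
    have hm := ball_subset_closedBall (hsub ht hs')
    refine (ContinuousLinearMap.le_opNorm _ _).trans (mul_le_mul ?_ (hK _) (norm_nonneg _) ?_)
    · exact (norm_add_le _ _).trans (add_le_add (hs.norm_dA _ hm) ((norm_mul_le _ _).trans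
        (mul_le_mul (hs.norm_A _ hm) (hs.norm_B _ hm) (norm_nonneg _) hs.C_nonneg)))
    · exact add_nonneg hs.C_nonneg (mul_nonneg hs.C_nonneg hs.C_nonneg)
  · exact intervalIntegrable_const
  · refine Eventually.of_forall fun s hs' t ht => ?_
    have hm := hsub ht hs'
    have h1 := hasDerivAt_snd (hs.diffA _ (ball_subset_closedBall hm))
    have h2 := h1.clm_apply (hyB _ hm)
    simpa using h2

/-- The integrand is the `u`-derivative of `B S`, where `S` is the candidate and `S_u = A y`. -/
theorem LocalSystem.integral_candidate [CompleteSpace V] (hs : LocalSystem A B p₀ r C)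
    {y : ℝ × ℝ → V} (hy : Continuous y)
    {p : ℝ × ℝ} (hp : p ∈ ball p₀ r) :
    ∫ s in p₀.1..p.1, (du B (s, p.2) (candidate A p₀ y (s, p.2)) +
      (B (s, p.2) * A (s, p.2)) (y (s, p.2))) =
    B p (candidate A p₀ y p) - B (p₀.1, p.2) (candidate A p₀ y (p₀.1, p.2)) := by
  refine intervalIntegral.integral_eq_sub_of_hasDerivAt
    (f := fun s => B (s, p.2) (candidate A p₀ y (s, p.2))) (fun s hs' => ?_) ?_
  · have hm := mem_ball_of_mem_uIcc_fst hp hs'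
    have h1 := hasDerivAt_fst (hs.diffB _ (ball_subset_closedBall hm))
    exact h1.clm_apply (hs.hasDerivAt_candidate_fst hy hm)
  · refine ContinuousOn.intervalIntegrable (ContinuousOn.add ?_ ?_)
    · have hmem : MapsTo (fun s : ℝ => (s, p.2)) (uIcc p₀.1 p.1) (ball p₀ r) :=
        fun s hs' => mem_ball_of_mem_uIcc_fst hp hs'
      refine (hs.cont_dB.comp (by fun_prop) fun s hs' =>
        ball_subset_closedBall (hmem hs')).clm_apply fun s hs' => ?_
      exact (hs.hasDerivAt_candidate_fst hy (hmem hs')).continuousAt.continuousWithinAt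
    · exact continuousOn_clm_apply_line (hs.continuousOn_B.mul hs.continuousOn_A)
        hy.continuousOn hp

/-- Put `h = S - y` with `S` the candidate. Compatibility turns the `v`-derivative into `h_v = B h -
∫ B_u h ds`, a linear expression in `h` alone, and `h = 0` on the axis. A bound `N` for `h` thus
improves to `N / 2`, and iterating gives `h = 0`. -/
theorem LocalSystem.candidate_eq [CompleteSpace V] (hs : LocalSystem A B p₀ r C)
    {y : ℝ × ℝ → V} (hy : Continuous y) {K : ℝ} (hK : ∀ p, ‖y p‖ ≤ K)
    (hyA : ∀ p ∈ ball p₀ r,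
      HasDerivAt (fun s => y (s, p₀.2)) (A (p.1, p₀.2) (y (p.1, p₀.2))) p.1)
    (hyB : ∀ p ∈ ball p₀ r, HasDerivAt (fun t => y (p.1, t)) (B p (y p)) p.2)
    {p : ℝ × ℝ} (hp : p ∈ ball p₀ r) : candidate A p₀ y p = y p := by
  have hr := hs.r_pos
  have hC := hs.C_nonneg
  have hK0 : 0 ≤ K := (norm_nonneg _).trans (hK p₀)
  have hcAy : ∀ p ∈ ball p₀ r,
      ContinuousOn (fun s => A (s, p.2) (y (s, p.2))) (uIcc p₀.1 p.1) := fun p hp =>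
    continuousOn_clm_apply_line hs.continuousOn_A hy.continuousOn hp
  -- In the rate `C + C * r`, the first term bounds `B h` and the second the integral of `B_u h`.
  -- The initial bound is `K + C * K * r` for the candidate plus `K` for `y`.
  refine sub_eq_zero.1 (eq_zero_of_hasDerivAt_snd_bound (h := fun p => candidate A p₀ y p - y p)
    (K := C + C * r) (M := K + C * K * r + K) (by positivity) ?_ ?_ ?_ ?_ hp)
  · have h1 : C * r * r ≤ C * r * 1 := mul_le_mul_of_nonneg_left hs.r_le (by positivity)
    linarith [hs.C_mul_r, h1]
  · intro p hp
    refine (norm_sub_le _ _).trans (add_le_add ((norm_add_le _ _).trans (add_le_add (hK _) ?_))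
      (hK _))
    exact norm_integral_line_le hp fun s hs' => ((A (s, p.2)).le_opNorm _).trans
      (mul_le_mul (hs.norm_A _ (ball_subset_closedBall hs')) (hK _) (norm_nonneg _) hC)
  · intro p hp
    have hp' : (p.1, p₀.2) ∈ ball p₀ r :=
      mem_ball_prod_iff.2 ⟨(mem_ball_prod_iff.1 hp).1, by simpa using hr⟩
    have hint : ∫ s in p₀.1..p.1, A (s, p₀.2) (y (s, p₀.2)) = y (p.1, p₀.2) - y (p₀.1, p₀.2) :=
      intervalIntegral.integral_eq_sub_of_hasDerivAt (f := fun s => y (s, p₀.2))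
        (fun s hs' => hyA (s, p₀.2) (mem_ball_of_mem_uIcc_fst (p := (p.1, p₀.2)) hp' hs'))
        (hcAy _ hp').intervalIntegrable
    simp only [candidate, hint]
    abel
  · intro N hN p hp
    refine ⟨_, (hs.hasDerivAt_candidate_snd hy hK hyB hp).sub (hyB p hp), ?_⟩
    set S := candidate A p₀ y with hS
    have hmem : MapsTo (fun s : ℝ => (s, p.2)) (uIcc p₀.1 p.1) (ball p₀ r) :=
      fun s hs' => mem_ball_of_mem_uIcc_fst hp hs'
    have hScont : ContinuousOn (fun s => S (s, p.2)) (uIcc p₀.1 p.1) := fun s hs' =>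
      (hs.hasDerivAt_candidate_fst hy (hmem hs')).continuousAt.continuousWithinAt
    have hdB : ContinuousOn (fun s => du B (s, p.2)) (uIcc p₀.1 p.1) :=
      hs.cont_dB.comp (by fun_prop) fun s hs' => ball_subset_closedBall (hmem hs')
    have hBA := continuousOn_clm_apply_line (hs.continuousOn_B.mul hs.continuousOn_A)
      hy.continuousOn hp
    have hycont : ContinuousOn (fun s => y (s, p.2)) (uIcc p₀.1 p.1) := by fun_prop
    -- Compatibility replaces `A_v + A B` by `B_u + B A`. Writing `B_u y` as `B_u S - B_u (S - y)`
    -- leaves an exact derivative and an error term linear in the defect.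
    have hsplit : ∫ s in p₀.1..p.1, (dv A (s, p.2) + A (s, p.2) * B (s, p.2)) (y (s, p.2)) =
        (B p (S p) - B (p₀.1, p.2) (S (p₀.1, p.2))) -
          ∫ s in p₀.1..p.1, du B (s, p.2) (S (s, p.2) - y (s, p.2)) := by
      rw [← hs.integral_candidate hy hp, ← intervalIntegral.integral_sub]
      · refine intervalIntegral.integral_congr fun s hs' => ?_
        simp only [hs.compat _ (ball_subset_closedBall (hmem hs')), map_sub, hS,
          add_apply]
        abel
      · exact ((hdB.clm_apply hScont).add hBA).intervalIntegrable
      · exact (hdB.clm_apply (hScont.sub hycont)).intervalIntegrable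
    have hS0 : S (p₀.1, p.2) = y (p₀.1, p.2) := by simp [hS, candidate]
    rw [hsplit, hS0]
    have hrw : B (p₀.1, p.2) (y (p₀.1, p.2)) + (B p (S p) - B (p₀.1, p.2) (y (p₀.1, p.2)) -
        ∫ s in p₀.1..p.1, du B (s, p.2) (S (s, p.2) - y (s, p.2))) - B p (y p) =
        B p (S p - y p) - ∫ s in p₀.1..p.1, du B (s, p.2) (S (s, p.2) - y (s, p.2)) := by
      rw [map_sub]; abel
    rw [hrw]
    refine (norm_sub_le _ _).trans ?_
    have h1 : ‖B p (S p - y p)‖ ≤ C * N := ((B p).le_opNorm _).trans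
      (mul_le_mul (hs.norm_B _ (ball_subset_closedBall hp)) (hN p hp) (norm_nonneg _) hC)
    have h2 : ‖∫ s in p₀.1..p.1, du B (s, p.2) (S (s, p.2) - y (s, p.2))‖ ≤ C * N * r :=
      norm_integral_line_le hp fun s hs' => ((du B (s, p.2)).le_opNorm _).trans
        (mul_le_mul (hs.norm_dB _ (ball_subset_closedBall hs')) (hN _ hs') (norm_nonneg _) hC)
    linarith

theorem LocalSystem.exists_solution [CompleteSpace V] (hs : LocalSystem A B p₀ r C) (y₀ : V) :
    ∃ Y : ℝ × ℝ → V, Y p₀ = y₀ ∧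
      ∀ p ∈ ball p₀ r, HasFDerivAt Y (totalForm (A p (Y p)) (B p (Y p))) p := by
  obtain ⟨y, hy, ⟨K, hK⟩, hy₀, hyA, hyB⟩ := hs.exists_axis_solution y₀
  have hyA' : ∀ p ∈ ball p₀ r, HasDerivAt (fun s => y (s, p.2)) (A p (y p)) p.1 := fun p hp => by
    refine (hs.hasDerivAt_candidate_fst hy hp).congr_of_eventuallyEq ?_
    have hnear : {s : ℝ | (s, p.2) ∈ ball p₀ r} ∈ 𝓝 p.1 :=
      (isOpen_ball.preimage (by fun_prop : Continuous fun s : ℝ => (s, p.2))).mem_nhds hp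
    filter_upwards [hnear] with s hs'
    exact (hs.candidate_eq hy hK hyA hyB hs').symm
  refine ⟨y, hy₀, fun p hp => ?_⟩
  have hmem : ∀ᶠ q in 𝓝 p, q ∈ ball p₀ r := isOpen_ball.mem_nhds hp
  have hAc : ContinuousAt A p := (hs.diffA _ (ball_subset_closedBall hp)).continuousAt
  have hBc : ContinuousAt B p := (hs.diffB _ (ball_subset_closedBall hp)).continuousAt
  -- Both partial derivatives exist near `p` and are continuous at `p`, which gives total
  -- differentiability.
  refine (hasStrictFDerivAt_uncurry_coprod (f := fun a b => y (a, b)) (u := p)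
    (f₁ := fun a b => ContinuousLinearMap.toSpanSingleton ℝ (A (a, b) (y (a, b))))
    (f₂ := fun a b => ContinuousLinearMap.toSpanSingleton ℝ (B (a, b) (y (a, b))))
    ?_ ?_ ?_ ?_).hasFDerivAt
  · filter_upwards [hmem] with q hq
    exact (hyA' q hq).hasFDerivAt
  · filter_upwards [hmem] with q hq
    exact (hyB q hq).hasFDerivAt
  · exact (ContinuousLinearMap.toSpanSingletonCLE (𝕜 := ℝ) (E := V)).continuous.continuousAt.comp
      (hAc.clm_apply hy.continuousAt)
  · exact (ContinuousLinearMap.toSpanSingletonCLE (𝕜 := ℝ) (E := V)).continuous.continuousAt.comp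
      (hBc.clm_apply hy.continuousAt)

end Frobenius

/-! ### Frame equations: existence, smoothness, uniqueness -/

section FrameSystem

open Metric Filter Topology

variable {V : Type} [NormedAddCommGroup V] [NormedSpace ℝ V]

/-- For a solution of a differential equation with smooth coefficients the derivative is as smooth
as the solution, so each order of smoothness yields the next. -/
theorem contDiffOn_infty_of_bootstrap {f : ℝ × ℝ → V} {U : Set (ℝ × ℝ)} (hU : IsOpen U)
    (hf : DifferentiableOn ℝ f U)
    (h : ∀ n : ℕ, ContDiffOn ℝ n f U → ContDiffOn ℝ n (fderiv ℝ f) U) : ContDiffOn ℝ ∞ f U := by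
  refine contDiffOn_infty.2 fun n => ?_
  induction n with
  | zero => exact contDiffOn_zero.2 hf.continuousOn
  | succ n ih =>
    push_cast
    exact (contDiffOn_succ_iff_fderiv_of_isOpen hU).2 ⟨hf, by simp, h n ih⟩

theorem contDiffOn_totalForm {n : ℕ∞ω} {f g : ℝ × ℝ → V} {U : Set (ℝ × ℝ)}
    (hf : ContDiffOn ℝ n f U) (hg : ContDiffOn ℝ n g U) :
    ContDiffOn ℝ n (fun p => totalForm (f p) (g p)) U := by
  have h : (fun p => totalForm (f p) (g p)) = fun p =>
      (ContinuousLinearMap.fst ℝ ℝ ℝ).smulRight (f p) +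
        (ContinuousLinearMap.snd ℝ ℝ ℝ).smulRight (g p) := by
    funext p
    ext <;> simp [totalForm]
  rw [h]
  fun_prop

theorem contDiffOn_du {f : ℝ × ℝ → V} {U : Set (ℝ × ℝ)} (hf : ContDiffOn ℝ ∞ f U)
    (hU : IsOpen U) : ContDiffOn ℝ ∞ (du f) U :=
  (hf.fderiv_of_isOpen hU (by simp)).clm_apply contDiffOn_const

theorem contDiffOn_dv {f : ℝ × ℝ → V} {U : Set (ℝ × ℝ)} (hf : ContDiffOn ℝ ∞ f U)
    (hU : IsOpen U) : ContDiffOn ℝ ∞ (dv f) U :=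
  (hf.fderiv_of_isOpen hU (by simp)).clm_apply contDiffOn_const

/-- A function vanishing at the centre of a ball, whose derivative is controlled by the function
itself, vanishes on the ball. -/
theorem eq_zero_of_norm_du_dv_le {h : ℝ × ℝ → V} {p₀ : ℝ × ℝ} {r K : ℝ}
    (hd : ∀ p ∈ ball p₀ r, DifferentiableAt ℝ h p) (h0 : h p₀ = 0)
    (hu : ∀ p ∈ ball p₀ r, ‖du h p‖ ≤ K * ‖h p‖) (hv : ∀ p ∈ ball p₀ r, ‖dv h p‖ ≤ K * ‖h p‖)
    {p : ℝ × ℝ} (hp : p ∈ ball p₀ r) : h p = 0 := by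
  set w := p - p₀ with hw
  have hmem : ∀ t ∈ Set.Icc (0 : ℝ) 1, p₀ + t • w ∈ ball p₀ r := by
    intro t ht
    have hp' : ‖w‖ < r := mem_ball_iff_norm.1 hp
    rw [mem_ball_iff_norm, add_sub_cancel_left, norm_smul, Real.norm_of_nonneg ht.1]
    exact (mul_le_of_le_one_left (norm_nonneg _) ht.2).trans_lt hp'
  have hder : ∀ t ∈ Set.Icc (0 : ℝ) 1,
      HasDerivAt (fun t : ℝ => h (p₀ + t • w)) (fderiv ℝ h (p₀ + t • w) w) t := by
    intro t ht
    have h1 : HasDerivAt (fun t : ℝ => p₀ + t • w) w t := by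
      simpa using ((hasDerivAt_id t).smul_const w).const_add p₀
    exact (hd _ (hmem t ht)).hasFDerivAt.comp_hasDerivAt t h1
  -- Grönwall's inequality on the segment from `p₀` to `p`; the constant comes from the chain rule
  -- with velocity `w = p - p₀`.
  have := eq_zero_of_abs_deriv_le_mul_abs_self_of_eq_zero_right (a := 0) (b := 1)
    (K := |w.1| * K + |w.2| * K) (f := fun t : ℝ => h (p₀ + t • w))
    (fun t ht => (hder t ht).continuousAt.continuousWithinAt)
    (fun t ht => (hder t (Set.Ico_subset_Icc_self ht)).hasDerivWithinAt)
    (by simpa using h0) (fun t ht => by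
      have ht' := hmem t (Set.Ico_subset_Icc_self ht)
      rw [fderiv_eq_totalForm, totalForm_apply]
      refine (norm_add_le _ _).trans ?_
      rw [norm_smul, norm_smul, Real.norm_eq_abs, Real.norm_eq_abs]
      have h1 := mul_le_mul_of_nonneg_left (hu _ ht') (abs_nonneg w.1)
      have h2 := mul_le_mul_of_nonneg_left (hv _ ht') (abs_nonneg w.2)
      linarith) 1 (by simp)
  simpa [hw] using this

/-- The action of a coefficient matrix on a frame, the rows of which are vectors of `ℝ⁴`. -/
def frameMul (a M : Fin 4 → Fin 4 → ℝ) : Fin 4 → Fin 4 → ℝ := fun i k => ∑ j, a i j * M j k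

theorem norm_frameMul_le (a M : Fin 4 → Fin 4 → ℝ) : ‖frameMul a M‖ ≤ 4 * ‖a‖ * ‖M‖ := by
  refine (pi_norm_le_iff_of_nonneg (by positivity)).2 fun i =>
    (pi_norm_le_iff_of_nonneg (by positivity)).2 fun k => ?_
  refine (norm_sum_le _ _).trans ?_
  have h : ∀ j ∈ Finset.univ, ‖a i j * M j k‖ ≤ ‖a‖ * ‖M‖ := fun j _ => by
    rw [norm_mul]
    exact mul_le_mul ((norm_le_pi_norm (a i) j).trans (norm_le_pi_norm a i))
      ((norm_le_pi_norm (M j) k).trans (norm_le_pi_norm M j)) (norm_nonneg _) (norm_nonneg _)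
  refine (Finset.sum_le_card_nsmul _ _ _ h).trans (le_of_eq ?_)
  simp
  ring

/-- Multiplication of a vector by a matrix as a continuous bilinear map. -/
def mulVecCLM : (Fin 4 → Fin 4 → ℝ) →L[ℝ] (Fin 4 → ℝ) →L[ℝ] Fin 4 → ℝ :=
  LinearMap.toContinuousLinearMap
    ((LinearMap.toContinuousLinearMap (𝕜 := ℝ) (E := Fin 4 → ℝ) (F' := Fin 4 → ℝ)).toLinearMap ∘ₗ
      (Matrix.toLin' (R := ℝ) (m := Fin 4) (n := Fin 4)).toLinearMap ∘ₗ
        (Matrix.ofLinearEquiv ℝ).toLinearMap)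

theorem mulVecCLM_apply (a : Fin 4 → Fin 4 → ℝ) (y : Fin 4 → ℝ) (i : Fin 4) :
    mulVecCLM a y i = ∑ j, a i j * y j := rfl

theorem du_pi_apply {ι : Type} [Fintype ι] {f : ℝ × ℝ → ι → V} {p : ℝ × ℝ}
    (hf : DifferentiableAt ℝ f p) (i : ι) : du (fun q => f q i) p = du f p i := by
  have := (hasFDerivAt_pi'.1 hf.hasFDerivAt) i
  rw [du, this.fderiv]
  rfl

theorem dv_pi_apply {ι : Type} [Fintype ι] {f : ℝ × ℝ → ι → V} {p : ℝ × ℝ}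
    (hf : DifferentiableAt ℝ f p) (i : ι) : dv (fun q => f q i) p = dv f p i := by
  have := (hasFDerivAt_pi'.1 hf.hasFDerivAt) i
  rw [dv, this.fderiv]
  rfl

theorem du_eq_of_totalForm {f : ℝ × ℝ → V} {a b : V} {p : ℝ × ℝ}
    (h : HasFDerivAt f (totalForm a b) p) : du f p = a := by
  rw [du, h.fderiv]; simp

theorem dv_eq_of_totalForm {f : ℝ × ℝ → V} {a b : V} {p : ℝ × ℝ}
    (h : HasFDerivAt f (totalForm a b) p) : dv f p = b := by
  rw [dv, h.fderiv]; simp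

/-- `M` solves the frame equations with coefficient matrices `A`, `B` on `U`. -/
def SolvesFrame (U : Set (ℝ × ℝ)) (A B M : ℝ × ℝ → Fin 4 → Fin 4 → ℝ) : Prop :=
  ∀ p ∈ U, HasFDerivAt M (totalForm (frameMul (A p) (M p)) (frameMul (B p) (M p))) p

theorem SolvesFrame.row {U : Set (ℝ × ℝ)} {A B M : ℝ × ℝ → Fin 4 → Fin 4 → ℝ}
    (hM : SolvesFrame U A B M) {p : ℝ × ℝ} (hp : p ∈ U) (i : Fin 4) :
    HasFDerivAt (fun q => M q i)
      (totalForm (frameMul (A p) (M p) i) (frameMul (B p) (M p) i)) p :=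
  (hasFDerivAt_pi'.1 (hM p hp) i).congr_fderiv (by ext <;> simp [totalForm])

theorem SolvesFrame.mono {U W : Set (ℝ × ℝ)} {A B M : ℝ × ℝ → Fin 4 → Fin 4 → ℝ}
    (h : SolvesFrame U A B M) (hW : W ⊆ U) : SolvesFrame W A B M := fun p hp => h p (hW hp)

theorem contDiffOn_frameMul {n : ℕ∞ω} {A M : ℝ × ℝ → Fin 4 → Fin 4 → ℝ} {U : Set (ℝ × ℝ)}
    (hA : ContDiffOn ℝ n A U) (hM : ContDiffOn ℝ n M U) :
    ContDiffOn ℝ n (fun p => frameMul (A p) (M p)) U := by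
  refine contDiffOn_pi.2 fun i => contDiffOn_pi.2 fun k => ContDiffOn.sum fun j _ => ?_
  exact ((contDiffOn_pi.1 (contDiffOn_pi.1 hA i) j)).mul (contDiffOn_pi.1 (contDiffOn_pi.1 hM j) k)

theorem SolvesFrame.contDiffOn {U : Set (ℝ × ℝ)} (hU : IsOpen U)
    {A B M : ℝ × ℝ → Fin 4 → Fin 4 → ℝ} (hM : SolvesFrame U A B M) (hA : ContDiffOn ℝ ∞ A U)
    (hB : ContDiffOn ℝ ∞ B U) : ContDiffOn ℝ ∞ M U := by
  refine contDiffOn_infty_of_bootstrap hU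
    (fun p hp => (hM p hp).differentiableAt.differentiableWithinAt) fun n hn => ?_
  refine (contDiffOn_totalForm
    (contDiffOn_frameMul (hA.of_le (by exact_mod_cast le_top)) hn)
    (contDiffOn_frameMul (hB.of_le (by exact_mod_cast le_top)) hn)).congr fun p hp => ?_
  exact (hM p hp).fderiv

theorem exists_solvesFrame {U : Set (ℝ × ℝ)} (hU : IsOpen U) {A B : ℝ × ℝ → Fin 4 → Fin 4 → ℝ}
    (hA : ContDiffOn ℝ ∞ A U) (hB : ContDiffOn ℝ ∞ B U)
    (hAB : ∀ p ∈ U, dv A p + frameMul (A p) (B p) = du B p + frameMul (B p) (A p))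
    {p₀ : ℝ × ℝ} (hp₀ : p₀ ∈ U) (M₀ : Fin 4 → Fin 4 → ℝ) :
    ∃ r > 0, ball p₀ r ⊆ U ∧ ∃ M, M p₀ = M₀ ∧ SolvesFrame (ball p₀ r) A B M := by
  have hdA : ∀ p ∈ U, HasFDerivAt (fun q => mulVecCLM (A q))
      (mulVecCLM.comp (fderiv ℝ A p)) p := fun p hp =>
    mulVecCLM.hasFDerivAt.comp p
      ((hA.differentiableOn (by simp)).differentiableAt (hU.mem_nhds hp)).hasFDerivAt
  have hdB : ∀ p ∈ U, HasFDerivAt (fun q => mulVecCLM (B q))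
      (mulVecCLM.comp (fderiv ℝ B p)) p := fun p hp =>
    mulVecCLM.hasFDerivAt.comp p
      ((hB.differentiableOn (by simp)).differentiableAt (hU.mem_nhds hp)).hasFDerivAt
  have hmul : ∀ a b : Fin 4 → Fin 4 → ℝ,
      mulVecCLM a * mulVecCLM b = mulVecCLM (frameMul a b) := by
    intro a b
    ext1 y
    ext i
    simp only [mul_apply_eq_comp, mulVecCLM_apply, frameMul, Finset.mul_sum,
      Finset.sum_mul]
    rw [Finset.sum_comm]
    simp only [mul_assoc]
  obtain ⟨r, C, hs, hrU⟩ := exists_localSystem hU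
    (A := fun q => mulVecCLM (A q)) (B := fun q => mulVecCLM (B q))
    ((mulVecCLM.contDiff.comp_contDiffOn hA).of_le (by simp))
    ((mulVecCLM.contDiff.comp_contDiffOn hB).of_le (by simp))
    (fun p hp => by
      rw [dv, du, (hdA p hp).fderiv, (hdB p hp).fderiv, hmul, hmul]
      have := congrArg mulVecCLM (hAB p hp)
      rwa [map_add, map_add] at this) hp₀
  -- The coefficients mix the rows of the frame but act on every coordinate alike, so each column of
  -- `M` solves one and the same vector system. The radius does not depend on the initial value,
  -- hence one ball serves all four columns.
  choose y hy₀ hy using hs.exists_solution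
  refine ⟨r, hs.r_pos, ball_subset_closedBall.trans hrU,
    fun p i k => y (fun j => M₀ j k) p i, ?_, fun p hp => ?_⟩
  · funext i k
    exact congrFun (hy₀ fun j => M₀ j k) i
  · refine hasFDerivAt_pi'.2 fun i => hasFDerivAt_pi'.2 fun k => ?_
    refine (hasFDerivAt_pi'.1 (hy (fun j => M₀ j k) p hp) i).congr_fderiv ?_
    ext <;> simp [totalForm, mulVecCLM_apply, frameMul]

/-- Solutions of the frame equations agreeing at the centre of a ball agree on the ball. -/
theorem SolvesFrame.eqOn {A B M N : ℝ × ℝ → Fin 4 → Fin 4 → ℝ} {p₀ : ℝ × ℝ} {r K : ℝ}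
    (hM : SolvesFrame (ball p₀ r) A B M) (hN : SolvesFrame (ball p₀ r) A B N)
    (hA : ∀ p ∈ ball p₀ r, ‖A p‖ ≤ K) (hB : ∀ p ∈ ball p₀ r, ‖B p‖ ≤ K)
    (h0 : M p₀ = N p₀) : Set.EqOn M N (ball p₀ r) := by
  intro p hp
  have hsub : ∀ a M N, frameMul a M - frameMul a N = frameMul a (M - N) := by
    intro a M N
    funext i k
    simp only [frameMul, Pi.sub_apply, mul_sub, Finset.sum_sub_distrib]
  have hform : ∀ p ∈ ball p₀ r, HasFDerivAt (fun q => M q - N q)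
      (totalForm (frameMul (A p) (M p - N p)) (frameMul (B p) (M p - N p))) p := fun p hp => by
    refine ((hM p hp).sub (hN p hp)).congr_fderiv ?_
    rw [← hsub, ← hsub]
    refine ContinuousLinearMap.ext fun w => ?_
    simp only [sub_apply, totalForm_apply, smul_sub]
    abel
  have hb : ∀ {a : Fin 4 → Fin 4 → ℝ} (M), ‖a‖ ≤ K → ‖frameMul a M‖ ≤ 4 * K * ‖M‖ :=
    fun M ha => (norm_frameMul_le _ M).trans (by gcongr)
  refine sub_eq_zero.1 (eq_zero_of_norm_du_dv_le (h := fun q => M q - N q) (K := 4 * K)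
    (fun p hp => (hform p hp).differentiableAt) (sub_eq_zero.2 h0) ?_ ?_ hp)
  · intro p hp
    rw [du_eq_of_totalForm (hform p hp)]
    exact hb _ (hA p hp)
  · intro p hp
    rw [dv_eq_of_totalForm (hform p hp)]
    exact hb _ (hB p hp)

end FrameSystem

/-! ### The connection matrices in null directions and their zero-curvature equation -/

section Coefficients

open Real

/-- Coefficients of the frame equations in the null direction `∂_u + ∂_v`. -/
def coefP (a f w b d e : ℝ) : Fin 4 → Fin 4 → ℝ :=
  ![![a, 0, d * exp (f / 2) / 2, d * e * exp (-(f / 2)) / 2],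
    ![0, 0, 0, 0],
    ![0, d * e * (exp (-(f / 2)) * exp (-w)) / 2, b / 2, 0],
    ![0, d * (exp (f / 2) * exp (-w)) / 2, 0, -(b / 2)]]

/-- Coefficients of the frame equations in the null direction `∂_u - ∂_v`. -/
def coefQ (a f w b d e : ℝ) : Fin 4 → Fin 4 → ℝ :=
  ![![0, 0, 0, 0],
    ![0, a, d * exp (-(f / 2)) / 2, d * e * exp (f / 2) / 2],
    ![d * e * (exp (f / 2) * exp (-w)) / 2, 0, -(b / 2), 0],
    ![d * (exp (-(f / 2)) * exp (-w)) / 2, 0, 0, b / 2]]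

theorem hasDerivAt_vec4 {V : Type} [NormedAddCommGroup V] [NormedSpace ℝ V] {a b c d : ℝ → V}
    {a' b' c' d' : V} {t : ℝ} (ha : HasDerivAt a a' t) (hb : HasDerivAt b b' t)
    (hc : HasDerivAt c c' t) (hd : HasDerivAt d d' t) :
    HasDerivAt (fun s => (![a s, b s, c s, d s] : Fin 4 → V)) ![a', b', c', d'] t := by
  refine hasDerivAt_pi.2 fun i => ?_
  fin_cases i
  exacts [ha, hb, hc, hd]

theorem contDiffOn_vec4 {V : Type} [NormedAddCommGroup V] [NormedSpace ℝ V] {n : ℕ∞ω}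
    {U : Set (ℝ × ℝ)} {a b c d : ℝ × ℝ → V} (ha : ContDiffOn ℝ n a U) (hb : ContDiffOn ℝ n b U)
    (hc : ContDiffOn ℝ n c U) (hd : ContDiffOn ℝ n d U) :
    ContDiffOn ℝ n (fun p => (![a p, b p, c p, d p] : Fin 4 → V)) U := by
  refine contDiffOn_pi.2 fun i => ?_
  fin_cases i
  exacts [ha, hb, hc, hd]

/-- The derivative of `coefP` along a curve. -/
def dCoefP (a' f f' w w' b' d e : ℝ) : Fin 4 → Fin 4 → ℝ :=
  ![![a', 0, d * (exp (f / 2) * (f' / 2)) / 2,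
      d * e * (exp (-(f / 2)) * -(f' / 2)) / 2],
    ![0, 0, 0, 0],
    ![0, d * e * (exp (-(f / 2)) * -(f' / 2) * exp (-w) +
      exp (-(f / 2)) * (exp (-w) * -w')) / 2, b' / 2, 0],
    ![0, d * (exp (f / 2) * (f' / 2) * exp (-w) +
      exp (f / 2) * (exp (-w) * -w')) / 2, 0, -(b' / 2)]]

/-- The derivative of `coefQ` along a curve. -/
def dCoefQ (a' f f' w w' b' d e : ℝ) : Fin 4 → Fin 4 → ℝ :=
  ![![0, 0, 0, 0],
    ![0, a', d * (exp (-(f / 2)) * -(f' / 2)) / 2,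
      d * e * (exp (f / 2) * (f' / 2)) / 2],
    ![d * e * (exp (f / 2) * (f' / 2) * exp (-w) +
      exp (f / 2) * (exp (-w) * -w')) / 2, 0, -(b' / 2), 0],
    ![d * (exp (-(f / 2)) * -(f' / 2) * exp (-w) +
      exp (-(f / 2)) * (exp (-w) * -w')) / 2, 0, 0, b' / 2]]

theorem hasDerivAt_coefP {a f w b : ℝ → ℝ} {a' f' w' b' t : ℝ} (ha : HasDerivAt a a' t)
    (hf : HasDerivAt f f' t) (hw : HasDerivAt w w' t) (hb : HasDerivAt b b' t) (d e : ℝ) :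
    HasDerivAt (fun t => coefP (a t) (f t) (w t) (b t) d e)
      (dCoefP a' (f t) f' (w t) w' b' d e) t := by
  have hf2 := hf.div_const 2
  have h0 : HasDerivAt (fun _ : ℝ => (0 : ℝ)) 0 t := hasDerivAt_const _ _
  exact hasDerivAt_vec4
    (hasDerivAt_vec4 ha h0 ((hf2.exp.const_mul d).div_const 2)
      ((hf2.neg.exp.const_mul (d * e)).div_const 2))
    (hasDerivAt_vec4 h0 h0 h0 h0)
    (hasDerivAt_vec4 h0 (((hf2.neg.exp.mul hw.neg.exp).const_mul (d * e)).div_const 2)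
      (hb.div_const 2) h0)
    (hasDerivAt_vec4 h0 (((hf2.exp.mul hw.neg.exp).const_mul d).div_const 2) h0
      (hb.div_const 2).neg)

theorem hasDerivAt_coefQ {a f w b : ℝ → ℝ} {a' f' w' b' t : ℝ} (ha : HasDerivAt a a' t)
    (hf : HasDerivAt f f' t) (hw : HasDerivAt w w' t) (hb : HasDerivAt b b' t) (d e : ℝ) :
    HasDerivAt (fun t => coefQ (a t) (f t) (w t) (b t) d e)
      (dCoefQ a' (f t) f' (w t) w' b' d e) t := by
  have hf2 := hf.div_const 2
  have h0 : HasDerivAt (fun _ : ℝ => (0 : ℝ)) 0 t := hasDerivAt_const _ _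
  exact hasDerivAt_vec4
    (hasDerivAt_vec4 h0 h0 h0 h0)
    (hasDerivAt_vec4 h0 ha ((hf2.neg.exp.const_mul d).div_const 2)
      ((hf2.exp.const_mul (d * e)).div_const 2))
    (hasDerivAt_vec4 (((hf2.exp.mul hw.neg.exp).const_mul (d * e)).div_const 2) h0
      (hb.div_const 2).neg h0)
    (hasDerivAt_vec4 (((hf2.neg.exp.mul hw.neg.exp).const_mul d).div_const 2) h0 h0
      (hb.div_const 2))

theorem contDiffOn_coefP {n : ℕ∞ω} {U : Set (ℝ × ℝ)} {a f w b : ℝ × ℝ → ℝ}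
    (ha : ContDiffOn ℝ n a U) (hf : ContDiffOn ℝ n f U) (hw : ContDiffOn ℝ n w U)
    (hb : ContDiffOn ℝ n b U) (d e : ℝ) :
    ContDiffOn ℝ n (fun p => coefP (a p) (f p) (w p) (b p) d e) U := by
  unfold coefP
  refine contDiffOn_vec4 (contDiffOn_vec4 ?_ ?_ ?_ ?_) (contDiffOn_vec4 ?_ ?_ ?_ ?_)
    (contDiffOn_vec4 ?_ ?_ ?_ ?_) (contDiffOn_vec4 ?_ ?_ ?_ ?_) <;> fun_prop

theorem contDiffOn_coefQ {n : ℕ∞ω} {U : Set (ℝ × ℝ)} {a f w b : ℝ × ℝ → ℝ}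
    (ha : ContDiffOn ℝ n a U) (hf : ContDiffOn ℝ n f U) (hw : ContDiffOn ℝ n w U)
    (hb : ContDiffOn ℝ n b U) (d e : ℝ) :
    ContDiffOn ℝ n (fun p => coefQ (a p) (f p) (w p) (b p) d e) U := by
  unfold coefQ
  refine contDiffOn_vec4 (contDiffOn_vec4 ?_ ?_ ?_ ?_) (contDiffOn_vec4 ?_ ?_ ?_ ?_)
    (contDiffOn_vec4 ?_ ?_ ?_ ?_) (contDiffOn_vec4 ?_ ?_ ?_ ?_) <;> fun_prop

/-- The function `ln |E|`. -/
def logAbs (E : ℝ × ℝ → ℝ) (p : ℝ × ℝ) : ℝ := Real.log |E p|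

/-- The part of the coefficients of the frame equations in the direction `∂_u + ∂_v`. -/
def nullCoefP (E φ : ℝ × ℝ → ℝ) (ε δ : DNum) (p : ℝ × ℝ) : Fin 4 → Fin 4 → ℝ :=
  coefP ((du (logAbs E) p + dv (logAbs E) p) / 2) (φ p) (logAbs E p)
    ((du φ p + dv φ p) / 2) (δ.re + δ.im) (ε.re + ε.im)

/-- The part of the coefficients of the frame equations in the direction `∂_u - ∂_v`. -/
def nullCoefQ (E φ : ℝ × ℝ → ℝ) (ε δ : DNum) (p : ℝ × ℝ) : Fin 4 → Fin 4 → ℝ :=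
  coefQ ((du (logAbs E) p - dv (logAbs E) p) / 2) (φ p) (logAbs E p)
    ((du φ p - dv φ p) / 2) (δ.re - δ.im) (ε.re - ε.im)

/-- The coefficients of the frame equations in the direction `∂_u`. -/
def coefU (E φ : ℝ × ℝ → ℝ) (ε δ : DNum) (p : ℝ × ℝ) : Fin 4 → Fin 4 → ℝ :=
  nullCoefP E φ ε δ p + nullCoefQ E φ ε δ p

/-- The coefficients of the frame equations in the direction `∂_v`. -/
def coefV (E φ : ℝ × ℝ → ℝ) (ε δ : DNum) (p : ℝ × ℝ) : Fin 4 → Fin 4 → ℝ :=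
  nullCoefP E φ ε δ p - nullCoefQ E φ ε δ p

theorem contDiffOn_logAbs {E : ℝ × ℝ → ℝ} {U : Set (ℝ × ℝ)} (hE : ContDiffOn ℝ ∞ E U)
    (hneg : ∀ p ∈ U, E p < 0) : ContDiffOn ℝ ∞ (logAbs E) U := by
  refine (hE.log fun p hp => (hneg p hp).ne).congr fun p _ => ?_
  rw [logAbs, Real.log_abs]

theorem exp_logAbs {E : ℝ × ℝ → ℝ} {p : ℝ × ℝ} (hneg : E p < 0) : exp (logAbs E p) = -E p := by
  rw [logAbs, Real.log_abs, Real.exp_log_of_neg hneg]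

theorem contDiffOn_nullCoefP {E φ : ℝ × ℝ → ℝ} {U : Set (ℝ × ℝ)} (hU : IsOpen U)
    (hE : ContDiffOn ℝ ∞ E U) (hneg : ∀ p ∈ U, E p < 0) (hφ : ContDiffOn ℝ ∞ φ U) (ε δ : DNum) :
    ContDiffOn ℝ ∞ (nullCoefP E φ ε δ) U := by
  have hw := contDiffOn_logAbs hE hneg
  have := contDiffOn_du hw hU
  have := contDiffOn_dv hw hU
  have := contDiffOn_du hφ hU
  have := contDiffOn_dv hφ hU
  exact contDiffOn_coefP (by fun_prop) hφ hw (by fun_prop) _ _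

theorem contDiffOn_nullCoefQ {E φ : ℝ × ℝ → ℝ} {U : Set (ℝ × ℝ)} (hU : IsOpen U)
    (hE : ContDiffOn ℝ ∞ E U) (hneg : ∀ p ∈ U, E p < 0) (hφ : ContDiffOn ℝ ∞ φ U) (ε δ : DNum) :
    ContDiffOn ℝ ∞ (nullCoefQ E φ ε δ) U := by
  have hw := contDiffOn_logAbs hE hneg
  have := contDiffOn_du hw hU
  have := contDiffOn_dv hw hU
  have := contDiffOn_du hφ hU
  have := contDiffOn_dv hφ hU
  exact contDiffOn_coefQ (by fun_prop) hφ hw (by fun_prop) _ _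

theorem fderiv_fderiv_apply {V : Type} [NormedAddCommGroup V] [NormedSpace ℝ V]
    {f : ℝ × ℝ → V} {U : Set (ℝ × ℝ)} (hU : IsOpen U) (hf : ContDiffOn ℝ ∞ f U)
    {p : ℝ × ℝ} (hp : p ∈ U) (a b : ℝ × ℝ) :
    fderiv ℝ (fderiv ℝ f) p b a = fderiv ℝ (fun q => fderiv ℝ f q a) p b := by
  have hd : DifferentiableAt ℝ (fderiv ℝ f) p :=
    ((hf.fderiv_of_isOpen hU (m := ∞) (by simp)).differentiableOn (by simp)).differentiableAt
      (hU.mem_nhds hp)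
  rw [(hd.hasFDerivAt.clm_apply (hasFDerivAt_const a p)).fderiv]
  simp

theorem du_dv_comm {V : Type} [NormedAddCommGroup V] [NormedSpace ℝ V]
    {f : ℝ × ℝ → V} {U : Set (ℝ × ℝ)} (hU : IsOpen U) (hf : ContDiffOn ℝ ∞ f U)
    {p : ℝ × ℝ} (hp : p ∈ U) : dv (du f) p = du (dv f) p := by
  have hsymm : IsSymmSndFDerivAt ℝ f p :=
    (hf.contDiffAt (hU.mem_nhds hp)).isSymmSndFDerivAt
      (by simpa using (WithTop.coe_le_coe.2 le_top : ((2 : ℕ∞) : ℕ∞ω) ≤ ∞))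
  change fderiv ℝ (fun q => fderiv ℝ f q (1, 0)) p (0, 1) =
    fderiv ℝ (fun q => fderiv ℝ f q (0, 1)) p (1, 0)
  rw [← fderiv_fderiv_apply hU hf hp, ← fderiv_fderiv_apply hU hf hp]
  exact hsymm.eq _ _

/-- Here the two null components of `δ` and `ε` are independent letters `d, d'` and `e, e'`. The
diagonal entries are the only ones that carry `wuu - wvv` or `fuu - fvv`: the first two reduce to
`hw`, the last two to `hf`. The off-diagonal entries are identities, because the rotation
coefficients are built from the derivatives of `φ`. -/
theorem coef_compat {wuu wuv wvv fuu fuv fvv wu wv fu fv w f d e d' e' : ℝ}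
    (hw : wuu - wvv = -(d * d' * (e' * exp (f / 2) ^ 2 + e * exp (-(f / 2)) ^ 2) * exp (-w)))
    (hf : fuu - fvv = d * d' * (e' * exp (f / 2) ^ 2 - e * exp (-(f / 2)) ^ 2) * exp (-w)) :
    dCoefP ((wuv + wvv) / 2) f fv w wv ((fuv + fvv) / 2) d e +
        dCoefQ ((wuv - wvv) / 2) f fv w wv ((fuv - fvv) / 2) d' e' +
      frameMul (coefP ((wu + wv) / 2) f w ((fu + fv) / 2) d e +
          coefQ ((wu - wv) / 2) f w ((fu - fv) / 2) d' e')
        (coefP ((wu + wv) / 2) f w ((fu + fv) / 2) d e -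
          coefQ ((wu - wv) / 2) f w ((fu - fv) / 2) d' e') =
    dCoefP ((wuu + wuv) / 2) f fu w wu ((fuu + fuv) / 2) d e -
        dCoefQ ((wuu - wuv) / 2) f fu w wu ((fuu - fuv) / 2) d' e' +
      frameMul (coefP ((wu + wv) / 2) f w ((fu + fv) / 2) d e -
          coefQ ((wu - wv) / 2) f w ((fu - fv) / 2) d' e')
        (coefP ((wu + wv) / 2) f w ((fu + fv) / 2) d e +
          coefQ ((wu - wv) / 2) f w ((fu - fv) / 2) d' e') := by
  unfold coefP coefQ dCoefP dCoefQ
  -- The three exponentials may be treated as free variables: the entries are polynomial identities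
  -- in them, and the relation `k * l = 1` plays no role.
  generalize exp (f / 2) = k at *
  generalize exp (-(f / 2)) = l at *
  generalize exp (-w) = z at *
  funext i j
  fin_cases i <;> fin_cases j <;>
    simp [frameMul, Fin.sum_univ_four] <;>
    first
    | ring1
    | linear_combination (-1 / 2) * hw
    | linear_combination (1 / 2) * hw
    | linear_combination (-1 / 2) * hf
    | linear_combination (1 / 2) * hf

/-- In the splitting of the double numbers, twice the real and imaginary parts are the sum and
difference of the two components. Conjugation swaps the components of `ε`, `|δ|²` is the product of
those of `δ`, and `1 / E = -exp (-logAbs E)`. -/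
theorem natural_system_null {E φ : ℝ × ℝ → ℝ} {ε δ : DNum} {D : Set (ℝ × ℝ)}
    (hsys : SolvesNaturalSystem D E φ ε δ) {p : ℝ × ℝ} (hp : p ∈ D) :
    du (du (logAbs E)) p - dv (dv (logAbs E)) p =
      -((δ.re + δ.im) * (δ.re - δ.im) * ((ε.re - ε.im) * exp (φ p / 2) ^ 2 +
        (ε.re + ε.im) * exp (-(φ p / 2)) ^ 2) * exp (-logAbs E p)) ∧
    du (du φ) p - dv (dv φ) p =
      (δ.re + δ.im) * (δ.re - δ.im) * ((ε.re - ε.im) * exp (φ p / 2) ^ 2 -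
        (ε.re + ε.im) * exp (-(φ p / 2)) ^ 2) * exp (-logAbs E p) := by
  have hneg := hsys.E_neg p hp
  have hE : exp (-logAbs E p) = -(E p)⁻¹ := by rw [exp_neg, exp_logAbs hneg, inv_neg]
  have h1 : exp (φ p / 2) ^ 2 = exp (φ p) := by rw [← exp_nat_mul]; congr 1; push_cast; ring
  have h2 : exp (-(φ p / 2)) ^ 2 = exp (-φ p) := by rw [← exp_nat_mul]; congr 1; push_cast; ring
  rw [h1, h2, hE]
  constructor
  · have := hsys.eq_E p hp
    simp only [hypLaplacian, norm_eq, expj, star_eq, QuadraticAlgebra.re_smul,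
      QuadraticAlgebra.re_mul, cosh_eq, sinh_eq, smul_eq_mul] at this
    rw [show (fun q => Real.log |E q|) = logAbs E from rfl] at this
    rw [this]
    field_simp
    ring
  · have := hsys.eq_phi p hp
    simp only [hypLaplacian, norm_eq, expj, star_eq, QuadraticAlgebra.im_smul,
      QuadraticAlgebra.im_mul, cosh_eq, sinh_eq, smul_eq_mul] at this
    rw [this]
    field_simp
    ring

theorem coefUV_compat {E φ : ℝ × ℝ → ℝ} {ε δ : DNum} {D : Set (ℝ × ℝ)} (hD : IsOpen D)
    (hE : ContDiffOn ℝ ∞ E D) (hφ : ContDiffOn ℝ ∞ φ D)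
    (hsys : SolvesNaturalSystem D E φ ε δ) {p : ℝ × ℝ} (hp : p ∈ D) :
    dv (coefU E φ ε δ) p + frameMul (coefU E φ ε δ p) (coefV E φ ε δ p) =
      du (coefV E φ ε δ) p + frameMul (coefV E φ ε δ p) (coefU E φ ε δ p) := by
  have hdiff : ∀ {W : Type} [NormedAddCommGroup W] [NormedSpace ℝ W] {f : ℝ × ℝ → W},
      ContDiffOn ℝ ∞ f D → DifferentiableAt ℝ f p := fun hf =>
    (hf.differentiableOn (by simp)).differentiableAt (hD.mem_nhds hp)
  have hw := contDiffOn_logAbs hE hsys.E_neg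
  have hwu := hdiff (contDiffOn_du hw hD)
  have hwv := hdiff (contDiffOn_dv hw hD)
  have hfu := hdiff (contDiffOn_du hφ hD)
  have hfv := hdiff (contDiffOn_dv hφ hD)
  have hP := contDiffOn_nullCoefP hD hE hsys.E_neg hφ ε δ
  have hQ := contDiffOn_nullCoefQ hD hE hsys.E_neg hφ ε δ
  have hw0 := hdiff hw
  have hf0 := hdiff hφ
  have hA : dv (coefU E φ ε δ) p = _ :=
    (hasDerivAt_snd (hdiff (hP.add hQ))).unique
      ((hasDerivAt_coefP (((hasDerivAt_snd hwu).add (hasDerivAt_snd hwv)).div_const 2)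
        (hasDerivAt_snd hf0) (hasDerivAt_snd hw0)
        (((hasDerivAt_snd hfu).add (hasDerivAt_snd hfv)).div_const 2) _ _).add
      (hasDerivAt_coefQ (((hasDerivAt_snd hwu).sub (hasDerivAt_snd hwv)).div_const 2)
        (hasDerivAt_snd hf0) (hasDerivAt_snd hw0)
        (((hasDerivAt_snd hfu).sub (hasDerivAt_snd hfv)).div_const 2) _ _))
  have hB : du (coefV E φ ε δ) p = _ :=
    (hasDerivAt_fst (hdiff (hP.sub hQ))).unique
      ((hasDerivAt_coefP (((hasDerivAt_fst hwu).add (hasDerivAt_fst hwv)).div_const 2)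
        (hasDerivAt_fst hf0) (hasDerivAt_fst hw0)
        (((hasDerivAt_fst hfu).add (hasDerivAt_fst hfv)).div_const 2) _ _).sub
      (hasDerivAt_coefQ (((hasDerivAt_fst hwu).sub (hasDerivAt_fst hwv)).div_const 2)
        (hasDerivAt_fst hf0) (hasDerivAt_fst hw0)
        (((hasDerivAt_fst hfu).sub (hasDerivAt_fst hfv)).div_const 2) _ _))
  obtain ⟨h1, h2⟩ := natural_system_null hsys hp
  rw [hA, hB, du_dv_comm hD hw hp, du_dv_comm hD hφ hp]
  exact coef_compat h1 h2

end Coefficients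

/-! ### Conservation of the Gram matrix, initial frames and primitives -/

section Gram

open Metric

theorem ip_comm {R : Type} [CommRing R] (a b : Fin 4 → R) : ip a b = ip b a := by
  simp only [ip]; ring

theorem ip_add_left {R : Type} [CommRing R] (a b c : Fin 4 → R) :
    ip (a + b) c = ip a c + ip b c := by
  simp only [ip, Pi.add_apply]; ring

theorem ip_sub_left {R : Type} [CommRing R] (a b c : Fin 4 → R) :
    ip (a - b) c = ip a c - ip b c := by
  simp only [ip, Pi.sub_apply]; ring

theorem ip_smul_left {R : Type} [CommRing R] (r : R) (a b : Fin 4 → R) :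
    ip (r • a) b = r * ip a b := by
  simp only [ip, Pi.smul_apply, smul_eq_mul]; ring

theorem ip_add_right {R : Type} [CommRing R] (a b c : Fin 4 → R) :
    ip c (a + b) = ip c a + ip c b := by
  simp only [ip, Pi.add_apply]; ring

theorem ip_sub_right {R : Type} [CommRing R] (a b c : Fin 4 → R) :
    ip c (a - b) = ip c a - ip c b := by
  simp only [ip, Pi.sub_apply]; ring

theorem ip_smul_right {R : Type} [CommRing R] (r : R) (a b : Fin 4 → R) :
    ip b (r • a) = r * ip b a := by
  simp only [ip, Pi.smul_apply, smul_eq_mul]; ring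

theorem hasFDerivAt_ip {f g : ℝ × ℝ → Fin 4 → ℝ} {a b c d : Fin 4 → ℝ} {p : ℝ × ℝ}
    (hf : HasFDerivAt f (totalForm a b) p) (hg : HasFDerivAt g (totalForm c d) p) :
    HasFDerivAt (fun q => ip (f q) (g q))
      (totalForm (ip a (g p) + ip (f p) c) (ip b (g p) + ip (f p) d)) p := by
  have hf' := fun i => hasFDerivAt_pi'.1 hf i
  have hg' := fun i => hasFDerivAt_pi'.1 hg i
  refine (((((hf' 0).mul (hg' 0)).neg.add ((hf' 1).mul (hg' 1))).sub
    ((hf' 2).mul (hg' 2))).add ((hf' 3).mul (hg' 3))).congr_fderiv ?_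
  ext <;> simp [totalForm, ip] <;> ring

/-- The Gram matrix of a frame. -/
def frameGram (M : Fin 4 → Fin 4 → ℝ) : Fin 4 → Fin 4 → ℝ := fun i j => ip (M i) (M j)

/-- The Gram matrix of the null frame `(x_u + x_v) / 2, (x_u - x_v) / 2, m₁, m₂`. -/
def nullGram (E : ℝ) : Fin 4 → Fin 4 → ℝ :=
  ![![0, E / 2, 0, 0], ![E / 2, 0, 0, 0], ![0, 0, 0, 1 / 2], ![0, 0, 1 / 2, 0]]

/-- The infinitesimal action of a coefficient matrix on Gram matrices. -/
def gramAction (a G : Fin 4 → Fin 4 → ℝ) : Fin 4 → Fin 4 → ℝ :=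
  fun i j => ∑ k, a i k * G k j + ∑ k, a j k * G i k

theorem gramAction_sub_right (a G H : Fin 4 → Fin 4 → ℝ) :
    gramAction a (G - H) = gramAction a G - gramAction a H := by
  funext i j
  simp only [gramAction, Pi.sub_apply, mul_sub, Finset.sum_sub_distrib]
  ring

theorem gramAction_add_left (a b G : Fin 4 → Fin 4 → ℝ) :
    gramAction (a + b) G = gramAction a G + gramAction b G := by
  funext i j
  simp only [gramAction, Pi.add_apply, add_mul, Finset.sum_add_distrib]
  ring

theorem gramAction_sub_left (a b G : Fin 4 → Fin 4 → ℝ) :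
    gramAction (a - b) G = gramAction a G - gramAction b G := by
  funext i j
  simp only [gramAction, Pi.sub_apply, sub_mul, Finset.sum_sub_distrib]
  ring

theorem norm_gramAction_le (a G : Fin 4 → Fin 4 → ℝ) : ‖gramAction a G‖ ≤ 8 * ‖a‖ * ‖G‖ := by
  refine (pi_norm_le_iff_of_nonneg (by positivity)).2 fun i =>
    (pi_norm_le_iff_of_nonneg (by positivity)).2 fun j => ?_
  have hentry : ∀ (b : Fin 4 → Fin 4 → ℝ) (i j), ‖b i j‖ ≤ ‖b‖ := fun b i j =>
    (norm_le_pi_norm (b i) j).trans (norm_le_pi_norm b i)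
  have hprod : ∀ i k l m, ‖a i k * G l m‖ ≤ ‖a‖ * ‖G‖ := fun i k l m => by
    rw [norm_mul]
    exact mul_le_mul (hentry a i k) (hentry G l m) (norm_nonneg _) (norm_nonneg _)
  refine (norm_add_le _ _).trans ((add_le_add
    ((norm_sum_le _ _).trans (Finset.sum_le_card_nsmul _ _ _ fun k _ => hprod i k k j))
    ((norm_sum_le _ _).trans (Finset.sum_le_card_nsmul _ _ _ fun k _ => hprod j k i k))).trans
    (le_of_eq ?_))
  simp
  ring

theorem ip_sum_left {ι : Type} [Fintype ι] (c : ι → ℝ) (M : ι → Fin 4 → ℝ) (y : Fin 4 → ℝ) :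
    ip (fun k => ∑ j, c j * M j k) y = ∑ j, c j * ip (M j) y := by
  simp only [ip, Finset.sum_mul, ← Finset.sum_neg_distrib, ← Finset.sum_add_distrib,
    ← Finset.sum_sub_distrib]
  exact Finset.sum_congr rfl fun j _ => by ring

theorem hasFDerivAt_frameGram {M : ℝ × ℝ → Fin 4 → Fin 4 → ℝ} {a b : Fin 4 → Fin 4 → ℝ} {p : ℝ × ℝ}
    (hM : HasFDerivAt M (totalForm (frameMul a (M p)) (frameMul b (M p))) p) :
    HasFDerivAt (fun q => frameGram (M q))
      (totalForm (gramAction a (frameGram (M p))) (gramAction b (frameGram (M p)))) p := by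
  have hrow : ∀ i, HasFDerivAt (fun q => M q i)
      (totalForm (frameMul a (M p) i) (frameMul b (M p) i)) p := fun i =>
    (hasFDerivAt_pi'.1 hM i).congr_fderiv (by ext <;> simp [totalForm])
  refine hasFDerivAt_pi'.2 fun i => hasFDerivAt_pi'.2 fun j => ?_
  refine (hasFDerivAt_ip (hrow i) (hrow j)).congr_fderiv ?_
  have h : ∀ c : Fin 4 → Fin 4 → ℝ, ip (frameMul c (M p) i) (M p j) +
      ip (M p i) (frameMul c (M p) j) = gramAction c (frameGram (M p)) i j := fun c => by
    rw [ip_comm (M p i)]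
    change ip (fun k => ∑ l, c i l * M p l k) (M p j) +
      ip (fun k => ∑ l, c j l * M p l k) (M p i) = _
    rw [ip_sum_left, ip_sum_left]
    simp only [gramAction, frameGram, ip_comm (M p i)]
  rw [h, h]
  ext <;> simp [totalForm]

/-- The last two rows of `coefP` are the Weingarten counterparts of the Gauss row: with `exp (-w) =
-1 / E` their tangential entries cancel the variation of the mixed products, and the opposite
rotation terms preserve `m₁ · m₂`. Only the product `E / 2` varies. -/
theorem gramAction_coefP {a f w b d e E : ℝ} (h : Real.exp (-w) * E = -1) :
    gramAction (coefP a f w b d e) (nullGram E) =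
      ![![0, E * a / 2, 0, 0], ![E * a / 2, 0, 0, 0], ![0, 0, 0, 0], ![0, 0, 0, 0]] := by
  unfold coefP nullGram
  generalize Real.exp (f / 2) = k
  generalize Real.exp (-(f / 2)) = l
  generalize Real.exp (-w) = z at *
  funext i j
  fin_cases i <;> fin_cases j <;> simp [gramAction, Fin.sum_univ_four] <;>
    first
    | ring1
    | linear_combination (d * e * l / 4) * h
    | linear_combination (d * k / 4) * h

theorem gramAction_coefQ {a f w b d e E : ℝ} (h : Real.exp (-w) * E = -1) :
    gramAction (coefQ a f w b d e) (nullGram E) =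
      ![![0, E * a / 2, 0, 0], ![E * a / 2, 0, 0, 0], ![0, 0, 0, 0], ![0, 0, 0, 0]] := by
  unfold coefQ nullGram
  generalize Real.exp (f / 2) = k
  generalize Real.exp (-(f / 2)) = l
  generalize Real.exp (-w) = z at *
  funext i j
  fin_cases i <;> fin_cases j <;> simp [gramAction, Fin.sum_univ_four] <;>
    first
    | ring1
    | linear_combination (d * e * k / 4) * h
    | linear_combination (d * l / 4) * h

/-- This converts the logarithmic derivatives in the connection matrices back into derivatives of
`E`, so that `nullGram E` can be recognised as a solution of the Gram equation. -/
theorem du_logAbs {E : ℝ × ℝ → ℝ} {p : ℝ × ℝ} (hE : DifferentiableAt ℝ E p) (hneg : E p ≠ 0) :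
    HasFDerivAt E (totalForm (E p * du (logAbs E) p) (E p * dv (logAbs E) p)) p := by
  have h : HasFDerivAt (logAbs E) ((E p)⁻¹ • fderiv ℝ E p) p := by
    have : logAbs E = fun q => Real.log (E q) := by funext q; rw [logAbs, Real.log_abs]
    rw [this]
    exact hE.hasFDerivAt.log hneg
  refine hE.hasFDerivAt.congr_fderiv ?_
  rw [du, dv, h.fderiv]
  ext <;> simp [totalForm, hneg]

theorem exp_neg_logAbs_mul {E : ℝ × ℝ → ℝ} {p : ℝ × ℝ} (hneg : E p < 0) :
    Real.exp (-logAbs E p) * E p = -1 := by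
  rw [Real.exp_neg, exp_logAbs hneg, inv_neg, neg_mul, inv_mul_cancel₀ hneg.ne]

theorem hasFDerivAt_nullGram {E : ℝ × ℝ → ℝ} (φ : ℝ × ℝ → ℝ) (ε δ : DNum) {p : ℝ × ℝ}
    (hE : DifferentiableAt ℝ E p) (hneg : E p < 0) :
    HasFDerivAt (fun q => nullGram (E q))
      (totalForm (gramAction (coefU E φ ε δ p) (nullGram (E p)))
        (gramAction (coefV E φ ε δ p) (nullGram (E p)))) p := by
  have hz := exp_neg_logAbs_mul hneg
  have hd := du_logAbs hE hneg.ne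
  have hd2 : HasFDerivAt (fun q => E q / 2)
      (totalForm (E p * du (logAbs E) p / 2) (E p * dv (logAbs E) p / 2)) p := by
    refine (hd.mul_const (2⁻¹ : ℝ)).congr_fderiv ?_
    ext <;> simp [totalForm] <;> ring
  rw [coefU, coefV, gramAction_add_left, gramAction_sub_left]
  unfold nullCoefP nullCoefQ
  rw [gramAction_coefP hz, gramAction_coefQ hz]
  refine hasFDerivAt_pi'.2 fun i => hasFDerivAt_pi'.2 fun j => ?_
  have hc : ∀ c : ℝ, HasFDerivAt (fun _ : ℝ × ℝ => c) (totalForm (0 : ℝ) 0) p := fun c =>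
    (hasFDerivAt_const c p).congr_fderiv (by ext <;> simp [totalForm])
  fin_cases i <;> fin_cases j
  all_goals first
    | refine (hc _).congr_fderiv ?_
      ext <;> simp [totalForm]
    | refine hd2.congr_fderiv ?_
      ext <;> simp [totalForm] <;> ring

/-- The Gram matrix of a solution of the frame equations is the prescribed one if it is so at the
centre of the ball. -/
theorem SolvesFrame.frameGram_eq {E φ : ℝ × ℝ → ℝ} {ε δ : DNum} {M : ℝ × ℝ → Fin 4 → Fin 4 → ℝ}
    {p₀ : ℝ × ℝ} {r K : ℝ}
    (hM : SolvesFrame (ball p₀ r) (coefU E φ ε δ) (coefV E φ ε δ) M)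
    (hE : ∀ p ∈ ball p₀ r, DifferentiableAt ℝ E p) (hneg : ∀ p ∈ ball p₀ r, E p < 0)
    (hA : ∀ p ∈ ball p₀ r, ‖coefU E φ ε δ p‖ ≤ K) (hB : ∀ p ∈ ball p₀ r, ‖coefV E φ ε δ p‖ ≤ K)
    (h0 : frameGram (M p₀) = nullGram (E p₀)) {p : ℝ × ℝ} (hp : p ∈ ball p₀ r) :
    frameGram (M p) = nullGram (E p) := by
  -- Both Gram matrices satisfy the same linear equation, hence so does their difference, which
  -- vanishes at the centre.
  have hform : ∀ p ∈ ball p₀ r, HasFDerivAt (fun q => frameGram (M q) - nullGram (E q))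
      (totalForm (gramAction (coefU E φ ε δ p) (frameGram (M p) - nullGram (E p)))
        (gramAction (coefV E φ ε δ p) (frameGram (M p) - nullGram (E p)))) p := fun p hp => by
    refine ((hasFDerivAt_frameGram (hM p hp)).sub
      (hasFDerivAt_nullGram φ ε δ (hE p hp) (hneg p hp))).congr_fderiv ?_
    rw [gramAction_sub_right, gramAction_sub_right]
    refine ContinuousLinearMap.ext fun w => ?_
    simp only [sub_apply, totalForm_apply, smul_sub]
    abel
  have hb : ∀ {a : Fin 4 → Fin 4 → ℝ} (G), ‖a‖ ≤ K → ‖gramAction a G‖ ≤ 8 * K * ‖G‖ :=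
    fun G ha => (norm_gramAction_le _ G).trans (by gcongr)
  refine sub_eq_zero.1 (eq_zero_of_norm_du_dv_le
    (h := fun q => frameGram (M q) - nullGram (E q)) (K := 8 * K)
    (fun p hp => (hform p hp).differentiableAt) (sub_eq_zero.2 h0) ?_ ?_ hp)
  · intro p hp
    rw [du_eq_of_totalForm (hform p hp)]
    exact hb _ (hA p hp)
  · intro p hp
    rw [dv_eq_of_totalForm (hform p hp)]
    exact hb _ (hB p hp)

/-- A frame with the prescribed Gram matrix and orientation. -/
theorem exists_initial_frame {E : ℝ} (hE : E < 0) :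
    ∃ M : Fin 4 → Fin 4 → ℝ, frameGram M = nullGram E ∧
      RightOriented (M 0 + M 1) (M 0 - M 1) (M 2) (M 3) := by
  have hs : √(-E) * √(-E) = -E := Real.mul_self_sqrt (by linarith)
  have hs0 : 0 < √(-E) := Real.sqrt_pos.2 (by linarith)
  generalize √(-E) = s at *
  -- The sum and the difference of the first two rows are `s` times the first two basis vectors,
  -- with squares `-s²` and `s²`. The last two rows are null combinations of the other two basis
  -- vectors, with product `1/2`.
  refine ⟨![![s / 2, s / 2, 0, 0], ![s / 2, -(s / 2), 0, 0], ![0, 0, 1 / 2, 1 / 2],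
    ![0, 0, -(1 / 2), 1 / 2]], ?_, ?_⟩
  · funext i j
    fin_cases i <;> fin_cases j <;> simp [frameGram, nullGram, ip] <;>
    first
    | ring1
    | linear_combination (-1 / 2) * hs
  · unfold RightOriented
    simp [Matrix.det_succ_row_zero, Fin.sum_univ_succ, Fin.succAbove]
    positivity

/-- A closed pair of coefficient functions on a ball has a primitive. -/
theorem exists_primitive {V : Type} [NormedAddCommGroup V] [NormedSpace ℝ V] [CompleteSpace V]
    {α β : ℝ × ℝ → V} {p₀ : ℝ × ℝ} {r : ℝ}
    (hα : ∀ p ∈ ball p₀ r, DifferentiableAt ℝ α p) (hβ : ∀ p ∈ ball p₀ r, DifferentiableAt ℝ β p)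
    (h : ∀ p ∈ ball p₀ r, dv α p = du β p) :
    ∃ x : ℝ × ℝ → V, ∀ p ∈ ball p₀ r, HasFDerivAt x (totalForm (α p) (β p)) p := by
  have hd : ∀ p ∈ ball p₀ r, HasFDerivAt (fun q => totalForm (α q) (β q))
      ((ContinuousLinearMap.smulRightL ℝ (ℝ × ℝ) V (ContinuousLinearMap.fst ℝ ℝ ℝ)).comp
          (fderiv ℝ α p) +
        (ContinuousLinearMap.smulRightL ℝ (ℝ × ℝ) V (ContinuousLinearMap.snd ℝ ℝ ℝ)).comp
          (fderiv ℝ β p)) p := fun p hp => by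
    have h1 := ((ContinuousLinearMap.smulRightL ℝ (ℝ × ℝ) V
      (ContinuousLinearMap.fst ℝ ℝ ℝ)).hasFDerivAt.comp p (hα p hp).hasFDerivAt).add
      ((ContinuousLinearMap.smulRightL ℝ (ℝ × ℝ) V
      (ContinuousLinearMap.snd ℝ ℝ ℝ)).hasFDerivAt.comp p (hβ p hp).hasFDerivAt)
    refine h1.congr_of_eventuallyEq (Filter.Eventually.of_forall fun q => ?_)
    ext <;> simp [totalForm]
  refine (convex_ball p₀ r).exists_forall_hasFDerivAt_of_fderiv_symmetric isOpen_ball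
    (fun p hp => (hd p hp).differentiableAt.differentiableWithinAt) fun p hp a b => ?_
  rw [(hd p hp).fderiv]
  simp only [fderiv_eq_totalForm α, fderiv_eq_totalForm β, add_apply,
    ContinuousLinearMap.comp_apply, ContinuousLinearMap.smulRightL_apply_apply, totalForm_apply, h p hp]
  simp
  module

end Gram

/-! ### Normal projection, `Φ'^⊥` and mean curvature in terms of second derivatives -/

section Surface

open Metric Filter Topology

/-- The projection formula recovers the tangential coefficients `r` and `s`, so a normal part can be
read off from any splitting into tangential and normal terms. -/
theorem normalPart_eq {x : ℝ × ℝ → Fin 4 → ℝ} {p : ℝ × ℝ} (hE : coeffE x p ≠ 0)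
    (hF : coeffF x p = 0) (hG : coeffG x p = -coeffE x p) {n : Fin 4 → ℝ}
    (hu : ip n (du x p) = 0) (hv : ip n (dv x p) = 0) {a : Fin 4 → ℝ} (r s : ℝ)
    (ha : a = r • du x p + s • dv x p + n) : normalPart x p a = n := by
  have hvu : ip (dv x p) (du x p) = 0 := by rw [ip_comm]; exact hF
  have h1 : ip a (du x p) = r * coeffE x p := by
    rw [ha, ip_add_left, ip_add_left, ip_smul_left, ip_smul_left, hu, hvu]
    simp [coeffE]
  have h2 : ip a (dv x p) = -(s * coeffE x p) := by
    rw [ha, ip_add_left, ip_add_left, ip_smul_left, ip_smul_left, hv]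
    change r * coeffF x p + s * coeffG x p + 0 = _
    rw [hF, hG]; ring
  have e1 : (ip a (du x p) * coeffG x p - ip a (dv x p) * coeffF x p) /
      (coeffE x p * coeffG x p - coeffF x p ^ 2) = r := by
    rw [h1, h2, hF, hG]; field_simp; ring
  have e2 : (ip a (dv x p) * coeffE x p - ip a (du x p) * coeffF x p) /
      (coeffE x p * coeffG x p - coeffF x p ^ 2) = s := by
    rw [h1, h2, hF, hG]; field_simp; ring
  rw [normalPart, e1, e2, ha]
  abel

theorem PhiPrime_eq {x : ℝ × ℝ → Fin 4 → ℝ} {U : Set (ℝ × ℝ)} (hU : IsOpen U)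
    (hx : ContDiffOn ℝ ∞ x U) {p : ℝ × ℝ} (hp : p ∈ U) (i : Fin 4) :
    PhiPrime x p i =
      ⟨((1 / 2 : ℝ) • (du (du x) p + dv (dv x) p)) i, dv (du x) p i⟩ := by
  have hu : DifferentiableAt ℝ (du x) p :=
    ((contDiffOn_du hx hU).differentiableOn (by simp)).differentiableAt (hU.mem_nhds hp)
  have hv : DifferentiableAt ℝ (dv x) p :=
    ((contDiffOn_dv hx hU).differentiableOn (by simp)).differentiableAt (hU.mem_nhds hp)
  have hcomm := congrFun (du_dv_comm hU hx hp) i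
  simp only [PhiPrime, dt, Phi]
  rw [du_pi_apply hu, du_pi_apply hv, dv_pi_apply hu, dv_pi_apply hv, ← hcomm]
  ext
  · simp [jj]; ring
  · simp [jj]; ring

theorem PhiPrimePerp_eq {x : ℝ × ℝ → Fin 4 → ℝ} {U : Set (ℝ × ℝ)} (hU : IsOpen U)
    (hx : ContDiffOn ℝ ∞ x U) {p : ℝ × ℝ} (hp : p ∈ U) (i : Fin 4) :
    PhiPrimePerp x p i =
      ⟨normalPart x p ((1 / 2 : ℝ) • (du (du x) p + dv (dv x) p)) i,
        normalPart x p (dv (du x) p) i⟩ := by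
  simp only [PhiPrimePerp, normalPartD, PhiPrime_eq hU hx hp]

/-- The value of the representation of `Φ'^⊥` in components. -/
theorem representation_apply (ε δ : DNum) (f : ℝ) (a b : Fin 4 → ℝ) (i : Fin 4) :
    ((δ * expj (f / 2)) • toD a + (ε * δ * expj (-(f / 2))) • toD b) i =
      ⟨(((δ.re + δ.im) * Real.exp (f / 2) / 2) • a +
          ((δ.re + δ.im) * (ε.re + ε.im) * Real.exp (-(f / 2)) / 2) • b +
          (((δ.re - δ.im) * Real.exp (-(f / 2)) / 2) • a +
          ((δ.re - δ.im) * (ε.re - ε.im) * Real.exp (f / 2) / 2) • b)) i,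
        (((δ.re + δ.im) * Real.exp (f / 2) / 2) • a +
          ((δ.re + δ.im) * (ε.re + ε.im) * Real.exp (-(f / 2)) / 2) • b -
          (((δ.re - δ.im) * Real.exp (-(f / 2)) / 2) • a +
          ((δ.re - δ.im) * (ε.re - ε.im) * Real.exp (f / 2) / 2) • b)) i⟩ := by
  ext <;> simp [toD, expj, Real.cosh_eq, Real.sinh_eq] <;> ring

/-- The normal part of `x_uu + x_uv`, up to the factor `2`, in the frame. -/
def normalP (φ : ℝ × ℝ → ℝ) (ε δ : DNum) (p : ℝ × ℝ) (a b : Fin 4 → ℝ) : Fin 4 → ℝ :=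
  ((δ.re + δ.im) * Real.exp (φ p / 2) / 2) • a +
    ((δ.re + δ.im) * (ε.re + ε.im) * Real.exp (-(φ p / 2)) / 2) • b

/-- The normal part of `x_uu - x_uv`, up to the factor `2`, in the frame. -/
def normalQ (φ : ℝ × ℝ → ℝ) (ε δ : DNum) (p : ℝ × ℝ) (a b : Fin 4 → ℝ) : Fin 4 → ℝ :=
  ((δ.re - δ.im) * Real.exp (-(φ p / 2)) / 2) • a +
    ((δ.re - δ.im) * (ε.re - ε.im) * Real.exp (φ p / 2) / 2) • b

/-- The logarithmic derivatives of `E` in the null directions. -/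
def nullLog (E : ℝ × ℝ → ℝ) (s : ℝ) (p : ℝ × ℝ) : ℝ :=
  (du (logAbs E) p + s * dv (logAbs E) p) / 2

theorem frameMul_coefU_zero (E φ : ℝ × ℝ → ℝ) (ε δ : DNum) (p : ℝ × ℝ) (M : Fin 4 → Fin 4 → ℝ) :
    frameMul (coefU E φ ε δ p) M 0 =
      nullLog E 1 p • M 0 + normalP φ ε δ p (M 2) (M 3) := by
  funext k
  simp [frameMul, coefU, nullCoefP, nullCoefQ, coefP, coefQ, normalP, nullLog, Fin.sum_univ_four]
  ring

theorem frameMul_coefU_one (E φ : ℝ × ℝ → ℝ) (ε δ : DNum) (p : ℝ × ℝ) (M : Fin 4 → Fin 4 → ℝ) :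
    frameMul (coefU E φ ε δ p) M 1 =
      nullLog E (-1) p • M 1 + normalQ φ ε δ p (M 2) (M 3) := by
  funext k
  simp [frameMul, coefU, nullCoefP, nullCoefQ, coefP, coefQ, normalQ, nullLog, Fin.sum_univ_four]
  ring

theorem frameMul_coefV_zero (E φ : ℝ × ℝ → ℝ) (ε δ : DNum) (p : ℝ × ℝ) (M : Fin 4 → Fin 4 → ℝ) :
    frameMul (coefV E φ ε δ p) M 0 =
      nullLog E 1 p • M 0 + normalP φ ε δ p (M 2) (M 3) := by
  funext k
  simp [frameMul, coefV, nullCoefP, nullCoefQ, coefP, coefQ, normalP, nullLog, Fin.sum_univ_four]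
  ring

theorem frameMul_coefV_one (E φ : ℝ × ℝ → ℝ) (ε δ : DNum) (p : ℝ × ℝ) (M : Fin 4 → Fin 4 → ℝ) :
    frameMul (coefV E φ ε δ p) M 1 =
      -(nullLog E (-1) p • M 1 + normalQ φ ε δ p (M 2) (M 3)) := by
  funext k
  simp [frameMul, coefV, nullCoefP, nullCoefQ, coefP, coefQ, normalQ, nullLog, Fin.sum_univ_four]
  ring

theorem delta_sq {δ : DNum} (h : δ = 1 ∨ δ = jj) : δ * δ = 1 := by
  rcases h with rfl | rfl
  · simp
  · exact jj_mul_jj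

theorem ip_toD (a b : Fin 4 → ℝ) : ip (toD a) (toD b) = ⟨ip a b, 0⟩ := by
  ext <;> simp [ip, toD]

theorem expj_mul_expj_neg (θ : ℝ) : expj θ * expj (-θ) = 1 := by
  ext
  · simp [expj, QuadraticAlgebra.re_one]
    nlinarith [Real.cosh_sq θ]
  · simp [expj, QuadraticAlgebra.im_one]
    ring

/-- Only the mixed products survive in the square. They give `2 * (1/2) * ε * δ²`, the exponentials
cancel, and `δ² = 1`. -/
theorem PhiPerpSq_eq {x m₁ m₂ : ℝ × ℝ → Fin 4 → ℝ} {p : ℝ × ℝ} {ε δ : DNum} {θ : ℝ}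
    (hδ : δ = 1 ∨ δ = jj) (h₁ : ip (m₁ p) (m₁ p) = 0) (h₂ : ip (m₂ p) (m₂ p) = 0)
    (h₁₂ : ip (m₁ p) (m₂ p) = 1 / 2)
    (h : PhiPrimePerp x p = (δ * expj θ) • toD (m₁ p) + (ε * δ * expj (-θ)) • toD (m₂ p)) :
    PhiPerpSq x p = ε := by
  have hz : (⟨0, 0⟩ : DNum) = 0 := rfl
  have hh : (⟨1 / 2, 0⟩ : DNum) + ⟨1 / 2, 0⟩ = 1 := by
    ext <;> simp [QuadraticAlgebra.re_one, QuadraticAlgebra.im_one]; norm_num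
  rw [PhiPerpSq, h]
  simp only [ip_add_left, ip_add_right, ip_smul_left, ip_smul_right, ip_toD, h₁, h₂, h₁₂,
    ip_comm (m₂ p) (m₁ p), hz]
  linear_combination ε * (δ * δ * (expj θ * expj (-θ))) * hh + ε * (expj θ * expj (-θ)) *
    delta_sq hδ + ε * expj_mul_expj_neg θ

/-- In isothermal coordinates with `G = -E` the trace of the second fundamental form is proportional
to the normal part of `x_uu - x_vv`. -/
theorem meanCurvature_eq_zero {x : ℝ × ℝ → Fin 4 → ℝ} {U : Set (ℝ × ℝ)} (hU : IsOpen U)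
    (hx : ContDiffOn ℝ ∞ x U) {p : ℝ × ℝ} (hp : p ∈ U)
    (hF : coeffF x p = 0) (hG : coeffG x p = -coeffE x p) (h : du (du x) p = dv (dv x) p) :
    meanCurvature x p = 0 := by
  have h1 : sff x p (1, 0) (1, 0) = sff x p (0, 1) (0, 1) := by
    rw [sff, sff, fderiv_fderiv_apply hU hx hp, fderiv_fderiv_apply hU hx hp]
    exact congrArg _ h
  rw [meanCurvature, hF, hG, h1]
  simp

end Surface

/-! ### Existence of a surface with the given data -/

section Existence

open Metric Filter Topology

theorem IsGeneralType.isCanonical {U : Set (ℝ × ℝ)} {x : ℝ × ℝ → Fin 4 → ℝ} {ε : DNum}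
    (h : IsGeneralType U x) (hε : ε = 1 ∨ ε = -1 ∨ ε = jj) (hsq : ∀ p ∈ U, PhiPerpSq x p = ε) :
    IsCanonical U x := by
  have h1 : (1 : DNum) ∈ positive := by
    simp [positive, norm_eq, QuadraticAlgebra.re_one, QuadraticAlgebra.im_one]
  refine ⟨h, ?_⟩
  rcases hε with rfl | rfl | rfl
  · exact Or.inl ⟨fun p hp => by rw [hsq p hp]; exact h1, hsq⟩
  · exact Or.inr (Or.inl ⟨fun p hp => by rw [hsq p hp, neg_neg]; exact h1, hsq⟩)
  · exact Or.inr (Or.inr ⟨fun p hp => by rw [hsq p hp, jj_mul_jj]; exact Or.inl h1, hsq⟩)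

theorem eps_not_nonInvertible {ε : DNum} (hε : ε = 1 ∨ ε = -1 ∨ ε = jj) : ε ∉ nonInvertible := by
  rcases hε with rfl | rfl | rfl <;>
    simp [nonInvertible, norm_eq, jj, QuadraticAlgebra.re_one, QuadraticAlgebra.im_one]

theorem RightOriented.smul {a b c d : Fin 4 → ℝ} (h : RightOriented a b c d) {r s : ℝ} (hr : 0 < r)
    (hs : 0 < s) : RightOriented (r • a) (s • b) c d := by
  unfold RightOriented at *
  have : (Matrix.of ![r • a, s • b, c, d]).det = r * s * (Matrix.of ![a, b, c, d]).det := by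
    simp [Matrix.det_succ_row_zero, Fin.sum_univ_succ, Fin.succAbove]
    ring
  rw [this]
  positivity

variable {E φ : ℝ × ℝ → ℝ} {ε δ : DNum} {U : Set (ℝ × ℝ)} {x : ℝ × ℝ → Fin 4 → ℝ}
  {M : ℝ × ℝ → Fin 4 → Fin 4 → ℝ}

/-- A map whose differential is read off from a solution of the frame equations with the prescribed
Gram matrix is a surface with the prescribed data. -/
theorem isSurfaceWithData_of_frame (hU : IsOpen U) (hneg : ∀ p ∈ U, E p < 0)
    (hε : ε = 1 ∨ ε = -1 ∨ ε = jj) (hδ : δ = 1 ∨ δ = jj)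
    (hM : SolvesFrame U (coefU E φ ε δ) (coefV E φ ε δ) M) (hMs : ContDiffOn ℝ ∞ M U)
    (hgram : ∀ p ∈ U, frameGram (M p) = nullGram (E p))
    (hor : ∀ p ∈ U, RightOriented (M p 0 + M p 1) (M p 0 - M p 1) (M p 2) (M p 3))
    (hx : ∀ p ∈ U, HasFDerivAt x (totalForm (M p 0 + M p 1) (M p 0 - M p 1)) p) :
    IsSurfaceWithData U x E φ ε δ := by
  have hMi : ∀ i, ContDiffOn ℝ ∞ (fun p => M p i) U := fun i => contDiffOn_pi.1 hMs i
  have hxs : ContDiffOn ℝ ∞ x U := contDiffOn_infty_of_bootstrap hU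
    (fun p hp => (hx p hp).differentiableAt.differentiableWithinAt) fun n _ =>
    ((contDiffOn_totalForm ((hMi 0).add (hMi 1)) ((hMi 0).sub (hMi 1))).congr
      fun p hp => (hx p hp).fderiv).of_le (by exact_mod_cast le_top)
  have hxu : ∀ p ∈ U, du x p = M p 0 + M p 1 := fun p hp => du_eq_of_totalForm (hx p hp)
  have hxv : ∀ p ∈ U, dv x p = M p 0 - M p 1 := fun p hp => dv_eq_of_totalForm (hx p hp)
  have hrow : ∀ p ∈ U, ∀ i, _ := fun p hp i => hM.row hp i
  have hF : ∀ p ∈ U, HasFDerivAt (fun q => M q 0)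
      (totalForm (nullLog E 1 p • M p 0 + normalP φ ε δ p (M p 2) (M p 3))
        (nullLog E 1 p • M p 0 + normalP φ ε δ p (M p 2) (M p 3))) p := fun p hp => by
    have := hrow p hp 0
    rwa [frameMul_coefU_zero, frameMul_coefV_zero] at this
  have hG : ∀ p ∈ U, HasFDerivAt (fun q => M q 1)
      (totalForm (nullLog E (-1) p • M p 1 + normalQ φ ε δ p (M p 2) (M p 3))
        (-(nullLog E (-1) p • M p 1 + normalQ φ ε δ p (M p 2) (M p 3)))) p := fun p hp => by
    have := hrow p hp 1
    rwa [frameMul_coefU_one, frameMul_coefV_one] at this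
  have hsecond : ∀ p ∈ U,
      HasFDerivAt (du x) (totalForm
        (nullLog E 1 p • M p 0 + normalP φ ε δ p (M p 2) (M p 3) +
          (nullLog E (-1) p • M p 1 + normalQ φ ε δ p (M p 2) (M p 3)))
        (nullLog E 1 p • M p 0 + normalP φ ε δ p (M p 2) (M p 3) -
          (nullLog E (-1) p • M p 1 + normalQ φ ε δ p (M p 2) (M p 3)))) p ∧
      HasFDerivAt (dv x) (totalForm
        (nullLog E 1 p • M p 0 + normalP φ ε δ p (M p 2) (M p 3) -
          (nullLog E (-1) p • M p 1 + normalQ φ ε δ p (M p 2) (M p 3)))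
        (nullLog E 1 p • M p 0 + normalP φ ε δ p (M p 2) (M p 3) +
          (nullLog E (-1) p • M p 1 + normalQ φ ε δ p (M p 2) (M p 3)))) p := fun p hp => by
    have hnear : ∀ᶠ q in 𝓝 p, q ∈ U := hU.mem_nhds hp
    constructor
    · refine (((hF p hp).add (hG p hp)).congr_of_eventuallyEq
        (hnear.mono hxu)).congr_fderiv ?_
      refine ContinuousLinearMap.ext fun w => ?_
      simp only [add_apply, totalForm_apply]
      module
    · refine (((hF p hp).sub (hG p hp)).congr_of_eventuallyEq
        (hnear.mono hxv)).congr_fderiv ?_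
      refine ContinuousLinearMap.ext fun w => ?_
      simp only [sub_apply, totalForm_apply]
      module
  have hip : ∀ p ∈ U, ∀ i j, ip (M p i) (M p j) = nullGram (E p) i j := fun p hp i j =>
    congrFun (congrFun (hgram p hp) i) j
  have hcE : ∀ p ∈ U, coeffE x p = E p := fun p hp => by
    rw [coeffE, hxu p hp]
    simp only [ip_add_left, ip_add_right, hip p hp]
    simp [nullGram]
  have hcF : ∀ p ∈ U, coeffF x p = 0 := fun p hp => by
    rw [coeffF, hxu p hp, hxv p hp]
    simp only [ip_add_left, ip_sub_right, hip p hp]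
    simp [nullGram]
  have hcG : ∀ p ∈ U, coeffG x p = -E p := fun p hp => by
    rw [coeffG, hxv p hp]
    simp only [ip_sub_left, ip_sub_right, hip p hp]
    simp [nullGram]
    ring
  have hn : ∀ p ∈ U, ∀ i, (i = 2 ∨ i = 3) →
      ip (M p i) (du x p) = 0 ∧ ip (M p i) (dv x p) = 0 := fun p hp i hi => by
    rw [hxu p hp, hxv p hp, ip_add_right, ip_sub_right, hip p hp, hip p hp]
    rcases hi with rfl | rfl <;> simp [nullGram]
  have hframe : IsIsotropicNormalFrame U x (fun p => M p 2) (fun p => M p 3) :=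
    { smooth₁ := hMi 2
      smooth₂ := hMi 3
      normal₁ := fun p hp => hn p hp 2 (Or.inl rfl)
      normal₂ := fun p hp => hn p hp 3 (Or.inr rfl)
      isotropic := fun p hp => by
        rw [hip p hp, hip p hp]
        simp [nullGram]
      product := fun p hp => by
        rw [hip p hp]
        simp [nullGram]
      oriented := fun p hp => by
        have hs : 0 < √(-E p) := Real.sqrt_pos.2 (by linarith [hneg p hp])
        rw [frameX1, frameX2, hcE p hp, hcG p hp, hxu p hp, hxv p hp]
        exact (hor p hp).smul (inv_pos.2 hs) (inv_pos.2 hs) }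
  have hperp : ∀ p ∈ U, PhiPrimePerp x p =
      (δ * expj (φ p / 2)) • toD (M p 2) + (ε * δ * expj (-(φ p / 2))) • toD (M p 3) := by
    intro p hp
    have hE0 : coeffE x p ≠ 0 := by rw [hcE p hp]; exact (hneg p hp).ne
    have hG0 : coeffG x p = -coeffE x p := by rw [hcE p hp, hcG p hp]
    have hcomb : ∀ a b : ℝ, ip (a • M p 2 + b • M p 3) (du x p) = 0 ∧
        ip (a • M p 2 + b • M p 3) (dv x p) = 0 := fun a b => by
      obtain ⟨h1, h2⟩ := hn p hp 2 (Or.inl rfl)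
      obtain ⟨h3, h4⟩ := hn p hp 3 (Or.inr rfl)
      simp [ip_add_left, ip_smul_left, h1, h2, h3, h4]
    obtain ⟨hP1, hP2⟩ : ip (normalP φ ε δ p (M p 2) (M p 3)) (du x p) = 0 ∧
        ip (normalP φ ε δ p (M p 2) (M p 3)) (dv x p) = 0 := hcomb _ _
    obtain ⟨hQ1, hQ2⟩ : ip (normalQ φ ε δ p (M p 2) (M p 3)) (du x p) = 0 ∧
        ip (normalQ φ ε δ p (M p 2) (M p 3)) (dv x p) = 0 := hcomb _ _
    obtain ⟨hu, hv⟩ := hsecond p hp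
    -- The tangential coefficients come from rewriting the null frame through `x_u` and `x_v`: the
    -- mean and half the difference of the two null logarithmic derivatives of `E`.
    have h1 : normalPart x p ((1 / 2 : ℝ) • (du (du x) p + dv (dv x) p)) =
        normalP φ ε δ p (M p 2) (M p 3) + normalQ φ ε δ p (M p 2) (M p 3) := by
      refine normalPart_eq hE0 (hcF p hp) hG0 (by rw [ip_add_left, hP1, hQ1, add_zero])
        (by rw [ip_add_left, hP2, hQ2, add_zero]) ((nullLog E 1 p + nullLog E (-1) p) / 2)
        ((nullLog E 1 p - nullLog E (-1) p) / 2) ?_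
      rw [du_eq_of_totalForm hu, dv_eq_of_totalForm hv, hxu p hp, hxv p hp]
      module
    have h2 : normalPart x p (dv (du x) p) =
        normalP φ ε δ p (M p 2) (M p 3) - normalQ φ ε δ p (M p 2) (M p 3) := by
      refine normalPart_eq hE0 (hcF p hp) hG0 (by rw [ip_sub_left, hP1, hQ1, sub_zero])
        (by rw [ip_sub_left, hP2, hQ2, sub_zero]) ((nullLog E 1 p - nullLog E (-1) p) / 2)
        ((nullLog E 1 p + nullLog E (-1) p) / 2) ?_
      rw [dv_eq_of_totalForm hu, hxu p hp, hxv p hp]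
      module
    funext i
    rw [PhiPrimePerp_eq hU hxs hp, representation_apply, h1, h2]
    rfl
  have hsq : ∀ p ∈ U, PhiPerpSq x p = ε := fun p hp =>
    PhiPerpSq_eq (m₁ := fun p => M p 2) (m₂ := fun p => M p 3) hδ (hframe.isotropic p hp).1
      (hframe.isotropic p hp).2 (hframe.product p hp) (hperp p hp)
  have hgen : IsGeneralType U x :=
    { isOpen := hU
      smooth := hxs
      immersion := fun p hp => by
        refine (injective_iff_map_eq_zero _).2 fun w hw => ?_
        rw [fderiv_eq_totalForm, totalForm_apply] at hw
        have h0 : ∀ y : Fin 4 → ℝ, ip (0 : Fin 4 → ℝ) y = 0 := fun y => by simp [ip]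
        have h1 := congrArg (fun y => ip y (du x p)) hw
        have h2 := congrArg (fun y => ip y (dv x p)) hw
        simp only [ip_add_left, ip_smul_left, h0] at h1 h2
        rw [ip_comm (dv x p) (du x p)] at h1
        change w.1 * coeffE x p + w.2 * coeffF x p = 0 at h1
        change w.1 * coeffF x p + w.2 * coeffG x p = 0 at h2
        rw [hcE p hp, hcF p hp] at h1
        rw [hcG p hp, hcF p hp] at h2
        have hE0 := (hneg p hp).ne
        ext <;> simp_all
      indefinite := fun p hp => by
        refine ⟨(1, 0), (0, 1), ?_, ?_⟩
        · exact (hcE p hp).trans_lt (hneg p hp)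
        · change 0 < coeffG x p
          rw [hcG p hp]
          linarith [hneg p hp]
      minimal := fun p hp => by
        refine meanCurvature_eq_zero hU hxs hp (hcF p hp) (by rw [hcE p hp, hcG p hp]) ?_
        rw [du_eq_of_totalForm (hsecond p hp).1, dv_eq_of_totalForm (hsecond p hp).2]
      isothermal := fun p hp => by
        rw [hcE p hp, hcF p hp, hcG p hp, neg_neg]
        exact ⟨rfl, rfl, hneg p hp⟩
      nondegenerate := fun p hp => by
        rw [hsq p hp]
        exact eps_not_nonInvertible hε }
  exact { toIsCanonical := hgen.isCanonical hε hsq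
          coeffE_eq := hcE
          representation := ⟨_, _, hframe, hperp⟩ }

/-- The coefficients of the frame equations are bounded on small balls. -/
theorem exists_coef_bound {D : Set (ℝ × ℝ)} (hD : IsOpen D) (hE : ContDiffOn ℝ ∞ E D)
    (hφ : ContDiffOn ℝ ∞ φ D) (hneg : ∀ p ∈ D, E p < 0) (ε δ : DNum) {p₀ : ℝ × ℝ} (hp₀ : p₀ ∈ D) :
    ∃ r > 0, ∃ K, ball p₀ r ⊆ D ∧
      (∀ p ∈ ball p₀ r, ‖coefU E φ ε δ p‖ ≤ K) ∧ ∀ p ∈ ball p₀ r, ‖coefV E φ ε δ p‖ ≤ K := by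
  obtain ⟨R, hR, hRD⟩ := nhds_basis_closedBall.mem_iff.1 (hD.mem_nhds hp₀)
  have hP := contDiffOn_nullCoefP hD hE hneg hφ ε δ
  have hQ := contDiffOn_nullCoefQ hD hE hneg hφ ε δ
  obtain ⟨C₁, h₁⟩ := (isCompact_closedBall p₀ R).exists_bound_of_continuousOn
    ((hP.add hQ).continuousOn.mono hRD)
  obtain ⟨C₂, h₂⟩ := (isCompact_closedBall p₀ R).exists_bound_of_continuousOn
    ((hP.sub hQ).continuousOn.mono hRD)
  exact ⟨R, hR, max C₁ C₂, ball_subset_closedBall.trans hRD,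
    fun p hp => (h₁ p (ball_subset_closedBall hp)).trans (le_max_left _ _),
    fun p hp => (h₂ p (ball_subset_closedBall hp)).trans (le_max_right _ _)⟩

theorem exists_isSurfaceWithData {D : Set (ℝ × ℝ)} (hD : IsOpen D) (hE : ContDiffOn ℝ ∞ E D)
    (hφ : ContDiffOn ℝ ∞ φ D) (hsys : SolvesNaturalSystem D E φ ε δ) {p₀ : ℝ × ℝ} (hp₀ : p₀ ∈ D) :
    ∃ r > 0, ball p₀ r ⊆ D ∧ ∃ x, IsSurfaceWithData (ball p₀ r) x E φ ε δ := by
  have hneg := hsys.E_neg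
  have hP := contDiffOn_nullCoefP hD hE hneg hφ ε δ
  have hQ := contDiffOn_nullCoefQ hD hE hneg hφ ε δ
  obtain ⟨M₀, hM₀, hor₀⟩ := exists_initial_frame (hneg p₀ hp₀)
  obtain ⟨r₁, hr₁, hr₁D, M, rfl, hM⟩ := exists_solvesFrame hD
    (A := coefU E φ ε δ) (B := coefV E φ ε δ) (hP.add hQ) (hP.sub hQ)
    (fun p hp => coefUV_compat hD hE hφ hsys hp) hp₀ M₀
  obtain ⟨r₂, hr₂, K, hr₂D, hA, hB⟩ := exists_coef_bound hD hE hφ hneg ε δ hp₀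
  -- Right orientation is an open condition, so it holds on a ball around `p₀` once the initial
  -- frame has it.
  have hcont : ContinuousAt (fun p => (Matrix.of ![M p 0 + M p 1, M p 0 - M p 1, M p 2, M p 3]).det)
      p₀ := by
    have hMc : ContinuousAt M p₀ := (hM p₀ (mem_ball_self hr₁)).continuousAt
    have hMi : ∀ i, ContinuousAt (fun p => M p i) p₀ := fun i => (continuousAt_pi.1 hMc) i
    refine (Continuous.matrix_det continuous_id).continuousAt.comp
      (f := fun p => Matrix.of ![M p 0 + M p 1, M p 0 - M p 1, M p 2, M p 3])
      (continuousAt_pi.2 fun i => ?_)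
    fin_cases i
    exacts [(hMi 0).add (hMi 1), (hMi 0).sub (hMi 1), hMi 2, hMi 3]
  obtain ⟨r₃, hr₃, hr₃D⟩ := Metric.mem_nhds_iff.1 (hcont.eventually (lt_mem_nhds hor₀))
  set r := min r₁ (min r₂ r₃) with hr
  have h1 : ball p₀ r ⊆ ball p₀ r₁ := ball_subset_ball (min_le_left _ _)
  have h2 : ball p₀ r ⊆ ball p₀ r₂ :=
    ball_subset_ball ((min_le_right _ _).trans (min_le_left _ _))
  have h3 : ball p₀ r ⊆ ball p₀ r₃ :=
    ball_subset_ball ((min_le_right _ _).trans (min_le_right _ _))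
  have hrD := h1.trans hr₁D
  have hMr := hM.mono h1
  have hMs := hMr.contDiffOn isOpen_ball ((hP.add hQ).mono hrD) ((hP.sub hQ).mono hrD)
  have hgram : ∀ p ∈ ball p₀ r, frameGram (M p) = nullGram (E p) := fun p hp =>
    hMr.frameGram_eq (fun p hp => (hE.differentiableOn (by simp)).differentiableAt
      (hD.mem_nhds (hrD hp))) (fun p hp => hneg p (hrD hp)) (fun p hp => hA p (h2 hp))
      (fun p hp => hB p (h2 hp)) hM₀ hp
  have hrow : ∀ p ∈ ball p₀ r, ∀ i, _ := fun p hp i => hMr.row hp i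
  -- The form is closed because the first frame vector has equal `u`- and `v`-derivatives and the
  -- second has opposite ones.
  obtain ⟨x, hx⟩ := exists_primitive (α := fun p => M p 0 + M p 1) (β := fun p => M p 0 - M p 1)
    (fun p hp => ((hrow p hp 0).add (hrow p hp 1)).differentiableAt)
    (fun p hp => ((hrow p hp 0).sub (hrow p hp 1)).differentiableAt) (fun p hp => by
      rw [dv, du, ((hrow p hp 0).fun_add (hrow p hp 1)).fderiv,
        ((hrow p hp 0).fun_sub (hrow p hp 1)).fderiv]
      simp only [add_apply, sub_apply, totalForm_apply, frameMul_coefU_zero, frameMul_coefU_one,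
        frameMul_coefV_zero, frameMul_coefV_one]
      module)
  exact ⟨r, lt_min hr₁ (lt_min hr₂ hr₃), hrD, x, isSurfaceWithData_of_frame isOpen_ball
    (fun p hp => hneg p (hrD hp)) hsys.eps hsys.del hMr hMs hgram (fun p hp => hr₃D (h3 hp)) hx⟩

end Existence

/-! ### Frames with a common Gram matrix and proper motions -/

section FrameAlgebra

open Matrix

/-- The matrix of the product of `ℝ⁴₂`. -/
def metricMatrix : Matrix (Fin 4) (Fin 4) ℝ := Matrix.diagonal ![-1, 1, -1, 1]

theorem ip_eq_dotProduct (a b : Fin 4 → ℝ) : ip a b = a ⬝ᵥ metricMatrix *ᵥ b := by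
  simp [ip, metricMatrix, dotProduct, Matrix.mulVec_diagonal, Fin.sum_univ_four]
  ring

theorem det_metricMatrix : metricMatrix.det = 1 := by
  simp [metricMatrix, Fin.prod_univ_four]

theorem gram_eq_mul (M : Fin 4 → Fin 4 → ℝ) :
    Matrix.of M * metricMatrix * (Matrix.of M)ᵀ = Matrix.of (frameGram M) := by
  ext i j
  simp [Matrix.mul_apply, metricMatrix, frameGram, ip, Fin.sum_univ_four]
  ring

theorem det_nullGram (E : ℝ) : (Matrix.of (nullGram E)).det = E ^ 2 / 16 := by
  simp [nullGram, Matrix.det_succ_row_zero, Fin.sum_univ_succ, Fin.succAbove]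
  ring

theorem det_frame_sq {M : Fin 4 → Fin 4 → ℝ} {E : ℝ} (h : frameGram M = nullGram E) :
    (Matrix.of M).det ^ 2 = E ^ 2 / 16 := by
  have := congrArg Matrix.det (gram_eq_mul M)
  rw [h, det_nullGram, det_mul, det_mul, det_transpose, det_metricMatrix] at this
  linarith

theorem det_frame_ne_zero {M : Fin 4 → Fin 4 → ℝ} {E : ℝ} (hE : E ≠ 0)
    (h : frameGram M = nullGram E) : (Matrix.of M).det ≠ 0 := by
  intro h0
  have := det_frame_sq h
  rw [h0] at this
  have : 0 < E ^ 2 := by positivity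
  linarith

/-- A vector is determined by its products with the vectors of a frame. -/
theorem eq_of_ip_frame_eq {M : Fin 4 → Fin 4 → ℝ} {E : ℝ} (hE : E ≠ 0)
    (h : frameGram M = nullGram E) {y z : Fin 4 → ℝ} (hyz : ∀ j, ip y (M j) = ip z (M j)) :
    y = z := by
  have h1 : Matrix.of M *ᵥ (metricMatrix *ᵥ (y - z)) = 0 := by
    funext j
    change M j ⬝ᵥ metricMatrix *ᵥ (y - z) = 0
    rw [← ip_eq_dotProduct, ip_sub_right, ip_comm, hyz, ip_comm, sub_self]
  have h2 := eq_zero_of_mulVec_eq_zero (det_frame_ne_zero hE h) h1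
  have h3 := eq_zero_of_mulVec_eq_zero (by rw [det_metricMatrix]; exact one_ne_zero) h2
  exact sub_eq_zero.1 h3

/-- Passing from the null pair to its sum and difference multiplies the determinant by `-2`, which
explains why right orientation of the surface frame means a negative determinant of the null frame.
-/
theorem rightOriented_null_iff (a b c d : Fin 4 → ℝ) :
    RightOriented (a + b) (a - b) c d ↔ (Matrix.of ![a, b, c, d]).det < 0 := by
  have : (Matrix.of ![a + b, a - b, c, d]).det = -2 * (Matrix.of ![a, b, c, d]).det := by
    simp [Matrix.det_succ_row_zero, Fin.sum_univ_succ, Fin.succAbove]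
    ring
  rw [RightOriented, this]
  constructor <;> intro h <;> linarith

/-- Two frames with the same Gram matrix and orientation differ by a proper motion. -/
theorem exists_motion {M N : Fin 4 → Fin 4 → ℝ} {E : ℝ} (hE : E ≠ 0)
    (hM : frameGram M = nullGram E) (hN : frameGram N = nullGram E)
    (hMd : (Matrix.of M).det < 0) (hNd : (Matrix.of N).det < 0) :
    ∃ A : Matrix (Fin 4) (Fin 4) ℝ, IsProperMotion A ∧ ∀ i, A *ᵥ M i = N i := by
  set m := Matrix.of M with hm
  set n := Matrix.of N with hn
  have hu : IsUnit m.det := (det_frame_ne_zero hE hM).isUnit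
  have hG : m * metricMatrix * mᵀ = n * metricMatrix * nᵀ := by
    rw [hm, hn, gram_eq_mul, gram_eq_mul, hM, hN]
  have hmt : IsUnit mᵀ.det := by rwa [det_transpose]
  have hR : (m⁻¹ * n) * metricMatrix * (m⁻¹ * n)ᵀ = metricMatrix := by
    rw [transpose_mul, transpose_nonsing_inv]
    calc m⁻¹ * n * metricMatrix * (nᵀ * mᵀ⁻¹) = m⁻¹ * (n * metricMatrix * nᵀ) * mᵀ⁻¹ := by
          simp only [Matrix.mul_assoc]
      _ = m⁻¹ * (m * metricMatrix * mᵀ) * mᵀ⁻¹ := by rw [hG]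
      _ = (m⁻¹ * m) * metricMatrix * (mᵀ * mᵀ⁻¹) := by simp only [Matrix.mul_assoc]
      _ = metricMatrix := by
        rw [nonsing_inv_mul _ hu, mul_nonsing_inv _ hmt, Matrix.one_mul, Matrix.mul_one]
  -- Frame vectors are rows, so `m * (m⁻¹ * n) = n` says that the transpose of `m⁻¹ * n` carries `M
  -- i` to `N i`.
  refine ⟨(m⁻¹ * n)ᵀ, ⟨fun a b => ?_, ?_⟩, fun i => ?_⟩
  · rw [ip_eq_dotProduct, ip_eq_dotProduct, ← vecMul_transpose, transpose_transpose,
      ← dotProduct_mulVec, mulVec_mulVec, mulVec_mulVec, hR]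
  · have h1 : (m⁻¹ * n).det = m.det⁻¹ * n.det := by
      rw [det_mul, det_nonsing_inv, Ring.inverse_eq_inv']
    have h2 := congrArg Matrix.det hR
    rw [det_mul, det_mul, det_transpose, det_metricMatrix] at h2
    have h3 : 0 < (m⁻¹ * n).det := by
      rw [h1]
      exact mul_pos_of_neg_of_neg (inv_lt_zero.2 hMd) hNd
    rw [det_transpose]
    -- The square of the determinant is `1` because the product is preserved; equal orientations
    -- make it positive.
    nlinarith
  · rw [mulVec_transpose]
    have h1 : M i = (Pi.single i 1 : Fin 4 → ℝ) ᵥ* m := by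
      rw [single_one_vecMul]; rfl
    rw [h1, vecMul_vecMul, ← Matrix.mul_assoc, mul_nonsing_inv _ hu, Matrix.one_mul,
      single_one_vecMul]
    rfl

theorem frameMul_mulVec (A : Matrix (Fin 4) (Fin 4) ℝ) (c M : Fin 4 → Fin 4 → ℝ) (i : Fin 4) :
    A *ᵥ frameMul c M i = frameMul c (fun j => A *ᵥ M j) i := by
  funext k
  simp only [frameMul, mulVec, dotProduct, Finset.mul_sum]
  rw [Finset.sum_comm]
  exact Finset.sum_congr rfl fun _ _ => Finset.sum_congr rfl fun _ _ => by ring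

theorem hasFDerivAt_mulVec (A : Matrix (Fin 4) (Fin 4) ℝ) {f : ℝ × ℝ → Fin 4 → ℝ}
    {a b : Fin 4 → ℝ} {p : ℝ × ℝ} (hf : HasFDerivAt f (totalForm a b) p) :
    HasFDerivAt (fun q => A *ᵥ f q) (totalForm (A *ᵥ a) (A *ᵥ b)) p := by
  refine ((LinearMap.toContinuousLinearMap A.mulVecLin).hasFDerivAt.comp p hf).congr_fderiv ?_
  ext1 <;> ext1 <;> simp [totalForm]

theorem SolvesFrame.mulVec {U : Set (ℝ × ℝ)} {a b M : ℝ × ℝ → Fin 4 → Fin 4 → ℝ}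
    (hM : SolvesFrame U a b M) (A : Matrix (Fin 4) (Fin 4) ℝ) :
    SolvesFrame U a b (fun p i => A *ᵥ M p i) := by
  intro p hp
  refine hasFDerivAt_pi'.2 fun i => (hasFDerivAt_mulVec A (hM.row hp i)).congr_fderiv ?_
  rw [frameMul_mulVec, frameMul_mulVec]
  ext1 <;> ext1 <;> simp [totalForm]

end FrameAlgebra

/-! ### Derivative identities and the wave equation of a minimal surface -/

section GaussWeingarten

open Metric Filter Topology

theorem normalPart_sub (x : ℝ × ℝ → Fin 4 → ℝ) (p : ℝ × ℝ) (a b : Fin 4 → ℝ) :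
    normalPart x p (a - b) = normalPart x p a - normalPart x p b := by
  simp only [normalPart, ip_sub_left]
  module

theorem ip_normalPart_of_normal {x : ℝ × ℝ → Fin 4 → ℝ} {p : ℝ × ℝ} {n : Fin 4 → ℝ}
    (hu : ip n (du x p) = 0) (hv : ip n (dv x p) = 0) (a : Fin 4 → ℝ) :
    ip (normalPart x p a) n = ip a n := by
  rw [ip_comm] at hu hv
  simp [normalPart, ip_sub_left, ip_add_left, ip_smul_left, hu, hv]

theorem hasFDerivAt_totalForm {V : Type} [NormedAddCommGroup V] [NormedSpace ℝ V]
    {f : ℝ × ℝ → V} {p : ℝ × ℝ} (hf : DifferentiableAt ℝ f p) :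
    HasFDerivAt f (totalForm (du f p) (dv f p)) p := by
  rw [← fderiv_eq_totalForm]
  exact hf.hasFDerivAt

theorem totalForm_injective {V : Type} [NormedAddCommGroup V] [NormedSpace ℝ V] {a b c d : V}
    (h : totalForm a b = totalForm c d) : a = c ∧ b = d := by
  constructor
  · simpa using congrArg (fun L => L (1, 0)) h
  · simpa using congrArg (fun L => L (0, 1)) h

theorem totalForm_unique {V : Type} [NormedAddCommGroup V] [NormedSpace ℝ V] {f g : ℝ × ℝ → V}
    {U : Set (ℝ × ℝ)} (hU : IsOpen U) (hfg : ∀ q ∈ U, f q = g q) {p : ℝ × ℝ} (hp : p ∈ U)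
    {a b c d : V} (hf : HasFDerivAt f (totalForm a b) p) (hg : HasFDerivAt g (totalForm c d) p) :
    a = c ∧ b = d := by
  refine totalForm_injective (hf.unique (hg.congr_of_eventuallyEq ?_))
  have hnear : ∀ᶠ q in 𝓝 p, q ∈ U := hU.mem_nhds hp
  exact hnear.mono hfg

theorem differentiableAt_of_contDiffOn {V : Type} [NormedAddCommGroup V] [NormedSpace ℝ V]
    {f : ℝ × ℝ → V} {U : Set (ℝ × ℝ)} (hf : ContDiffOn ℝ ∞ f U) (hU : IsOpen U) {p : ℝ × ℝ}
    (hp : p ∈ U) : DifferentiableAt ℝ f p :=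
  (hf.differentiableOn (by simp)).differentiableAt (hU.mem_nhds hp)

theorem totalForm_add {V : Type} [NormedAddCommGroup V] [NormedSpace ℝ V] (a b c d : V) :
    totalForm a b + totalForm c d = totalForm (a + c) (b + d) := by
  refine ContinuousLinearMap.ext fun w => ?_
  simp only [add_apply, totalForm_apply]
  module

theorem hasFDerivAt_zero_totalForm {V : Type} [NormedAddCommGroup V] [NormedSpace ℝ V]
    (p : ℝ × ℝ) : HasFDerivAt (fun _ : ℝ × ℝ => (0 : V)) (totalForm 0 0) p :=
  (hasFDerivAt_const 0 p).congr_fderiv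
    (ContinuousLinearMap.ext fun w => by simp)

variable {x : ℝ × ℝ → Fin 4 → ℝ} {U : Set (ℝ × ℝ)}

/-- In isothermal coordinates a minimal time-like surface satisfies the wave equation. -/
theorem IsMinimalSurface.wave (h : IsMinimalSurface U x) (hiso : IsIsothermal U x) {p : ℝ × ℝ}
    (hp : p ∈ U) : du (du x) p = dv (dv x) p := by
  have hU := h.isOpen
  have hxs := h.smooth
  have hu := hasFDerivAt_totalForm
    (differentiableAt_of_contDiffOn (contDiffOn_du hxs hU) hU hp)
  have hv := hasFDerivAt_totalForm
    (differentiableAt_of_contDiffOn (contDiffOn_dv hxs hU) hU hp)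
  obtain ⟨hEG, hF, hE⟩ := hiso p hp
  have hG : coeffG x p = -coeffE x p := by linarith
  have hcomm := du_dv_comm hU hxs hp
  have hsum := (hasFDerivAt_ip hu hu).add (hasFDerivAt_ip hv hv)
  rw [totalForm_add] at hsum
  obtain ⟨e1, e2⟩ := totalForm_unique hU (fun q hq => by
    have := (hiso q hq).1
    simp only [coeffE, coeffG] at this
    simp only [Pi.add_apply]
    linarith) hp hsum (hasFDerivAt_zero_totalForm p)
  obtain ⟨e3, e4⟩ := totalForm_unique hU (fun q hq => (hiso q hq).2.1) hp
    (hasFDerivAt_ip hu hv) (hasFDerivAt_zero_totalForm p)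
  rw [← hcomm] at e1 e3
  rw [ip_comm (du x p), ip_comm (dv x p)] at e1 e2
  rw [ip_comm (du x p)] at e3 e4
  -- The differentiated relations `E + G = 0` and `F = 0` show that `x_uu - x_vv` is normal: the
  -- first one's `u`-derivative pairs with the second one's `v`-derivative, and conversely in `hwv`.
  -- Vanishing mean curvature will kill its normal part.
  have hwu : ip (du (du x) p - dv (dv x) p) (du x p) = 0 := by
    rw [ip_sub_left]; linarith
  have hwv : ip (du (du x) p - dv (dv x) p) (dv x p) = 0 := by
    rw [ip_sub_left]; linarith
  have hmin := h.minimal p hp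
  have hn : normalPart x p (du (du x) p - dv (dv x) p) = 0 := by
    simp only [meanCurvature, hF, hG, sff, fderiv_fderiv_apply hU hxs hp] at hmin
    change _ • (-coeffE x p • normalPart x p (du (du x) p) - (0 : ℝ) • _ +
      coeffE x p • normalPart x p (dv (dv x) p)) = 0 at hmin
    rw [normalPart_sub]
    have hne : 1 / (2 * (coeffE x p * -coeffE x p - 0 ^ 2)) ≠ 0 := by
      have := hE.ne
      simp [this]
    have h0 := (smul_eq_zero.1 hmin).resolve_left hne
    have h1 : coeffE x p • (normalPart x p (du (du x) p) - normalPart x p (dv (dv x) p)) = 0 := by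
      rw [← neg_eq_zero, ← h0]
      module
    exact (smul_eq_zero.1 h1).resolve_left hE.ne
  have hw := normalPart_eq hE.ne hF hG hwu hwv 0 0 (a := du (du x) p - dv (dv x) p) (by simp)
  exact sub_eq_zero.1 (hw.symm.trans hn)

end GaussWeingarten

/-! ### Recovering the derivative of a frame from scalar products -/

section FrameEquations

open Metric Filter Topology

theorem ip_frameMul (c M : Fin 4 → Fin 4 → ℝ) (i j : Fin 4) :
    ip (frameMul c M i) (M j) = ∑ k, c i k * frameGram M k j :=
  ip_sum_left (c i) M (M j)

/-- Six entries determine an antisymmetric 4 by 4 matrix. The entry `D 3 2` is used in place of `D 2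
3` because the rotation coefficient is later computed from the derivative of `m₂` paired with `m₁`.
-/
theorem eq_zero_of_antisymm {D : Fin 4 → Fin 4 → ℝ} (h : ∀ i j, D i j + D j i = 0)
    (h01 : D 0 1 = 0) (h02 : D 0 2 = 0) (h03 : D 0 3 = 0) (h12 : D 1 2 = 0) (h13 : D 1 3 = 0)
    (h32 : D 3 2 = 0) : D = 0 := by
  funext i j
  have hij := h i j
  have hii := h i i
  fin_cases i <;> fin_cases j <;> simp at hij hii ⊢ <;> linarith

/-- A vector-valued derivative of a frame is determined by its rotational part. -/
theorem eq_frameMul_of_gram {M N c : Fin 4 → Fin 4 → ℝ} {E : ℝ} (hE : E ≠ 0)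
    (hM : frameGram M = nullGram E)
    (hS : ∀ i j, ip (N i) (M j) + ip (M i) (N j) = gramAction c (nullGram E) i j)
    (h01 : ip (N 0) (M 1) = ∑ k, c 0 k * nullGram E k 1)
    (h02 : ip (N 0) (M 2) = ∑ k, c 0 k * nullGram E k 2)
    (h03 : ip (N 0) (M 3) = ∑ k, c 0 k * nullGram E k 3)
    (h12 : ip (N 1) (M 2) = ∑ k, c 1 k * nullGram E k 2)
    (h13 : ip (N 1) (M 3) = ∑ k, c 1 k * nullGram E k 3)
    (h32 : ip (N 3) (M 2) = ∑ k, c 3 k * nullGram E k 2) (i : Fin 4) : N i = frameMul c M i := by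
  have hD := eq_zero_of_antisymm
    (D := fun i j => ip (N i) (M j) - ∑ k, c i k * nullGram E k j) (fun i j => by
      have h1 := hS i j
      have hsymm : ∀ k, nullGram E i k = nullGram E k i := fun k => by
        rw [← hM]; exact ip_comm _ _
      rw [gramAction] at h1
      simp only [hsymm] at h1
      rw [ip_comm (M i)] at h1
      linarith) (sub_eq_zero.2 h01) (sub_eq_zero.2 h02) (sub_eq_zero.2 h03) (sub_eq_zero.2 h12)
      (sub_eq_zero.2 h13) (sub_eq_zero.2 h32)
  refine eq_of_ip_frame_eq hE hM fun j => ?_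
  rw [ip_frameMul, hM]
  exact sub_eq_zero.1 (congrFun (congrFun hD i) j)

/-- The rotation coefficient of a pair of isotropic fields in a null direction, recovered from a
field that is constant in this direction. -/
theorem ip_directional_eq {Y m : ℝ × ℝ → Fin 4 → ℝ} {θ : ℝ × ℝ → ℝ} {U : Set (ℝ × ℝ)}
    (hU : IsOpen U) {p : ℝ × ℝ} (hp : p ∈ U) {y y' a b g n : Fin 4 → ℝ} {c r β s : ℝ}
    (hc : c ≠ 0) (hY : HasFDerivAt Y (totalForm y y') p) (hyy : y + s • y' = 0)
    (hm : HasFDerivAt m (totalForm a b) p) (hθ : DifferentiableAt ℝ θ p)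
    (h : ∀ q ∈ U, ip (Y q) (m q) = c * Real.exp (θ q))
    (hYp : Y p = r • g + (2 * (c * Real.exp (θ p))) • n + β • m p)
    (hg : ip g (a + s • b) = 0) (hmm : ip (m p) (a + s • b) = 0) :
    ip n (a + s • b) = (du θ p + s * dv θ p) / 2 := by
  have hexp : HasFDerivAt (fun q => c * Real.exp (θ q))
      (totalForm (c * Real.exp (θ p) * du θ p) (c * Real.exp (θ p) * dv θ p)) p := by
    refine (((hasFDerivAt_totalForm hθ).exp).const_mul c).congr_fderiv ?_
    ext <;> simp [totalForm] <;> ring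
  obtain ⟨e1, e2⟩ := totalForm_unique hU h hp (hasFDerivAt_ip hY hm) hexp
  have h0 : ip (y + s • y') (m p) = 0 := by rw [hyy]; simp [ip]
  rw [ip_add_left, ip_smul_left] at h0
  -- As `Y` is constant along the direction, the derivative of its product with `m` falls entirely
  -- on `m`. After expanding `Y p`, only the `n` term pairs nontrivially with that derivative.
  have h1 : ip (Y p) (a + s • b) = c * Real.exp (θ p) * (du θ p + s * dv θ p) := by
    rw [ip_add_right, ip_smul_right]
    linear_combination e1 + s * e2 - h0
  rw [hYp, ip_add_left, ip_add_left, ip_smul_left, ip_smul_left, ip_smul_left, hg, hmm] at h1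
  have hne : c * Real.exp (θ p) ≠ 0 := mul_ne_zero hc (Real.exp_pos _).ne'
  apply mul_left_cancel₀ hne
  linarith

end FrameEquations

/-! ### From the Gauss formulas to the Weingarten formulas -/

section FrameEquations

open Metric Filter Topology

variable {U : Set (ℝ × ℝ)} {E φ : ℝ × ℝ → ℝ} {ε δ : DNum} {M : ℝ × ℝ → Fin 4 → Fin 4 → ℝ}
  {p : ℝ × ℝ}

theorem gram_deriv_eq (hU : IsOpen U) (hE : ContDiffOn ℝ ∞ E U) (hneg : ∀ p ∈ U, E p < 0)
    (hgram : ∀ p ∈ U, frameGram (M p) = nullGram (E p)) {N N' : Fin 4 → Fin 4 → ℝ}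
    (hM : ∀ i, HasFDerivAt (fun q => M q i) (totalForm (N i) (N' i)) p) (hp : p ∈ U) (i j : Fin 4) :
    ip (N i) (M p j) + ip (M p i) (N j) =
        gramAction (coefU E φ ε δ p) (nullGram (E p)) i j ∧
      ip (N' i) (M p j) + ip (M p i) (N' j) =
        gramAction (coefV E φ ε δ p) (nullGram (E p)) i j := by
  have h := hasFDerivAt_pi'.1 (hasFDerivAt_pi'.1 (hasFDerivAt_nullGram φ ε δ
    (differentiableAt_of_contDiffOn hE hU hp) (hneg p hp)) i) j
  exact totalForm_unique hU (fun q hq => congrFun (congrFun (hgram q hq) i) j) hp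
    (hasFDerivAt_ip (hM i) (hM j)) (h.congr_fderiv (by ext <;> simp [totalForm]))

theorem gram_nullDeriv_eq (hU : IsOpen U) (hE : ContDiffOn ℝ ∞ E U) (hneg : ∀ p ∈ U, E p < 0)
    (hgram : ∀ p ∈ U, frameGram (M p) = nullGram (E p)) {N N' : Fin 4 → Fin 4 → ℝ}
    (hM : ∀ i, HasFDerivAt (fun q => M q i) (totalForm (N i) (N' i)) p) (hp : p ∈ U) (i j : Fin 4) :
    ip ((1 / 2 : ℝ) • (N i + N' i)) (M p j) + ip (M p i) ((1 / 2 : ℝ) • (N j + N' j)) =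
        gramAction (nullCoefP E φ ε δ p) (nullGram (E p)) i j ∧
      ip ((1 / 2 : ℝ) • (N i - N' i)) (M p j) + ip (M p i) ((1 / 2 : ℝ) • (N j - N' j)) =
        gramAction (nullCoefQ E φ ε δ p) (nullGram (E p)) i j := by
  obtain ⟨h1, h2⟩ := gram_deriv_eq (φ := φ) (ε := ε) (δ := δ) hU hE hneg hgram hM hp i j
  rw [coefU, gramAction_add_left, Pi.add_apply, Pi.add_apply] at h1
  rw [coefV, gramAction_sub_left, Pi.sub_apply, Pi.sub_apply] at h2
  simp only [ip_smul_left, ip_smul_right, ip_add_left, ip_add_right, ip_sub_left, ip_sub_right]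
  constructor <;> linarith

theorem frameMul_nullCoefP_zero (E φ : ℝ × ℝ → ℝ) (ε δ : DNum) (p : ℝ × ℝ)
    (M : Fin 4 → Fin 4 → ℝ) : frameMul (nullCoefP E φ ε δ p) M 0 =
      nullLog E 1 p • M 0 + normalP φ ε δ p (M 2) (M 3) := by
  funext k
  simp [frameMul, nullCoefP, coefP, normalP, nullLog, Fin.sum_univ_four]
  ring

theorem frameMul_nullCoefQ_one (E φ : ℝ × ℝ → ℝ) (ε δ : DNum) (p : ℝ × ℝ)
    (M : Fin 4 → Fin 4 → ℝ) : frameMul (nullCoefQ E φ ε δ p) M 1 =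
      nullLog E (-1) p • M 1 + normalQ φ ε δ p (M 2) (M 3) := by
  funext k
  simp [frameMul, nullCoefQ, coefQ, normalQ, nullLog, Fin.sum_univ_four]
  ring

/-- A moving null frame satisfying the Gauss formulas also satisfies the Weingarten formulas. -/
theorem solvesFrame_of_gauss (hU : IsOpen U) (hE : ContDiffOn ℝ ∞ E U) (hneg : ∀ p ∈ U, E p < 0)
    (hφ : ContDiffOn ℝ ∞ φ U) (hM : ContDiffOn ℝ ∞ M U) (hd : δ.re + δ.im ≠ 0)
    (hd' : δ.re - δ.im ≠ 0)
    (hgram : ∀ p ∈ U, frameGram (M p) = nullGram (E p))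
    (hP : ∀ p ∈ U, du (fun q => M q 0) p =
      nullLog E 1 p • M p 0 + normalP φ ε δ p (M p 2) (M p 3))
    (hP' : ∀ p ∈ U, dv (fun q => M q 0) p = du (fun q => M q 0) p)
    (hQ : ∀ p ∈ U, du (fun q => M q 1) p =
      nullLog E (-1) p • M p 1 + normalQ φ ε δ p (M p 2) (M p 3))
    (hQ' : ∀ p ∈ U, dv (fun q => M q 1) p = -du (fun q => M q 1) p) :
    SolvesFrame U (coefU E φ ε δ) (coefV E φ ε δ) M := by
  intro p hp
  have hsm : ∀ i, ContDiffOn ℝ ∞ (fun q => M q i) U := fun i => contDiffOn_pi.1 hM i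
  have hrow : ∀ i, HasFDerivAt (fun q => M q i)
      (totalForm (du (fun q => M q i) p) (dv (fun q => M q i) p)) p := fun i =>
    hasFDerivAt_totalForm (differentiableAt_of_contDiffOn (hsm i) hU hp)
  have hS := gram_nullDeriv_eq (φ := φ) (ε := ε) (δ := δ) hU hE hneg hgram hrow hp
  have hz := exp_neg_logAbs_mul (hneg p hp)
  have hSP := fun i j => (hS i j).1
  have hSQ := fun i j => (hS i j).2
  have hGP : gramAction (nullCoefP E φ ε δ p) (nullGram (E p)) = _ := gramAction_coefP hz
  have hGQ : gramAction (nullCoefQ E φ ε δ p) (nullGram (E p)) = _ := gramAction_coefQ hz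
  have hip : ∀ q ∈ U, ∀ i j, ip (M q i) (M q j) = nullGram (E q) i j := fun q hq i j =>
    congrFun (congrFun (hgram q hq) i) j
  have hφd := differentiableAt_of_contDiffOn hφ hU hp
  have hP0 : (1 / 2 : ℝ) • (du (fun q => M q 0) p + dv (fun q => M q 0) p) =
      frameMul (nullCoefP E φ ε δ p) (M p) 0 := by
    rw [hP' p hp, frameMul_nullCoefP_zero, ← hP p hp]; module
  have hP1 : (1 / 2 : ℝ) • (du (fun q => M q 1) p + dv (fun q => M q 1) p) = 0 := by
    rw [hQ' p hp]; module
  have hQ0 : (1 / 2 : ℝ) • (du (fun q => M q 0) p - dv (fun q => M q 0) p) = 0 := by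
    rw [hP' p hp]; module
  have hQ1 : (1 / 2 : ℝ) • (du (fun q => M q 1) p - dv (fun q => M q 1) p) =
      frameMul (nullCoefQ E φ ε δ p) (M p) 1 := by
    rw [hQ' p hp, frameMul_nullCoefQ_one, ← hQ p hp]; module
  have hzero : ∀ y : Fin 4 → ℝ, ip 0 y = 0 := fun y => by simp [ip]
  -- The `u`-derivative of the second frame vector is itself constant along `∂_u + ∂_v`. This
  -- Codazzi-type relation, and `hYP` for the other direction, fix the rotation of `m₁, m₂`.
  have hYQ : du (du fun q => M q 1) p + (1 : ℝ) • dv (du fun q => M q 1) p = 0 := by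
    have hY := hasFDerivAt_totalForm
      (differentiableAt_of_contDiffOn (contDiffOn_du (hsm 1) hU) hU hp)
    have hsum := hY.add (hasFDerivAt_totalForm
      (differentiableAt_of_contDiffOn (contDiffOn_dv (hsm 1) hU) hU hp))
    rw [totalForm_add] at hsum
    have h1 := totalForm_unique hU (fun q hq => by
      rw [Pi.add_apply, hQ' q hq, add_neg_cancel]) hp hsum (hasFDerivAt_zero_totalForm p)
    rw [one_smul, du_dv_comm hU (hsm 1) hp]
    exact h1.1
  have hYP : du (du fun q => M q 0) p + (-1 : ℝ) • dv (du fun q => M q 0) p = 0 := by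
    have h1 := totalForm_unique hU hP' hp
      (hasFDerivAt_totalForm (differentiableAt_of_contDiffOn (contDiffOn_dv (hsm 0) hU) hU hp))
      (hasFDerivAt_totalForm
        (differentiableAt_of_contDiffOn (contDiffOn_du (hsm 0) hU) hU hp))
    rw [du_dv_comm hU (hsm 0) hp, h1.1]
    module
  have hP13 := (hSP 1 3).trans (show _ = (0 : ℝ) by rw [hGP]; rfl)
  have hP33 := (hSP 3 3).trans (show _ = (0 : ℝ) by rw [hGP]; rfl)
  have hQ03 := (hSQ 0 3).trans (show _ = (0 : ℝ) by rw [hGQ]; rfl)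
  have hQ33 := (hSQ 3 3).trans (show _ = (0 : ℝ) by rw [hGQ]; rfl)
  rw [hP1, hzero, zero_add] at hP13
  rw [hQ0, hzero, zero_add] at hQ03
  rw [ip_comm _ (M p 3)] at hP33 hQ33
  simp only [ip_smul_right, ip_add_right, ip_sub_right] at hP13 hP33 hQ03 hQ33
  have hkP : ip (M p 2) ((1 / 2 : ℝ) • (du (fun q => M q 3) p + dv (fun q => M q 3) p)) =
      -((du φ p + dv φ p) / 2) / 4 := by
    have hθ : HasFDerivAt (fun q => -(φ q / 2)) (totalForm (-(du φ p / 2)) (-(dv φ p / 2))) p :=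
      ((hasFDerivAt_totalForm hφd).mul_const (2⁻¹ : ℝ)).neg.congr_fderiv (by
        ext <;> simp [totalForm] <;> ring)
    -- The `m₁` coefficient of `normalQ` carries `(δ.re - δ.im) / 2` and `exp (-(φ / 2))`; pairing
    -- with `m₂` contributes another `1/2`, hence this `c` and `θ`.
    have := ip_directional_eq (θ := fun q => -(φ q / 2)) (c := (δ.re - δ.im) / 4) hU hp
      (by simpa using hd') (hasFDerivAt_totalForm
        (differentiableAt_of_contDiffOn (contDiffOn_du (hsm 1) hU) hU hp)) hYQ (hrow 3)
      hθ.differentiableAt (g := M p 1) (n := M p 2) (r := nullLog E (-1) p)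
      (β := (δ.re - δ.im) * (ε.re - ε.im) * Real.exp (φ p / 2) / 2) ?_ ?_ ?_ ?_
    · rw [du_eq_of_totalForm hθ, dv_eq_of_totalForm hθ, ip_add_right, ip_smul_right] at this
      rw [ip_smul_right, ip_add_right]
      linarith
    · intro q hq
      rw [hQ q hq, normalQ]
      simp only [ip_add_left, ip_smul_left, hip q hq]
      simp [nullGram]
      ring
    · rw [hQ p hp, normalQ, add_assoc]
      congr 3
      ring
    · rw [ip_add_right, ip_smul_right]
      linarith
    · rw [ip_add_right, ip_smul_right]
      linarith
  have hkQ : ip (M p 2) ((1 / 2 : ℝ) • (du (fun q => M q 3) p - dv (fun q => M q 3) p)) =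
      ((du φ p - dv φ p) / 2) / 4 := by
    have hθ : HasFDerivAt (fun q => φ q / 2) (totalForm (du φ p / 2) (dv φ p / 2)) p :=
      ((hasFDerivAt_totalForm hφd).mul_const (2⁻¹ : ℝ)).congr_fderiv (by
        ext <;> simp [totalForm] <;> ring)
    have := ip_directional_eq (θ := fun q => φ q / 2) (c := (δ.re + δ.im) / 4) hU hp
      (by simpa using hd) (hasFDerivAt_totalForm
        (differentiableAt_of_contDiffOn (contDiffOn_du (hsm 0) hU) hU hp)) hYP (hrow 3)
      hθ.differentiableAt (g := M p 0) (n := M p 2) (r := nullLog E 1 p)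
      (β := (δ.re + δ.im) * (ε.re + ε.im) * Real.exp (-(φ p / 2)) / 2) ?_ ?_ ?_ ?_
    · rw [du_eq_of_totalForm hθ, dv_eq_of_totalForm hθ, ip_add_right, ip_smul_right] at this
      rw [ip_smul_right, ip_sub_right]
      linarith
    · intro q hq
      rw [hP q hq, normalP]
      simp only [ip_add_left, ip_smul_left, hip q hq]
      simp [nullGram]
      ring
    · rw [hP p hp, normalP, add_assoc]
      congr 3
      ring
    · rw [ip_add_right, ip_smul_right]
      linarith
    · rw [ip_add_right, ip_smul_right]
      linarith
  -- The products involving the first two frame vectors come from the Gauss formulas and constancy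
  -- in the null directions, the last from the rotation coefficient just found. The derivative of
  -- the Gram matrix supplies all others, including the tangential parts of the derivatives of `m₁,
  -- m₂`.
  have hPall := eq_frameMul_of_gram (hneg p hp).ne (hgram p hp) hSP
    (by rw [hP0, ip_frameMul, hgram p hp]) (by rw [hP0, ip_frameMul, hgram p hp])
    (by rw [hP0, ip_frameMul, hgram p hp])
    (by rw [hP1, hzero]; simp [nullCoefP, coefP, Fin.sum_univ_four])
    (by rw [hP1, hzero]; simp [nullCoefP, coefP, Fin.sum_univ_four])
    (by rw [ip_comm, hkP]; simp [nullCoefP, coefP, nullGram, Fin.sum_univ_four]; ring)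
  have hQall := eq_frameMul_of_gram (hneg p hp).ne (hgram p hp) hSQ
    (by rw [hQ0, hzero]; simp [nullCoefQ, coefQ, Fin.sum_univ_four])
    (by rw [hQ0, hzero]; simp [nullCoefQ, coefQ, Fin.sum_univ_four])
    (by rw [hQ0, hzero]; simp [nullCoefQ, coefQ, Fin.sum_univ_four])
    (by rw [hQ1, ip_frameMul, hgram p hp]) (by rw [hQ1, ip_frameMul, hgram p hp])
    (by rw [ip_comm, hkQ]; simp [nullCoefQ, coefQ, nullGram, Fin.sum_univ_four]; ring)
  have hadd : ∀ (c d N : Fin 4 → Fin 4 → ℝ) (i : Fin 4),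
      frameMul (c + d) N i = frameMul c N i + frameMul d N i := fun c d N i => by
    funext k
    simp [frameMul, add_mul, Finset.sum_add_distrib]
  have hsub : ∀ (c d N : Fin 4 → Fin 4 → ℝ) (i : Fin 4),
      frameMul (c - d) N i = frameMul c N i - frameMul d N i := fun c d N i => by
    funext k
    simp [frameMul, sub_mul, Finset.sum_sub_distrib]
  refine hasFDerivAt_pi'.2 fun i => (hrow i).congr_fderiv ?_
  have h1 : du (fun q => M q i) p = frameMul (coefU E φ ε δ p) (M p) i := by
    rw [coefU, hadd, ← hPall, ← hQall]; module
  have h2 : dv (fun q => M q i) p = frameMul (coefV E φ ε δ p) (M p) i := by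
    rw [coefV, hsub, ← hPall, ← hQall]; module
  rw [h1, h2]
  ext1 <;> ext1 <;> simp [totalForm]

end FrameEquations

/-! ### Uniqueness up to a proper motion -/

section Uniqueness

open Metric Filter Topology

/-- The null frame `(x_u + x_v) / 2, (x_u - x_v) / 2, m₁, m₂` along a surface. -/
def nullFrame (x m₁ m₂ : ℝ × ℝ → Fin 4 → ℝ) (p : ℝ × ℝ) : Fin 4 → Fin 4 → ℝ :=
  ![(1 / 2 : ℝ) • (du x p + dv x p), (1 / 2 : ℝ) • (du x p - dv x p), m₁ p, m₂ p]

variable {U : Set (ℝ × ℝ)} {E φ : ℝ × ℝ → ℝ} {ε δ : DNum} {x m₁ m₂ : ℝ × ℝ → Fin 4 → ℝ}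
  {p : ℝ × ℝ}

theorem contDiffOn_nullFrame (hU : IsOpen U) (hx : ContDiffOn ℝ ∞ x U)
    (hm : IsIsotropicNormalFrame U x m₁ m₂) : ContDiffOn ℝ ∞ (nullFrame x m₁ m₂) U := by
  have hu := contDiffOn_du hx hU
  have hv := contDiffOn_dv hx hU
  exact contDiffOn_vec4 ((hu.add hv).const_smul _) ((hu.sub hv).const_smul _) hm.smooth₁ hm.smooth₂

theorem frameGram_nullFrame (hiso : IsIsothermal U x) (hm : IsIsotropicNormalFrame U x m₁ m₂)
    (hp : p ∈ U) : frameGram (nullFrame x m₁ m₂ p) = nullGram (coeffE x p) := by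
  obtain ⟨hEG, hF, -⟩ := hiso p hp
  obtain ⟨h1, h2⟩ := hm.normal₁ p hp
  obtain ⟨h3, h4⟩ := hm.normal₂ p hp
  obtain ⟨h5, h6⟩ := hm.isotropic p hp
  have h7 := hm.product p hp
  have h8 : ip (du x p) (m₁ p) = 0 := by rw [ip_comm, h1]
  have h9 : ip (dv x p) (m₁ p) = 0 := by rw [ip_comm, h2]
  have h10 : ip (du x p) (m₂ p) = 0 := by rw [ip_comm, h3]
  have h11 : ip (dv x p) (m₂ p) = 0 := by rw [ip_comm, h4]
  have h12 : ip (m₂ p) (m₁ p) = 1 / 2 := by rw [ip_comm, h7]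
  have h13 : ip (dv x p) (du x p) = 0 := by rw [ip_comm]; exact hF
  have h14 : ip (dv x p) (dv x p) = -coeffE x p := by rw [hEG, neg_neg]; rfl
  have h15 : ip (du x p) (du x p) = coeffE x p := rfl
  have h16 : ip (du x p) (dv x p) = 0 := hF
  funext i j
  fin_cases i <;> fin_cases j <;>
    simp [frameGram, nullFrame, nullGram, ip_smul_left, ip_smul_right, ip_add_left, ip_add_right,
      ip_sub_left, ip_sub_right, h1, h2, h3, h4, h5, h6, h7, h8, h9, h10, h11, h12, h13, h14, h15,
      h16] <;> ring

theorem det_nullFrame_neg (hiso : IsIsothermal U x) (hm : IsIsotropicNormalFrame U x m₁ m₂)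
    (hp : p ∈ U) : (Matrix.of (nullFrame x m₁ m₂ p)).det < 0 := by
  obtain ⟨hEG, -, hE⟩ := hiso p hp
  have hs : 0 < √(-coeffE x p) := Real.sqrt_pos.2 (by linarith)
  have hG : coeffG x p = -coeffE x p := by linarith
  have h := hm.oriented p hp
  rw [frameX1, frameX2, hG] at h
  have h' := h.smul hs hs
  rw [smul_inv_smul₀ hs.ne', smul_inv_smul₀ hs.ne'] at h'
  rw [nullFrame, ← rightOriented_null_iff]
  convert h' using 1 <;> module

/-- Comparing real and imaginary parts of the representation gives the normal parts of `(x_uu +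
x_vv)/2` and `x_uv`; by the wave equation the former is that of `x_uu`. Tangential terms do not
contribute against a normal vector. -/
theorem ip_normal_second (h : IsSurfaceWithData U x E φ ε δ)
    (hrep : ∀ p ∈ U, PhiPrimePerp x p =
      (δ * expj (φ p / 2)) • toD (m₁ p) + (ε * δ * expj (-(φ p / 2))) • toD (m₂ p))
    (hp : p ∈ U) {n : Fin 4 → ℝ} (hu : ip n (du x p) = 0) (hv : ip n (dv x p) = 0) :
    ip (du (du x) p) n = ip (normalP φ ε δ p (m₁ p) (m₂ p) + normalQ φ ε δ p (m₁ p) (m₂ p)) n ∧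
      ip (dv (du x) p) n =
        ip (normalP φ ε δ p (m₁ p) (m₂ p) - normalQ φ ε δ p (m₁ p) (m₂ p)) n := by
  have hcomp : ∀ i, (⟨normalPart x p ((1 / 2 : ℝ) • (du (du x) p + dv (dv x) p)) i,
      normalPart x p (dv (du x) p) i⟩ : DNum) =
      ⟨(normalP φ ε δ p (m₁ p) (m₂ p) + normalQ φ ε δ p (m₁ p) (m₂ p)) i,
        (normalP φ ε δ p (m₁ p) (m₂ p) - normalQ φ ε δ p (m₁ p) (m₂ p)) i⟩ := fun i => by
    rw [← PhiPrimePerp_eq h.isOpen h.smooth hp, hrep p hp, representation_apply]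
    rfl
  have h1 : normalPart x p ((1 / 2 : ℝ) • (du (du x) p + dv (dv x) p)) =
      normalP φ ε δ p (m₁ p) (m₂ p) + normalQ φ ε δ p (m₁ p) (m₂ p) :=
    funext fun i => congrArg QuadraticAlgebra.re (hcomp i)
  have h2 : normalPart x p (dv (du x) p) =
      normalP φ ε δ p (m₁ p) (m₂ p) - normalQ φ ε δ p (m₁ p) (m₂ p) :=
    funext fun i => congrArg QuadraticAlgebra.im (hcomp i)
  have hw : (1 / 2 : ℝ) • (du (du x) p + dv (dv x) p) = du (du x) p := by
    rw [← h.toIsMinimalSurface.wave h.isothermal hp]; module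
  rw [hw] at h1
  rw [← h1, ← h2, ip_normalPart_of_normal hu hv, ip_normalPart_of_normal hu hv]
  exact ⟨rfl, rfl⟩

/-- It suffices to establish the Gauss formulas for the two null tangent vectors, by testing them
against the frame: tangential components come from the Gram matrix, normal ones from the
representation of `Φ'^⊥`. Invertibility of `δ` in both null components lets `solvesFrame_of_gauss`
supply the rest. -/
theorem IsSurfaceWithData.solvesFrame (h : IsSurfaceWithData U x E φ ε δ)
    (hE : ContDiffOn ℝ ∞ E U) (hφ : ContDiffOn ℝ ∞ φ U) (hδ : δ = 1 ∨ δ = jj)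
    (hm : IsIsotropicNormalFrame U x m₁ m₂)
    (hrep : ∀ p ∈ U, PhiPrimePerp x p =
      (δ * expj (φ p / 2)) • toD (m₁ p) + (ε * δ * expj (-(φ p / 2))) • toD (m₂ p)) :
    SolvesFrame U (coefU E φ ε δ) (coefV E φ ε δ) (nullFrame x m₁ m₂) := by
  have hU := h.isOpen
  have hM := contDiffOn_nullFrame hU h.smooth hm
  have hneg : ∀ p ∈ U, E p < 0 := fun p hp => by
    rw [← h.coeffE_eq p hp]; exact (h.isothermal p hp).2.2
  have hgram : ∀ p ∈ U, frameGram (nullFrame x m₁ m₂ p) = nullGram (E p) := fun p hp => by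
    rw [frameGram_nullFrame h.isothermal hm hp, h.coeffE_eq p hp]
  have hu : ∀ p ∈ U, HasFDerivAt (du x) (totalForm (du (du x) p) (dv (du x) p)) p := fun p hp =>
    hasFDerivAt_totalForm (differentiableAt_of_contDiffOn (contDiffOn_du h.smooth hU) hU hp)
  have hv : ∀ p ∈ U, HasFDerivAt (dv x) (totalForm (dv (du x) p) (du (du x) p)) p := fun p hp => by
    rw [h.toIsMinimalSurface.wave h.isothermal hp, du_dv_comm hU h.smooth hp]
    exact hasFDerivAt_totalForm
      (differentiableAt_of_contDiffOn (contDiffOn_dv h.smooth hU) hU hp)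
  have hF : ∀ p ∈ U, HasFDerivAt (fun q => nullFrame x m₁ m₂ q 0)
      (totalForm ((1 / 2 : ℝ) • (du (du x) p + dv (du x) p))
        ((1 / 2 : ℝ) • (du (du x) p + dv (du x) p))) p := fun p hp => by
    refine (((hu p hp).add (hv p hp)).const_smul (1 / 2 : ℝ)).congr_fderiv ?_
    refine ContinuousLinearMap.ext fun w => ?_
    simp only [add_apply, smul_apply, totalForm_apply]
    module
  have hG : ∀ p ∈ U, HasFDerivAt (fun q => nullFrame x m₁ m₂ q 1)
      (totalForm ((1 / 2 : ℝ) • (du (du x) p - dv (du x) p))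
        (-((1 / 2 : ℝ) • (du (du x) p - dv (du x) p)))) p := fun p hp => by
    refine (((hu p hp).sub (hv p hp)).const_smul (1 / 2 : ℝ)).congr_fderiv ?_
    refine ContinuousLinearMap.ext fun w => ?_
    simp only [sub_apply, smul_apply, totalForm_apply]
    module
  have hF' : ∀ p ∈ U, dv (fun q => nullFrame x m₁ m₂ q 0) p =
      du (fun q => nullFrame x m₁ m₂ q 0) p := fun p hp => by
    rw [du_eq_of_totalForm (hF p hp), dv_eq_of_totalForm (hF p hp)]
  have hG' : ∀ p ∈ U, dv (fun q => nullFrame x m₁ m₂ q 1) p =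
      -du (fun q => nullFrame x m₁ m₂ q 1) p := fun p hp => by
    rw [du_eq_of_totalForm (hG p hp), dv_eq_of_totalForm (hG p hp)]
  have hrow : ∀ p ∈ U, ∀ i, HasFDerivAt (fun q => nullFrame x m₁ m₂ q i)
      (totalForm (du (fun q => nullFrame x m₁ m₂ q i) p)
        (dv (fun q => nullFrame x m₁ m₂ q i) p)) p := fun p hp i =>
    hasFDerivAt_totalForm (differentiableAt_of_contDiffOn (contDiffOn_pi.1 hM i) hU hp)
  have hip : ∀ q ∈ U, ∀ i j, ip (nullFrame x m₁ m₂ q i) (nullFrame x m₁ m₂ q j) =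
      nullGram (E q) i j := fun q hq i j => congrFun (congrFun (hgram q hq) i) j
  have hzero : ∀ y : Fin 4 → ℝ, ip 0 y = 0 := fun y => by simp [ip]
  have hcases : ∀ j : Fin 4, j = 0 ∨ j = 1 ∨ j = 2 ∨ j = 3 := by decide
  have hnorm : ∀ p ∈ U, ∀ i, i = 2 ∨ i = 3 →
      ip (du (du x) p) (nullFrame x m₁ m₂ p i) =
        ip (normalP φ ε δ p (m₁ p) (m₂ p) + normalQ φ ε δ p (m₁ p) (m₂ p))
          (nullFrame x m₁ m₂ p i) ∧
      ip (dv (du x) p) (nullFrame x m₁ m₂ p i) =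
        ip (normalP φ ε δ p (m₁ p) (m₂ p) - normalQ φ ε δ p (m₁ p) (m₂ p))
          (nullFrame x m₁ m₂ p i) := fun p hp i hi => by
    rcases hi with rfl | rfl
    · exact ip_normal_second h hrep hp (hm.normal₁ p hp).1 (hm.normal₁ p hp).2
    · exact ip_normal_second h hrep hp (hm.normal₂ p hp).1 (hm.normal₂ p hp).2
  refine solvesFrame_of_gauss hU hE hneg hφ hM ?_ ?_ hgram ?_ hF' ?_ hG'
  · rcases hδ with rfl | rfl <;> simp [jj, QuadraticAlgebra.re_one, QuadraticAlgebra.im_one]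
  · rcases hδ with rfl | rfl <;> simp [jj, QuadraticAlgebra.re_one, QuadraticAlgebra.im_one]
  · intro p hp
    have hS := fun i j => (gram_nullDeriv_eq (φ := φ) (ε := ε) (δ := δ) hU hE hneg hgram
      (hrow p hp) hp i j).1
    have hGP : gramAction (nullCoefP E φ ε δ p) (nullGram (E p)) = _ :=
      gramAction_coefP (exp_neg_logAbs_mul (hneg p hp))
    -- The first frame vector is null, so its derivative is orthogonal to it. In `h01` the second
    -- frame vector is constant in this direction, so the whole derivative of the product `E / 2`
    -- falls on the first.
    have h00 := (hS 0 0).trans (show _ = (0 : ℝ) by rw [hGP]; rfl)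
    have h01 := (hS 0 1).trans (show _ = E p * nullLog E 1 p / 2 by
      rw [hGP, nullLog, one_mul]; rfl)
    rw [hF' p hp, ip_comm (nullFrame x m₁ m₂ p 0)] at h00
    rw [hF' p hp, hG' p hp, add_neg_cancel, smul_zero, ip_comm (nullFrame x m₁ m₂ p 0), hzero,
      add_zero] at h01
    simp only [ip_smul_left, ip_add_left] at h00 h01
    refine eq_of_ip_frame_eq (hneg p hp).ne (hgram p hp) fun j => ?_
    rw [ip_add_left (nullLog E 1 p • _), ip_smul_left, hip p hp]
    rcases hcases j with rfl | rfl | rfl | rfl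
    · rw [normalP, ip_add_left, ip_smul_left, ip_smul_left, hip p hp, hip p hp]
      simp [nullGram]
      linarith
    · rw [normalP, ip_add_left, ip_smul_left, ip_smul_left, hip p hp, hip p hp]
      simp [nullGram]
      linarith
    · obtain ⟨h1, h2⟩ := hnorm p hp 2 (Or.inl rfl)
      rw [du_eq_of_totalForm (hF p hp), ip_smul_left, ip_add_left, h1, h2, ip_add_left,
        ip_sub_left]
      simp [nullGram]
      ring_nf
      rfl
    · obtain ⟨h1, h2⟩ := hnorm p hp 3 (Or.inr rfl)
      rw [du_eq_of_totalForm (hF p hp), ip_smul_left, ip_add_left, h1, h2, ip_add_left,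
        ip_sub_left]
      simp [nullGram]
      ring_nf
      rfl
  · intro p hp
    have hS := fun i j => (gram_nullDeriv_eq (φ := φ) (ε := ε) (δ := δ) hU hE hneg hgram
      (hrow p hp) hp i j).2
    have hGQ : gramAction (nullCoefQ E φ ε δ p) (nullGram (E p)) = _ :=
      gramAction_coefQ (exp_neg_logAbs_mul (hneg p hp))
    have h11 := (hS 1 1).trans (show _ = (0 : ℝ) by rw [hGQ]; rfl)
    have h10 := (hS 1 0).trans (show _ = E p * nullLog E (-1) p / 2 by
      rw [hGQ, nullLog, neg_one_mul, ← sub_eq_add_neg]; rfl)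
    rw [hG' p hp, ip_comm (nullFrame x m₁ m₂ p 1)] at h11
    rw [hF' p hp, hG' p hp, sub_self, smul_zero, ip_comm (nullFrame x m₁ m₂ p 1), hzero,
      add_zero] at h10
    simp only [ip_smul_left, sub_neg_eq_add, ip_add_left] at h10 h11
    refine eq_of_ip_frame_eq (hneg p hp).ne (hgram p hp) fun j => ?_
    rw [ip_add_left (nullLog E (-1) p • _), ip_smul_left, hip p hp]
    rcases hcases j with rfl | rfl | rfl | rfl
    · rw [normalQ, ip_add_left, ip_smul_left, ip_smul_left, hip p hp, hip p hp]
      simp [nullGram]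
      linarith
    · rw [normalQ, ip_add_left, ip_smul_left, ip_smul_left, hip p hp, hip p hp]
      simp [nullGram]
      linarith
    · obtain ⟨h1, h2⟩ := hnorm p hp 2 (Or.inl rfl)
      rw [du_eq_of_totalForm (hG p hp), ip_smul_left, ip_sub_left, h1, h2, ip_add_left,
        ip_sub_left]
      simp [nullGram]
      ring_nf
      rfl
    · obtain ⟨h1, h2⟩ := hnorm p hp 3 (Or.inr rfl)
      rw [du_eq_of_totalForm (hG p hp), ip_smul_left, ip_sub_left, h1, h2, ip_add_left,
        ip_sub_left]
      simp [nullGram]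
      ring_nf
      rfl

/-- Two surfaces with the same data differ locally by a proper motion. -/
theorem IsSurfaceWithData.exists_motion {D U' : Set (ℝ × ℝ)} {x' : ℝ × ℝ → Fin 4 → ℝ}
    (hD : IsOpen D) (hE : ContDiffOn ℝ ∞ E D) (hφ : ContDiffOn ℝ ∞ φ D)
    (hneg : ∀ p ∈ D, E p < 0) (hδ : δ = 1 ∨ δ = jj) {p₀ : ℝ × ℝ}
    (h : IsSurfaceWithData U x E φ ε δ) (h' : IsSurfaceWithData U' x' E φ ε δ)
    (hUD : U ⊆ D) (hUD' : U' ⊆ D) (hp₀ : p₀ ∈ U) (hp₀' : p₀ ∈ U') :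
    ∃ r > 0, ball p₀ r ⊆ U ∩ U' ∧ ∃ (A : Matrix (Fin 4) (Fin 4) ℝ) (b : Fin 4 → ℝ),
      IsProperMotion A ∧ ∀ p ∈ ball p₀ r, x' p = A.mulVec (x p) + b := by
  obtain ⟨m₁, m₂, hm, hrep⟩ := h.representation
  obtain ⟨m₁', m₂', hm', hrep'⟩ := h'.representation
  obtain ⟨r₁, hr₁, K, -, hA, hB⟩ := exists_coef_bound hD hE hφ hneg ε δ (hUD hp₀)
  obtain ⟨r₂, hr₂, hr₂U⟩ := Metric.isOpen_iff.1 (h.isOpen.inter h'.isOpen) p₀ ⟨hp₀, hp₀'⟩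
  have hM := (h.solvesFrame (hE.mono hUD) (hφ.mono hUD) hδ hm hrep)
  have hN := (h'.solvesFrame (hE.mono hUD') (hφ.mono hUD') hδ hm' hrep')
  have hgM := frameGram_nullFrame h.isothermal hm hp₀
  have hgN := frameGram_nullFrame h'.isothermal hm' hp₀'
  rw [h.coeffE_eq p₀ hp₀] at hgM
  rw [h'.coeffE_eq p₀ hp₀'] at hgN
  obtain ⟨A, hAm, hA0⟩ := TimelikeR42.exists_motion (hneg p₀ (hUD hp₀)).ne hgM hgN
    (det_nullFrame_neg h.isothermal hm hp₀) (det_nullFrame_neg h'.isothermal hm' hp₀')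
  have hsub : ball p₀ (min r₁ r₂) ⊆ U ∩ U' := (ball_subset_ball (min_le_right _ _)).trans hr₂U
  have hsub₁ : ball p₀ (min r₁ r₂) ⊆ ball p₀ r₁ := ball_subset_ball (min_le_left _ _)
  -- A constant matrix applied to every frame vector commutes with the frame equations, so the moved
  -- frame and the second frame solve the same system and agree at `p₀`.
  have heq := ((hM.mulVec A).mono (hsub.trans Set.inter_subset_left)).eqOn
    (hN.mono (hsub.trans Set.inter_subset_right)) (fun p hp => hA p (hsub₁ hp))
    (fun p hp => hB p (hsub₁ hp)) (funext hA0)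
  have hx : ∀ p ∈ ball p₀ (min r₁ r₂), HasFDerivAt (fun q => A.mulVec (x q))
      (totalForm (A.mulVec (du x p)) (A.mulVec (dv x p))) p := fun p hp =>
    hasFDerivAt_mulVec A (hasFDerivAt_totalForm
      (differentiableAt_of_contDiffOn h.smooth h.isOpen (hsub hp).1))
  have hx' : ∀ p ∈ ball p₀ (min r₁ r₂), HasFDerivAt x' (totalForm (du x' p) (dv x' p)) p :=
    fun p hp => hasFDerivAt_totalForm
      (differentiableAt_of_contDiffOn h'.smooth h'.isOpen (hsub hp).2)
  -- The two null tangent vectors determine the differential; maps with equal differentials on a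
  -- connected ball differ by a constant.
  obtain ⟨b, hb⟩ := isOpen_ball.exists_eq_add_of_fderiv_eq
    (convex_ball p₀ (min r₁ r₂)).isPreconnected
    (fun p hp => (hx' p hp).differentiableAt.differentiableWithinAt)
    (fun p hp => (hx p hp).differentiableAt.differentiableWithinAt) (fun p hp => by
      rw [(hx' p hp).fderiv, (hx p hp).fderiv]
      have h0 : A.mulVec ((1 / 2 : ℝ) • (du x p + dv x p)) =
        (1 / 2 : ℝ) • (du x' p + dv x' p) := congrFun (heq hp) 0
      have h1 : A.mulVec ((1 / 2 : ℝ) • (du x p - dv x p)) =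
        (1 / 2 : ℝ) • (du x' p - dv x' p) := congrFun (heq hp) 1
      rw [Matrix.mulVec_smul] at h0 h1
      rw [Matrix.mulVec_add] at h0
      rw [Matrix.mulVec_sub] at h1
      have h2 : du x' p = A.mulVec (du x p) := by
        funext k
        have e0 := congrFun h0 k
        have e1 := congrFun h1 k
        simp only [Pi.smul_apply, Pi.add_apply, Pi.sub_apply, smul_eq_mul] at e0 e1
        linarith
      have h3 : dv x' p = A.mulVec (dv x p) := by
        funext k
        have e0 := congrFun h0 k
        have e1 := congrFun h1 k
        simp only [Pi.smul_apply, Pi.add_apply, Pi.sub_apply, smul_eq_mul] at e0 e1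
        linarith
      rw [h2, h3])
  exact ⟨min r₁ r₂, lt_min hr₁ hr₂, hsub, A, b, hAm, hb⟩

end Uniqueness

end TimelikeR42

end

/-! ### Local existence and uniqueness -/

theorem mainTheorem4 (D : Set (ℝ × ℝ)) (hD : IsOpen D) (hDconn : IsConnected D)
    (E φ : ℝ × ℝ → ℝ) (hE : ContDiffOn ℝ ∞ E D) (hφ : ContDiffOn ℝ ∞ φ D)
    (ε δ : TimelikeR42.DNum) (hsys : TimelikeR42.SolvesNaturalSystem D E φ ε δ)
    (p₀ : ℝ × ℝ) (hp₀ : p₀ ∈ D) :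
    (∃ (D₀ : Set (ℝ × ℝ)) (x : ℝ × ℝ → Fin 4 → ℝ),
      IsConnected D₀ ∧ p₀ ∈ D₀ ∧ D₀ ⊆ D ∧ TimelikeR42.IsSurfaceWithData D₀ x E φ ε δ) ∧
    (∀ (D₀ D₀' : Set (ℝ × ℝ)) (x x' : ℝ × ℝ → Fin 4 → ℝ),
      p₀ ∈ D₀ → D₀ ⊆ D → TimelikeR42.IsSurfaceWithData D₀ x E φ ε δ →
      p₀ ∈ D₀' → D₀' ⊆ D → TimelikeR42.IsSurfaceWithData D₀' x' E φ ε δ →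
      ∃ D₁ : Set (ℝ × ℝ), IsOpen D₁ ∧ IsConnected D₁ ∧ p₀ ∈ D₁ ∧ D₁ ⊆ D₀ ∩ D₀' ∧
        ∃ (A : Matrix (Fin 4) (Fin 4) ℝ) (b : Fin 4 → ℝ), TimelikeR42.IsProperMotion A ∧
          ∀ p ∈ D₁, x' p = A.mulVec (x p) + b) := by
  refine ⟨?_, fun D₀ D₀' x x' hp hD₀ hx hp' hD₀' hx' => ?_⟩
  · obtain ⟨r, hr, hrD, x, hx⟩ := TimelikeR42.exists_isSurfaceWithData hD hE hφ hsys hp₀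
    exact ⟨Metric.ball p₀ r, x, (convex_ball p₀ r).isConnected ⟨p₀, Metric.mem_ball_self hr⟩,
      Metric.mem_ball_self hr, hrD, hx⟩
  · obtain ⟨r, hr, hsub, A, b, hA, hb⟩ := hx.exists_motion hD hE hφ hsys.E_neg hsys.del hx'
      hD₀ hD₀' hp hp'
    exact ⟨Metric.ball p₀ r, Metric.isOpen_ball,
      (convex_ball p₀ r).isConnected ⟨p₀, Metric.mem_ball_self hr⟩, Metric.mem_ball_self hr, hsub,
      A, b, hA, hb⟩
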